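/- A \emph{clique modulator} of a finite graph $G$ is a set $D\subseteq V(G)$ such that any two distinct vertices of $V(G)\setminus D$ are adjacent. An instance $I$ of \textsc{List Coloring Clique Modulator} consists of a finite simple graph $G$, a clique modulator $D$ of $G$ with $|D|=k$, and a finite list $L(v)$ of colors (natural numbers) for every $v\in V(G)$; the question is whether $G$ has a proper list coloring, i.e. a map $\lambda$ on $V(G)$ with $\lambda(v)\in L(v)$ for all $v$ and $\lambda(u)\neq\lambda(v)$ for all adjacent $u,v$. Let $|I|$ be the number of bits of the encoding of $I$ (number of vertices, adjacency matrix, indicator vector of $D$, and for each vertex the length and the entries of its list, all numbers in binary). \textbf{Theorem.} \textsc{List Coloring Clique Modulator} can be solved by a randomized algorithm in time $\mathcal O^*(2^k)$. Precisely: there is an absolute constant $c$ such that for every $\varepsilon>0$ there are a constant $C$ and a randomized program for the random access machine with logarithmic cost (integer arithmetic $+,-,\cdot$, division with remainder, comparisons, indirect addressing, fair coin tosses; every operation costs one plus the bit lengths of the numbers and addresses it handles) such that on every instance $I$ 1. the program halts within time $C\cdot 2^k\cdot|I|^c$, for every outcome of the coin tosses; 2. if $G$ has a proper list coloring, the program answers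 YES with probability at least $1-\varepsilon$; 3. if $G$ has no proper list coloring, the program answers NO for every outcome of the coin tosses. -/

import Mathlib

open MeasureTheory

/-! ### Randomized random access machines with logarithmic cost

Programs are structured programs over finitely many (those the program mentions) unbounded arrays
of integers.  Every elementary operation is charged the bit lengths of the numbers and of the
addresses that it handles (logarithmic cost criterion), so one unit of time corresponds to work on
a bounded number of bits. -/

/-- The number of binary digits of an integer (sign ignored). -/
def bitLen (z : ℤ) : ℕ := z.natAbs.size

/-- Elementary arithmetic operations and tests. -/
inductive RamOp
  | add | sub | mul | div | mod | eq | lt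

/-- Value of an elementary operation; tests return `1` for true and `0` for false. -/
def RamOp.eval : RamOp → ℤ → ℤ → ℤ
  | .add, x, y => x + y
  | .sub, x, y => x - y
  | .mul, x, y => x * y
  | .div, x, y => x / y
  | .mod, x, y => x % y
  | .eq, x, y => if x = y then 1 else 0
  | .lt, x, y => if x < y then 1 else 0

/-- Expressions: constants, array cells (indirect addressing), elementary operations. -/
inductive RamExpr
  | const (z : ℤ)
  | get (a : ℕ) (i : RamExpr)
  | op (o : RamOp) (e₁ e₂ : RamExpr)

/-- The memory: `mem a i` is the content of cell `i` of array `a`. -/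
abbrev RamMem := ℕ → ℤ → ℤ

/-- The value of an expression. -/
def RamExpr.eval (m : RamMem) : RamExpr → ℤ
  | .const z => z
  | .get a i => m a (i.eval m)
  | .op o e₁ e₂ => o.eval (e₁.eval m) (e₂.eval m)

/-- The time needed to evaluate an expression. -/
def RamExpr.cost (m : RamMem) : RamExpr → ℕ
  | .const z => 1 + bitLen z
  | .get a i => i.cost m + 1 + bitLen (i.eval m) + bitLen (m a (i.eval m))
  | .op _ e₁ e₂ => e₁.cost m + e₂.cost m + 1 + bitLen (e₁.eval m) + bitLen (e₂.eval m)

/-- Randomized programs. -/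
inductive RamProg
  /-- do nothing -/
  | skip
  /-- `a[i] := e` -/
  | store (a : ℕ) (i e : RamExpr)
  /-- `a[i] :=` a fresh fair random bit -/
  | flip (a : ℕ) (i : RamExpr)
  /-- sequential composition -/
  | seq (p q : RamProg)
  /-- if `b ≠ 0` then `p` else `q` -/
  | ite (b : RamExpr) (p q : RamProg)
  /-- while `b ≠ 0` do `p` -/
  | loop (b : RamExpr) (p : RamProg)

/-- A machine state: the memory, and the coin tosses that have not been used yet. -/
structure RamState where
  mem : RamMem
  coins : ℕ → Bool

/-- The memory `m` after the assignment `a[i] := z`. -/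
def RamMem.set (m : RamMem) (a : ℕ) (i z : ℤ) : RamMem :=
  Function.update m a (Function.update (m a) i z)

/-- `RamExec p s t s'`: started in state `s`, the program `p` halts in state `s'` after exactly
`t` units of time. -/
inductive RamExec : RamProg → RamState → ℕ → RamState → Prop
  | skip (s : RamState) : RamExec .skip s 1 s
  | store (a : ℕ) (i e : RamExpr) (s : RamState) :
      RamExec (.store a i e) s
        (i.cost s.mem + e.cost s.mem + 1 + bitLen (i.eval s.mem) + bitLen (e.eval s.mem))
        ⟨s.mem.set a (i.eval s.mem) (e.eval s.mem), s.coins⟩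
  | flip (a : ℕ) (i : RamExpr) (s : RamState) :
      RamExec (.flip a i) s
        (i.cost s.mem + 1 + bitLen (i.eval s.mem))
        ⟨s.mem.set a (i.eval s.mem) (if s.coins 0 then 1 else 0), fun j => s.coins (j + 1)⟩
  | seq (p q : RamProg) (s s₁ s₂ : RamState) (t₁ t₂ : ℕ) :
      RamExec p s t₁ s₁ → RamExec q s₁ t₂ s₂ → RamExec (.seq p q) s (t₁ + t₂) s₂
  | ite_true (b : RamExpr) (p q : RamProg) (s s' : RamState) (t : ℕ) :
      b.eval s.mem ≠ 0 → RamExec p s t s' → RamExec (.ite b p q) s (b.cost s.mem + 1 + t) s'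
  | ite_false (b : RamExpr) (p q : RamProg) (s s' : RamState) (t : ℕ) :
      b.eval s.mem = 0 → RamExec q s t s' → RamExec (.ite b p q) s (b.cost s.mem + 1 + t) s'
  | loop_true (b : RamExpr) (p : RamProg) (s s₁ s₂ : RamState) (t₁ t₂ : ℕ) :
      b.eval s.mem ≠ 0 → RamExec p s t₁ s₁ → RamExec (.loop b p) s₁ t₂ s₂ →
        RamExec (.loop b p) s (b.cost s.mem + 1 + t₁ + t₂) s₂
  | loop_false (b : RamExpr) (p : RamProg) (s : RamState) :
      b.eval s.mem = 0 → RamExec (.loop b p) s (b.cost s.mem + 1) s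

/-- For a fixed sequence of coin tosses the machine is deterministic: the final state and the
running time are unique. -/
theorem RamExec.unique {p : RamProg} {s s₁ s₂ : RamState} {t₁ t₂ : ℕ}
    (h₁ : RamExec p s t₁ s₁) (h₂ : RamExec p s t₂ s₂) : t₁ = t₂ ∧ s₁ = s₂ := by
  induction h₁ generalizing t₂ s₂ with
  | skip | store | flip => cases h₂; exact ⟨rfl, rfl⟩
  | seq p q s s₁ s₂ t₁ t₂ _ _ ih₁ ih₂ =>
    cases h₂ with
    | seq _ _ _ _ _ _ _ g₁ g₂ =>
      obtain ⟨rfl, rfl⟩ := ih₁ g₁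
      obtain ⟨rfl, rfl⟩ := ih₂ g₂
      exact ⟨rfl, rfl⟩
  | ite_true b p q s s' t hb _ ih =>
    cases h₂ with
    | ite_true _ _ _ _ _ _ _ g => obtain ⟨rfl, rfl⟩ := ih g; exact ⟨rfl, rfl⟩
    | ite_false _ _ _ _ _ _ hb' _ => exact absurd hb' hb
  | ite_false b p q s s' t hb _ ih =>
    cases h₂ with
    | ite_true _ _ _ _ _ _ hb' _ => exact absurd hb hb'
    | ite_false _ _ _ _ _ _ _ g => obtain ⟨rfl, rfl⟩ := ih g; exact ⟨rfl, rfl⟩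
  | loop_true b p s s₁ s₂ t₁ t₂ hb _ _ ih₁ ih₂ =>
    cases h₂ with
    | loop_true _ _ _ _ _ _ _ _ g₁ g₂ =>
      obtain ⟨rfl, rfl⟩ := ih₁ g₁
      obtain ⟨rfl, rfl⟩ := ih₂ g₂
      exact ⟨rfl, rfl⟩
    | loop_false _ _ _ hb' => exact absurd hb' hb
  | loop_false b p s hb =>
    cases h₂ with
    | loop_true _ _ _ _ _ _ _ hb' _ _ => exact absurd hb hb'
    | loop_false => exact ⟨rfl, rfl⟩

/-- The initial state: the input word stands in the cells `0, 1, 2, …` of array `0`, all other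
cells hold `0`, and the coin tosses will be `ω 0, ω 1, …`. -/
def RamState.init (x : List ℕ) (ω : ℕ → Bool) : RamState where
  mem a i := if a = 0 ∧ 0 ≤ i then (x.getD i.toNat 0 : ℕ) else 0
  coins := ω

/-- On input `x` and coin tosses `ω`, the program halts within `T` units of time. -/
def RamProg.HaltsWithin (p : RamProg) (x : List ℕ) (ω : ℕ → Bool) (T : ℕ) : Prop :=
  ∃ t s, RamExec p (RamState.init x ω) t s ∧ t ≤ T

/-- On input `x` and coin tosses `ω`, the program halts and answers YES, that is, it leaves a
nonzero number in cell `0` of array `1`. -/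
def RamProg.Accepts (p : RamProg) (x : List ℕ) (ω : ℕ → Bool) : Prop :=
  ∃ t s, RamExec p (RamState.init x ω) t s ∧ s.mem 1 0 ≠ 0

/-- The distribution of an infinite sequence of independent fair coin tosses. -/
noncomputable def coinMeasure : Measure (ℕ → Bool) :=
  Measure.infinitePi fun _ : ℕ => (PMF.uniformOfFintype Bool).toMeasure

/-! ### List Coloring Clique Modulator -/

/-- An instance: a finite graph, a clique modulator (a set of vertices whose removal leaves a
clique), and a list of colors for every vertex. -/
structure LCCMInstance where
  n : ℕ
  graph : SimpleGraph (Fin n)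
  modulator : Finset (Fin n)
  isClique : graph.IsClique ((modulator : Set (Fin n))ᶜ)
  colors : Fin n → List ℕ

/-- The parameter: the size of the given clique modulator. -/
def LCCMInstance.k (I : LCCMInstance) : ℕ := I.modulator.card

/-- The question: is there a proper list coloring? -/
def LCCMInstance.IsYes (I : LCCMInstance) : Prop :=
  ∃ c : I.graph.Coloring ℕ, ∀ v, c v ∈ I.colors v

open Classical in
/-- The instance as a word of natural numbers: the number of vertices, the adjacency matrix row by
row, the indicator vector of the modulator, and for every vertex the length of its color list
followed by the list itself. -/
noncomputable def LCCMInstance.encode (I : LCCMInstance) : List ℕ :=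
  [I.n]
    ++ (List.finRange I.n).flatMap
        (fun u => (List.finRange I.n).map fun v => if I.graph.Adj u v then 1 else 0)
    ++ (List.finRange I.n).map (fun v => if v ∈ I.modulator then 1 else 0)
    ++ (List.finRange I.n).flatMap (fun v => (I.colors v).length :: I.colors v)

/-- The size of an instance: the number of bits of its encoding, with one separator per number. -/
noncomputable def LCCMInstance.size (I : LCCMInstance) : ℕ :=
  (I.encode.map fun x => x.size + 1).sum

/-! ### Expressions: notation, evaluation and cost -/

/-! Let `Q` be the length of the input word, and represent a color by the position of its first
occurrence in the word. Consider Q × Q matrices whose columns are positions and whose rows are the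
vertices outside the modulator D, padded with dummy rows that impose no condition. The vertices
outside D form a clique, so a proper coloring sends them to distinct columns, and this injection
extends to a permutation between columns and rows. The colors on D are recorded by a set X_c ⊆ D for
each column c. Hence a proper list coloring exists iff some permutation σ and some sets X_c covering
D make every triple (σ c, c, X_c) `good` (`isYes_of_cover`, `cover_of_isYes`). Covering suffices
instead of partitioning: a vertex covered twice may choose either color.

For fixed σ, the covering families are counted by inclusion–exclusion over S ⊆ D: up to the sign
(-1)^k, the count is Σ_S (-1)^|S| ∏_c #{X ⊆ S good for (σ c, c)}. Give entry (a, c) a weight r_{ac}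
independent of S and sum over all σ with signs: for each S this is a determinant. By `sieveDet_eq`
the alternating sum of these 2^k determinants is a polynomial in the weights whose coefficient at ∏
r_{σ c, c} is ± the number of covers for σ. Different permutations give different monomials, so
nothing cancels. On a NO instance all coefficients vanish and the value is 0 for every choice of
weights, whence the one-sided error. On a YES instance the polynomial is nonzero of degree at most
Q, and by Schwartz–Zippel random weights of b = Q + e₀ bits annihilate it with probability at most Q
/ 2^b ≤ 2^(-e₀).

For the running time, the numbers of good X ⊆ S are found for all S together by the subset sum
transformation in k rounds. Each determinant is obtained over ℤ from the traces of the powers of the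
matrix by Newton's identities (`Matrix.mul_revCharCoeff`), where all divisions are exact and all
numbers have polynomially many bits. Every table except the coin tosses is filled by one loop
pattern, `sumFill`, whose cost is a constant times the number of iterations times the bit bound `W`.
-/

instance : Add RamExpr := ⟨.op .add⟩
instance : Sub RamExpr := ⟨.op .sub⟩
instance : Mul RamExpr := ⟨.op .mul⟩
instance : Div RamExpr := ⟨.op .div⟩
instance : Mod RamExpr := ⟨.op .mod⟩
instance (n : ℕ) : OfNat RamExpr n := ⟨.const n⟩

namespace RamExpr

/-- The test `e₁ = e₂`. -/
def isEq (e₁ e₂ : RamExpr) : RamExpr := .op .eq e₁ e₂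

/-- The test `e₁ < e₂`. -/
def isLt (e₁ e₂ : RamExpr) : RamExpr := .op .lt e₁ e₂

/-- `if t then e₁ else e₂` for a test `t` with values `0` and `1`. -/
def cond (t e₁ e₂ : RamExpr) : RamExpr := t * e₁ + (1 - t) * e₂

variable (m : RamMem)

@[simp] theorem eval_add (e₁ e₂ : RamExpr) : (e₁ + e₂).eval m = e₁.eval m + e₂.eval m := rfl
@[simp] theorem eval_sub (e₁ e₂ : RamExpr) : (e₁ - e₂).eval m = e₁.eval m - e₂.eval m := rfl
@[simp] theorem eval_mul (e₁ e₂ : RamExpr) : (e₁ * e₂).eval m = e₁.eval m * e₂.eval m := rfl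
@[simp] theorem eval_div (e₁ e₂ : RamExpr) : (e₁ / e₂).eval m = e₁.eval m / e₂.eval m := rfl
@[simp] theorem eval_mod (e₁ e₂ : RamExpr) : (e₁ % e₂).eval m = e₁.eval m % e₂.eval m := rfl
@[simp] theorem eval_isEq (e₁ e₂ : RamExpr) :
    (isEq e₁ e₂).eval m = if e₁.eval m = e₂.eval m then 1 else 0 := rfl
@[simp] theorem eval_isLt (e₁ e₂ : RamExpr) :
    (isLt e₁ e₂).eval m = if e₁.eval m < e₂.eval m then 1 else 0 := rfl
@[simp] theorem eval_get (a : ℕ) (i : RamExpr) : (get a i).eval m = m a (i.eval m) := rfl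
@[simp] theorem eval_const (z : ℤ) : (const z).eval m = z := rfl
@[simp] theorem eval_zero : (0 : RamExpr).eval m = 0 := rfl
@[simp] theorem eval_one : (1 : RamExpr).eval m = 1 := rfl

/-- The factor by which the value of an expression can be longer than the cells it reads. -/
def lenFactor : RamExpr → ℕ
  | .const z => 1 + bitLen z
  | .get _ _ => 1
  | .op _ e₁ e₂ => e₁.lenFactor + e₂.lenFactor

/-- The cost of an expression per bit of the longest cell of the memory. -/
def costFactor : RamExpr → ℕ
  | .const z => 1 + bitLen z
  | .get _ i => i.costFactor + 1 + i.lenFactor + 1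
  | .op _ e₁ e₂ => e₁.costFactor + e₂.costFactor + 1 + e₁.lenFactor + e₂.lenFactor

theorem one_le_lenFactor (e : RamExpr) : 1 ≤ e.lenFactor := by
  induction e with
  | const z => simp [lenFactor]
  | get a i => simp [lenFactor]
  | op o e₁ e₂ h₁ h₂ => simp only [lenFactor]; omega

end RamExpr

/-- All cells of the memory hold numbers of at most `W` binary digits. -/
def RamMem.Bounded (W : ℕ) (m : RamMem) : Prop := ∀ a i, (m a i).natAbs < 2 ^ W

theorem bitLen_le_iff {z : ℤ} {W : ℕ} : bitLen z ≤ W ↔ z.natAbs < 2 ^ W := Nat.size_le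

/-- Multiplication adds the lengths. The other operations are dominated by it, because 2^p + 2^q ≤
2^(p+q) once p and q are positive; this is why every `lenFactor` is at least 1. -/
theorem RamOp.natAbs_eval_lt (o : RamOp) {x y : ℤ} {p q : ℕ} (hp : 1 ≤ p) (hq : 1 ≤ q)
    (hx : x.natAbs < 2 ^ p) (hy : y.natAbs < 2 ^ q) : (o.eval x y).natAbs < 2 ^ (p + q) := by
  have h2p : 2 ≤ 2 ^ p := by simpa using Nat.pow_le_pow_right (n := 2) (by norm_num) hp
  have h2q : 2 ≤ 2 ^ q := by simpa using Nat.pow_le_pow_right (n := 2) (by norm_num) hq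
  have hs : 2 ^ p + 2 ^ q ≤ 2 ^ (p + q) := by rw [pow_add]; nlinarith
  have h1 : 1 < 2 ^ (p + q) := by omega
  cases o with
  | add => simp only [RamOp.eval]; omega
  | sub => simp only [RamOp.eval]; omega
  | mul =>
    simp only [RamOp.eval, Int.natAbs_mul, pow_add]
    exact Nat.mul_lt_mul'' hx hy
  | div =>
    simp only [RamOp.eval]
    have := Int.natAbs_ediv_le_natAbs x y
    omega
  | mod =>
    simp only [RamOp.eval]
    rcases eq_or_ne y 0 with rfl | h
    · simp only [Int.emod_zero]; omega
    · have h1 := Int.emod_nonneg x h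
      have h2 := Int.emod_lt_abs x h
      rw [Int.abs_eq_natAbs] at h2
      omega
  | eq => simp only [RamOp.eval]; split_ifs <;> simp <;> omega
  | lt => simp only [RamOp.eval]; split_ifs <;> simp <;> omega

/-! ### Bit length and cost of expressions in a bounded memory -/

namespace RamExpr

variable {m : RamMem} {W : ℕ}

/-- Lengths add along operations and restart at `W` whenever a cell is read. So for a fixed program
all costs reduce to syntactic constants times `W`, as long as the memory is kept bounded. -/
theorem bitLen_eval_le (hW : 1 ≤ W) (hm : m.Bounded W) (e : RamExpr) :
    bitLen (e.eval m) ≤ e.lenFactor * W := by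
  induction e with
  | const z => simp only [eval_const, lenFactor]; nlinarith
  | get a i => simpa [lenFactor] using bitLen_le_iff.2 (hm a _)
  | op o e₁ e₂ h₁ h₂ =>
    rw [bitLen_le_iff] at h₁ h₂ ⊢
    rw [lenFactor, add_mul]
    exact o.natAbs_eval_lt (Nat.mul_pos e₁.one_le_lenFactor hW)
      (Nat.mul_pos e₂.one_le_lenFactor hW) h₁ h₂

theorem cost_le (hW : 1 ≤ W) (hm : m.Bounded W) (e : RamExpr) :
    e.cost m ≤ e.costFactor * W := by
  induction e with
  | const z => simp only [cost, costFactor]; nlinarith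
  | get a i h =>
    have h1 := i.bitLen_eval_le hW hm
    have h2 := bitLen_le_iff.2 (hm a (i.eval m))
    simp only [cost, costFactor]; nlinarith
  | op o e₁ e₂ h₁ h₂ =>
    have h3 := e₁.bitLen_eval_le hW hm
    have h4 := e₂.bitLen_eval_le hW hm
    simp only [cost, costFactor]; nlinarith

end RamExpr

theorem RamMem.set_apply (m : RamMem) (a : ℕ) (i z : ℤ) (b : ℕ) (j : ℤ) :
    m.set a i z b j = if b = a ∧ j = i then z else m b j := by
  unfold RamMem.set
  by_cases h : b = a
  · subst h
    by_cases h' : j = i <;> simp [h']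
  · simp [h]

theorem RamMem.set_of_ne (m : RamMem) {a b : ℕ} (i z : ℤ) (h : b ≠ a) : m.set a i z b = m b := by
  simp [RamMem.set, h]

theorem RamMem.Bounded.set {m : RamMem} {W : ℕ} (hm : m.Bounded W) (a : ℕ) (i : ℤ) {z : ℤ}
    (hz : z.natAbs < 2 ^ W) : (m.set a i z).Bounded W := by
  intro b j
  rw [RamMem.set_apply]
  split_ifs
  · exact hz
  · exact hm b j

/-! ### Programs: partial specifications with time bounds -/

/-- Started in `s`, the program halts within `T` units of time in a state satisfying `Φ`. -/
def RamProg.Runs (p : RamProg) (s : RamState) (T : ℕ) (Φ : RamState → Prop) : Prop :=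
  ∃ t s', RamExec p s t s' ∧ t ≤ T ∧ Φ s'

namespace RamProg

theorem Runs.mono {p : RamProg} {s : RamState} {T T' : ℕ} {Φ Ψ : RamState → Prop}
    (h : p.Runs s T Φ) (hT : T ≤ T') (hΦ : ∀ s', Φ s' → Ψ s') : p.Runs s T' Ψ := by
  obtain ⟨t, s', h1, h2, h3⟩ := h
  exact ⟨t, s', h1, h2.trans hT, hΦ _ h3⟩

theorem Runs.seq {p q : RamProg} {s : RamState} {T₁ T₂ : ℕ} {Φ Ψ : RamState → Prop}
    (hp : p.Runs s T₁ Φ) (hq : ∀ s', Φ s' → q.Runs s' T₂ Ψ) :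
    (RamProg.seq p q).Runs s (T₁ + T₂) Ψ := by
  obtain ⟨t, s', h1, h2, h3⟩ := hp
  obtain ⟨u, s'', g1, g2, g3⟩ := hq s' h3
  exact ⟨t + u, s'', .seq _ _ _ _ _ _ _ h1 g1, by omega, g3⟩

/-- The cost of an assignment per bit of the longest cell of the memory. -/
def storeFactor (i e : RamExpr) : ℕ :=
  i.costFactor + e.costFactor + 1 + i.lenFactor + e.lenFactor

theorem runs_store {W : ℕ} (hW : 1 ≤ W) (a : ℕ) (i e : RamExpr) {s : RamState}
    (hs : s.mem.Bounded W) {Φ : RamState → Prop}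
    (hΦ : Φ ⟨s.mem.set a (i.eval s.mem) (e.eval s.mem), s.coins⟩) :
    (RamProg.store a i e).Runs s (storeFactor i e * W) Φ := by
  refine ⟨_, _, .store a i e s, ?_, hΦ⟩
  have h1 := i.cost_le hW hs
  have h2 := e.cost_le hW hs
  have h3 := i.bitLen_eval_le hW hs
  have h4 := e.bitLen_eval_le hW hs
  simp only [storeFactor]; nlinarith

theorem runs_flip {W : ℕ} (hW : 1 ≤ W) (a : ℕ) (i : RamExpr) {s : RamState}
    (hs : s.mem.Bounded W) {Φ : RamState → Prop}
    (hΦ : Φ ⟨s.mem.set a (i.eval s.mem) (if s.coins 0 then 1 else 0), fun j => s.coins (j + 1)⟩) :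
    (RamProg.flip a i).Runs s (storeFactor i 0 * W) Φ := by
  refine ⟨_, _, .flip a i s, ?_, hΦ⟩
  have h1 := i.cost_le hW hs
  have h3 := i.bitLen_eval_le hW hs
  simp only [storeFactor]; nlinarith

/-- Induction on the number of remaining rounds. The invariant is indexed by the round and forces
exactly `N` rounds, so termination needs no separate argument. -/
theorem runs_loop {b : RamExpr} {p : RamProg} {N T G : ℕ} {Φ : ℕ → RamState → Prop}
    (hstep : ∀ j < N, ∀ s, Φ j s →
      b.eval s.mem ≠ 0 ∧ b.cost s.mem ≤ G ∧ p.Runs s T (Φ (j + 1)))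
    (hend : ∀ s, Φ N s → b.eval s.mem = 0 ∧ b.cost s.mem ≤ G) {s : RamState} (hs : Φ 0 s) :
    (RamProg.loop b p).Runs s (N * (G + 1 + T) + (G + 1)) (Φ N) := by
  suffices H : ∀ r j, j + r = N → ∀ s, Φ j s →
      (RamProg.loop b p).Runs s (r * (G + 1 + T) + (G + 1)) (Φ N) from H N 0 (by omega) s hs
  intro r
  induction r with
  | zero =>
    intro j hj s h
    obtain rfl : j = N := by omega
    obtain ⟨h1, h2⟩ := hend s h
    exact ⟨_, s, .loop_false _ _ _ h1, by omega, h⟩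
  | succ r ih =>
    intro j hj s h
    obtain ⟨h1, h2, t, s', h3, h4, h5⟩ := hstep j (by omega) s h
    obtain ⟨t', s'', g1, g2, g3⟩ := ih (j + 1) (by omega) s' h5
    refine ⟨_, s'', .loop_true _ _ _ _ _ _ _ h1 h3 g1, ?_, g3⟩
    rw [add_mul]; omega

end RamProg

/-! ### Filling an array -/

/-- The scratch arrays hold the outer index, the inner index, and the accumulator. -/
def scratch (b : ℕ) : Prop := b = 101 ∨ b = 102 ∨ b = 103

/-- The outer index. -/
def vJ : RamExpr := .get 101 0
/-- The inner index. -/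
def vI : RamExpr := .get 102 0
/-- The accumulated sum. -/
def vAcc : RamExpr := .get 103 0

@[simp] theorem eval_vJ (m : RamMem) : vJ.eval m = m 101 0 := rfl
@[simp] theorem eval_vI (m : RamMem) : vI.eval m = m 102 0 := rfl
@[simp] theorem eval_vAcc (m : RamMem) : vAcc.eval m = m 103 0 := rfl

/-- `acc := ∑ i < M, E i`. -/
def sumLoop (M E : RamExpr) : RamProg :=
  .loop (.isLt vI M) (.seq (.store 103 0 (vAcc + E)) (.store 102 0 (vI + 1)))

/-- `for j < N do a[j] := F j (∑ i < M, E j i)`. -/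
def sumFill (a : ℕ) (N M E F : RamExpr) : RamProg :=
  .seq (.store 101 0 0) (.loop (.isLt vJ N)
    (.seq (.store 103 0 0) (.seq (.store 102 0 0) (.seq (sumLoop M E)
      (.seq (.store a vJ F) (.store 101 0 (vJ + 1)))))))

/-- `for j < N do a[j] := random bit`. -/
def flipFill (a : ℕ) (N : RamExpr) : RamProg :=
  .seq (.store 101 0 0) (.loop (.isLt vJ N) (.seq (.flip a vJ) (.store 101 0 (vJ + 1))))

/-- The running time of `sumFill` per iteration and bit. -/
def sumFillFactor (N M E F : RamExpr) : ℕ :=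
  RamProg.storeFactor 0 0 + ((RamExpr.isLt vJ N).costFactor + 1 +
    (RamProg.storeFactor 0 0 + (RamProg.storeFactor 0 0 +
      (((RamExpr.isLt vI M).costFactor + 1 +
        (RamProg.storeFactor 0 (vAcc + E) + RamProg.storeFactor 0 (vI + 1))) +
        (RamProg.storeFactor vJ F + RamProg.storeFactor 0 (vJ + 1))))))

/-- The running time of `flipFill` per iteration and bit. -/
def flipFillFactor (N : RamExpr) : ℕ :=
  RamProg.storeFactor 0 0 + ((RamExpr.isLt vJ N).costFactor + 1 +
    (RamProg.storeFactor vJ 0 + RamProg.storeFactor 0 (vJ + 1)))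

/-- The memory `m` agrees with `m₀` outside array `a` and the scratch arrays. -/
def FrameEq (a : ℕ) (m₀ m : RamMem) : Prop := ∀ b, b ≠ a → ¬ scratch b → m b = m₀ b

theorem FrameEq.set {a : ℕ} {m₀ m : RamMem} (h : FrameEq a m₀ m) {b : ℕ} (hb : b = a ∨ scratch b)
    (i z : ℤ) : FrameEq a m₀ (m.set b i z) := by
  intro c hc hc'
  rw [RamMem.set_of_ne _ _ _ (by rintro rfl; tauto)]
  exact h c hc hc'

/-- What holds after `j` cells of the array `a` have been filled with the values of `g`. -/
structure Filled (a : ℕ) (m₀ : RamMem) (W : ℕ) (g : ℕ → ℤ) (j : ℕ) (m : RamMem) : Prop where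
  frame : FrameEq a m₀ m
  bounded : m.Bounded W
  vals : ∀ i < j, m a i = g i

theorem Filled.set_scratch {a : ℕ} {m₀ m : RamMem} {W j : ℕ} {g : ℕ → ℤ}
    (h : Filled a m₀ W g j m) (ha : ¬ scratch a) {b : ℕ} (hb : scratch b) (i : ℤ) {z : ℤ}
    (hz : z.natAbs < 2 ^ W) : Filled a m₀ W g j (m.set b i z) where
  frame := h.frame.set (.inr hb) i z
  bounded := h.bounded.set b i hz
  vals i hi := by
    rw [RamMem.set_of_ne _ _ _ (by rintro rfl; exact ha hb)]
    exact h.vals i hi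

theorem Filled.set_next {a : ℕ} {m₀ m : RamMem} {W j : ℕ} {g : ℕ → ℤ}
    (h : Filled a m₀ W g j m) (hz : (g j).natAbs < 2 ^ W) :
    Filled a m₀ W g (j + 1) (m.set a j (g j)) where
  frame := h.frame.set (.inl rfl) _ _
  bounded := h.bounded.set _ _ hz
  vals i hi := by
    rw [RamMem.set_apply]
    rcases Nat.lt_succ_iff_lt_or_eq.1 hi with h' | rfl
    · rw [if_neg (by omega)]
      exact h.vals i h'
    · simp

section Fill

variable {a : ℕ} {m₀ : RamMem} {W Nn Mm : ℕ} {N M E F : RamExpr} {g : ℕ → ℤ} {h : ℕ → ℕ → ℤ}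

theorem runs_sumLoop (hW : 1 ≤ W) (ha : ¬ scratch a) {j : ℕ}
    (hMW : Mm < 2 ^ W)
    (hM : ∀ m, FrameEq a m₀ m → M.eval m = Mm)
    (hE : ∀ i < Mm, ∀ m, Filled a m₀ W g j m → m 101 0 = j → m 102 0 = i → E.eval m = h j i)
    (hb : ∑ i ∈ Finset.range Mm, (h j i).natAbs < 2 ^ W) {s : RamState}
    (hs : Filled a m₀ W g j s.mem) (hJ : s.mem 101 0 = j) (hI : s.mem 102 0 = 0)
    (hA : s.mem 103 0 = 0) :
    (sumLoop M E).Runs s ((Mm + 1) * (((RamExpr.isLt vI M).costFactor + 1 +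
        (RamProg.storeFactor 0 (vAcc + E) + RamProg.storeFactor 0 (vI + 1))) * W))
      (fun s' => s'.coins = s.coins ∧ Filled a m₀ W g j s'.mem ∧ s'.mem 101 0 = j ∧
        s'.mem 103 0 = ∑ i ∈ Finset.range Mm, h j i) := by
  -- The accumulator holds each partial sum in turn; bounding the sum of absolute values bounds them
  -- all.
  have hpart : ∀ i ≤ Mm, (∑ i ∈ Finset.range i, h j i).natAbs < 2 ^ W := fun i hi =>
    ((Int.natAbs_sum_le _ _).trans (Finset.sum_le_sum_of_subset
      (Finset.range_mono hi))).trans_lt hb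
  refine (RamProg.runs_loop (N := Mm) (G := (RamExpr.isLt vI M).costFactor * W)
    (T := RamProg.storeFactor 0 (vAcc + E) * W + RamProg.storeFactor 0 (vI + 1) * W)
    (Φ := fun i s' => s'.coins = s.coins ∧ Filled a m₀ W g j s'.mem ∧ s'.mem 101 0 = j ∧
        s'.mem 102 0 = i ∧ s'.mem 103 0 = ∑ i ∈ Finset.range i, h j i)
    ?_ ?_ ⟨rfl, hs, hJ, by simpa using hI, by simpa using hA⟩).mono ?_ ?_
  · rintro i hi s' ⟨h1, h2, h3, h4, h5⟩
    refine ⟨?_, RamExpr.cost_le hW h2.bounded _, ?_⟩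
    · simp [h4, hM _ h2.frame, hi]
    have e1 : (vAcc + E).eval s'.mem = ∑ i ∈ Finset.range (i + 1), h j i := by
      rw [Finset.sum_range_succ, RamExpr.eval_add, eval_vAcc, h5, hE i hi _ h2 h3 h4]
    refine (RamProg.runs_store hW 103 0 _ h2.bounded (Φ := fun s'' => s''.coins = s.coins ∧
      Filled a m₀ W g j s''.mem ∧ s''.mem 101 0 = j ∧ s''.mem 102 0 = i ∧
      s''.mem 103 0 = ∑ i ∈ Finset.range (i + 1), h j i) ?_).seq ?_
    · rw [e1]
      refine ⟨h1, h2.set_scratch ha (.inr (.inr rfl)) _ (hpart _ hi), ?_, ?_, ?_⟩ <;>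
        simp [RamMem.set_apply, h3, h4]
    · rintro s'' ⟨g1, g2, g3, g4, g5⟩
      refine RamProg.runs_store hW 102 0 _ g2.bounded ?_
      refine ⟨g1, g2.set_scratch ha (.inr (.inl rfl)) _ ?_, ?_, ?_, ?_⟩
      · simp only [RamExpr.eval_add, eval_vI, g4, RamExpr.eval_one]; omega
      all_goals simp [RamMem.set_apply, g3, g4, g5]
  · rintro s' ⟨h1, h2, h3, h4, h5⟩
    exact ⟨by simp [h4, hM _ h2.frame], RamExpr.cost_le hW h2.bounded _⟩
  · nlinarith
  · rintro s' ⟨h1, h2, h3, h4, h5⟩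
    exact ⟨h1, h2, h3, h5⟩

/-- `E` and `F` are evaluated in memories where the cells of `a` below `j` are already correct.
Tables defined by recursion on earlier cells are therefore covered by the same loop pattern. -/
theorem runs_sumFill (hW : 1 ≤ W) (ha : ¬ scratch a) (hNW : Nn < 2 ^ W) (hMW : Mm < 2 ^ W)
    (hN : ∀ m, FrameEq a m₀ m → N.eval m = Nn) (hM : ∀ m, FrameEq a m₀ m → M.eval m = Mm)
    (hE : ∀ j < Nn, ∀ i < Mm, ∀ m, Filled a m₀ W g j m → m 101 0 = j → m 102 0 = i →
      E.eval m = h j i)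
    (hF : ∀ j < Nn, ∀ m, Filled a m₀ W g j m → m 101 0 = j →
      m 103 0 = ∑ i ∈ Finset.range Mm, h j i → F.eval m = g j)
    (hb : ∀ j < Nn, ∑ i ∈ Finset.range Mm, (h j i).natAbs < 2 ^ W)
    (hg : ∀ j < Nn, (g j).natAbs < 2 ^ W) {s : RamState} (hm : s.mem = m₀)
    (hs : s.mem.Bounded W) :
    (sumFill a N M E F).Runs s (sumFillFactor N M E F * W * ((Nn + 1) * (Mm + 1)))
      (fun s' => s'.coins = s.coins ∧ Filled a m₀ W g Nn s'.mem) := by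
  subst hm
  have hz : (0 : ℤ).natAbs < 2 ^ W := by simp
  refine ((RamProg.runs_store hW 101 0 0 hs (Φ := fun s' => s'.coins = s.coins ∧
      Filled a s.mem W g 0 s'.mem ∧ s'.mem 101 0 = 0) ?_).seq
    (T₂ := Nn * ((RamExpr.isLt vJ N).costFactor * W + 1 +
      (RamProg.storeFactor 0 0 * W + (RamProg.storeFactor 0 0 * W +
      ((Mm + 1) * (((RamExpr.isLt vI M).costFactor + 1 +
        (RamProg.storeFactor 0 (vAcc + E) + RamProg.storeFactor 0 (vI + 1))) * W) +
      (RamProg.storeFactor vJ F * W + RamProg.storeFactor 0 (vJ + 1) * W))))) +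
      ((RamExpr.isLt vJ N).costFactor * W + 1)) ?_).mono ?_ (fun _ h => h)
  · refine ⟨rfl, ⟨?_, hs.set _ _ hz, by simp⟩, by simp [RamMem.set_apply]⟩
    exact FrameEq.set (fun _ _ _ => rfl) (.inr (.inl rfl)) _ _
  · rintro s₁ ⟨h1, h2, h3⟩
    refine (RamProg.runs_loop (Φ := fun j s' => s'.coins = s.coins ∧
      Filled a s.mem W g j s'.mem ∧ s'.mem 101 0 = j) ?_ ?_ ⟨h1, h2, by simpa using h3⟩).mono
      le_rfl ?_
    · rintro j hj s₂ ⟨h1, h2, h3⟩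
      refine ⟨by simp [h3, hN _ h2.frame, hj], RamExpr.cost_le hW h2.bounded _, ?_⟩
      refine (RamProg.runs_store hW 103 0 0 h2.bounded (Φ := fun s' => s'.coins = s.coins ∧
        Filled a s.mem W g j s'.mem ∧ s'.mem 101 0 = j ∧ s'.mem 103 0 = 0) ?_).seq ?_
      · refine ⟨h1, h2.set_scratch ha (.inr (.inr rfl)) _ hz, ?_, ?_⟩ <;>
          simp [RamMem.set_apply, h3]
      rintro s₃ ⟨h1, h2, h3, h4⟩
      refine (RamProg.runs_store hW 102 0 0 h2.bounded (Φ := fun s' => s'.coins = s.coins ∧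
        Filled a s.mem W g j s'.mem ∧ s'.mem 101 0 = j ∧ s'.mem 102 0 = 0 ∧
        s'.mem 103 0 = 0) ?_).seq ?_
      · refine ⟨h1, h2.set_scratch ha (.inr (.inl rfl)) _ hz, ?_, ?_, ?_⟩ <;>
          simp [RamMem.set_apply, h3, h4]
      rintro s₄ ⟨h1, h2, h3, h4, h5⟩
      refine (runs_sumLoop hW ha hMW hM (hE j hj) (hb j hj) h2 h3 h4 h5).seq ?_
      rintro s₅ ⟨h1', h2, h3, h4⟩
      refine (RamProg.runs_store hW a vJ F h2.bounded (Φ := fun s' => s'.coins = s.coins ∧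
        Filled a s.mem W g (j + 1) s'.mem ∧ s'.mem 101 0 = j) ?_).seq ?_
      · rw [eval_vJ, h3, hF j hj _ h2 h3 h4]
        refine ⟨h1'.trans h1, h2.set_next (hg j hj), ?_⟩
        exact (congrFun (RamMem.set_of_ne _ _ _ (by rintro rfl; exact ha (.inl rfl))) 0).trans h3
      rintro s₆ ⟨h1, h2, h3⟩
      refine RamProg.runs_store hW 101 0 _ h2.bounded ?_
      refine ⟨h1, h2.set_scratch ha (.inl rfl) _ ?_, ?_⟩
      · simp only [RamExpr.eval_add, eval_vJ, h3, RamExpr.eval_one]; omega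
      · simp [RamMem.set_apply, h3]
    · rintro s₂ ⟨h1, h2, h3⟩
      exact ⟨by simp [h3, hN _ h2.frame], RamExpr.cost_le hW h2.bounded _⟩
    · rintro s₂ ⟨h1, h2, h3⟩
      exact ⟨h1, h2⟩
  · simp only [sumFillFactor]
    generalize RamProg.storeFactor 0 0 = c₁
    generalize (RamExpr.isLt vJ N).costFactor = c₂
    generalize (RamExpr.isLt vI M).costFactor + 1 +
        (RamProg.storeFactor 0 (vAcc + E) + RamProg.storeFactor 0 (vI + 1)) = c₃
    generalize RamProg.storeFactor vJ F = c₄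
    generalize RamProg.storeFactor 0 (vJ + 1) = c₅
    -- The claimed bound equals the true cost, with each unit charge for a loop test enlarged to
    -- `W`, plus a polynomial with nonnegative coefficients.
    have e : (c₁ + (c₂ + 1 + (c₁ + (c₁ + (c₃ + (c₄ + c₅)))))) * W * ((Nn + 1) * (Mm + 1)) =
      (c₁ * W + (Nn * (c₂ * W + W + (c₁ * W + (c₁ * W + ((Mm + 1) * (c₃ * W) +
        (c₄ * W + c₅ * W))))) + (c₂ * W + W))) +
        (Nn * W * Mm * (c₁ + c₂ + 1 + c₁ + c₁ + c₄ + c₅) + Nn * W * c₁ +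
          W * (Mm + 1) * (c₁ + c₁ + c₃ + c₄ + c₅) + W * Mm * (c₁ + c₂ + 1)) := by ring
    rw [e]
    refine le_trans ?_ (Nat.le_add_right _ _)
    exact Nat.add_le_add_left (Nat.add_le_add (Nat.mul_le_mul_left _
      (Nat.add_le_add_right (Nat.add_le_add_left hW _) _)) (Nat.add_le_add_left hW _)) _

theorem runs_flipFill (hW : 1 ≤ W) (ha : ¬ scratch a) (hNW : Nn < 2 ^ W)
    (hN : ∀ m, FrameEq a m₀ m → N.eval m = Nn) {s : RamState} (hm : s.mem = m₀)
    (hs : s.mem.Bounded W) :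
    (flipFill a N).Runs s (flipFillFactor N * W * (Nn + 1))
      (fun s' => Filled a m₀ W (fun j => if s.coins j then 1 else 0) Nn s'.mem) := by
  subst hm
  have hz : (0 : ℤ).natAbs < 2 ^ W := by simp
  have h1W : 1 < 2 ^ W := Nat.one_lt_two_pow (by omega)
  refine ((RamProg.runs_store hW 101 0 0 hs (Φ := fun s' => s'.coins = s.coins ∧
      Filled a s.mem W (fun j => if s.coins j then 1 else 0) 0 s'.mem ∧ s'.mem 101 0 = 0) ?_).seq
    (T₂ := Nn * ((RamExpr.isLt vJ N).costFactor * W + 1 +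
      (RamProg.storeFactor vJ 0 * W + RamProg.storeFactor 0 (vJ + 1) * W)) +
      ((RamExpr.isLt vJ N).costFactor * W + 1)) ?_).mono ?_ (fun _ h => h)
  · refine ⟨rfl, ⟨?_, hs.set _ _ hz, by simp⟩, by simp [RamMem.set_apply]⟩
    exact FrameEq.set (fun _ _ _ => rfl) (.inr (.inl rfl)) _ _
  · rintro s₁ ⟨h1, h2, h3⟩
    refine (RamProg.runs_loop (Φ := fun j s' => (∀ i, s'.coins i = s.coins (i + j)) ∧
      Filled a s.mem W (fun j => if s.coins j then 1 else 0) j s'.mem ∧ s'.mem 101 0 = j) ?_ ?_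
      ⟨by simp [h1], h2, by simpa using h3⟩).mono le_rfl ?_
    · rintro j hj s₂ ⟨h1, h2, h3⟩
      refine ⟨by simp [h3, hN _ h2.frame, hj], RamExpr.cost_le hW h2.bounded _, ?_⟩
      refine (RamProg.runs_flip hW a vJ h2.bounded (Φ := fun s' =>
        (∀ i, s'.coins i = s.coins (i + (j + 1))) ∧
        Filled a s.mem W (fun j => if s.coins j then 1 else 0) (j + 1) s'.mem ∧
        s'.mem 101 0 = j) ?_).seq ?_
      · rw [eval_vJ, h3, h1 0, zero_add]
        refine ⟨fun i => by simp only [h1]; congr 1; omega, h2.set_next ?_, ?_⟩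
        · split_ifs <;> simp; omega
        exact (congrFun (RamMem.set_of_ne _ _ _ (by rintro rfl; exact ha (.inl rfl))) 0).trans h3
      rintro s₆ ⟨h1, h2, h3⟩
      refine RamProg.runs_store hW 101 0 _ h2.bounded ?_
      refine ⟨h1, h2.set_scratch ha (.inl rfl) _ ?_, ?_⟩
      · simp only [RamExpr.eval_add, eval_vJ, h3, RamExpr.eval_one]; omega
      · simp [RamMem.set_apply, h3]
    · rintro s₂ ⟨h1, h2, h3⟩
      exact ⟨by simp [h3, hN _ h2.frame], RamExpr.cost_le hW h2.bounded _⟩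
    · rintro s₂ ⟨h1, h2, h3⟩
      exact h2
  · simp only [flipFillFactor]
    generalize RamProg.storeFactor 0 0 = c₁
    generalize (RamExpr.isLt vJ N).costFactor = c₂
    generalize RamProg.storeFactor vJ 0 = c₄
    generalize RamProg.storeFactor 0 (vJ + 1) = c₅
    have e : (c₁ + (c₂ + 1 + (c₄ + c₅))) * W * (Nn + 1) =
      (c₁ * W + (Nn * (c₂ * W + W + (c₄ * W + c₅ * W)) + (c₂ * W + W))) +
        (Nn * W * c₁ + W * (c₄ + c₅)) := by ring
    rw [e]
    refine le_trans ?_ (Nat.le_add_right _ _)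
    exact Nat.add_le_add_left (Nat.add_le_add (Nat.mul_le_mul_left _
      (Nat.add_le_add_right (Nat.add_le_add_left hW _) _)) (Nat.add_le_add_left hW _)) _

end Fill

/-! ### Newton's identities for the characteristic polynomial -/

namespace Matrix

open Polynomial

variable {ι R : Type*} [Fintype ι] [DecidableEq ι] [CommRing R]

/-- In the Leibniz expansion, the product rule differentiates one factor at a time, and a factor has
derivative 1 on the diagonal and 0 elsewhere. So only pairs (σ, j) with σ j = j survive. The same
pairs survive in the diagonal cofactors, where row j is replaced by a unit vector. -/
theorem derivative_charpoly (A : Matrix ι ι R) :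
    derivative A.charpoly = (adjugate (charmatrix A)).trace := by
  have h1 : ∀ j i : ι, derivative (charmatrix A i j) = if i = j then 1 else 0 := by
    intro j i
    rw [charmatrix_apply, diagonal_apply]
    split_ifs <;> simp
  rw [charpoly, det_apply, trace]
  simp only [diag_apply, adjugate_apply, det_apply, derivative_sum]
  rw [Finset.sum_comm]
  refine Finset.sum_congr rfl fun σ _ => ?_
  rw [← Finset.smul_sum, Units.smul_def, Units.smul_def, map_zsmul, derivative_prod_finset]
  congr 1
  have hs : ∀ j, ∏ i, updateRow (charmatrix A) j (Pi.single j 1) (σ i) i =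
      (if σ j = j then 1 else 0) * ∏ i ∈ Finset.univ.erase j, charmatrix A (σ i) i := by
    intro j
    by_cases hj : σ j = j
    · rw [← Finset.mul_prod_erase _ _ (Finset.mem_univ j), hj, updateRow_self]
      simp only [Pi.single_eq_same, if_true]
      congr 1
      refine Finset.prod_congr rfl fun i hi => ?_
      rw [updateRow_ne]
      intro h
      exact Finset.ne_of_mem_erase hi (σ.injective (h.trans hj.symm))
    · rw [if_neg hj, zero_mul]
      refine Finset.prod_eq_zero (Finset.mem_univ (σ.symm j)) ?_
      rw [Equiv.apply_symm_apply, updateRow_self, Pi.single_eq_of_ne]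
      rintro h
      exact hj (by rw [← h, Equiv.apply_symm_apply, h])
  refine Finset.sum_congr rfl fun j _ => ?_
  rw [hs, h1, mul_comm]

/-- The coefficients of the adjugate of the characteristic matrix. -/
noncomputable def adjCoeff (A : Matrix ι ι R) (m : ℕ) : Matrix ι ι R :=
  (matPolyEquiv (adjugate (charmatrix A))).coeff m

theorem adjCoeff_apply (A : Matrix ι ι R) (m : ℕ) (i j : ι) :
    adjCoeff A m i j = (adjugate (charmatrix A) i j).coeff m :=
  matPolyEquiv_coeff_apply _ _ _ _

theorem charmatrix_mul_adjugate_apply (A : Matrix ι ι R) (i j : ι) :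
    X * adjugate (charmatrix A) i j - ∑ l, C (A i l) * adjugate (charmatrix A) l j =
      if i = j then A.charpoly else 0 := by
  have h := congrFun (congrFun (mul_adjugate (charmatrix A)) i) j
  rw [mul_apply] at h
  simp only [charmatrix_apply, sub_mul, Finset.sum_sub_distrib, smul_apply, one_apply,
    smul_eq_mul, mul_ite, mul_one, mul_zero, diagonal_apply, ite_mul, zero_mul,
    Finset.sum_ite_eq, Finset.mem_univ, if_true] at h
  exact h

/-- Compare the coefficients of X^(m+1) in (X - A) · adj(X - A) = charpoly · 1. -/
theorem adjCoeff_succ (A : Matrix ι ι R) (m : ℕ) :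
    adjCoeff A m = A * adjCoeff A (m + 1) + A.charpoly.coeff (m + 1) • (1 : Matrix ι ι R) := by
  ext i j
  have h := congrArg (fun p => coeff p (m + 1)) (charmatrix_mul_adjugate_apply A i j)
  simp only [coeff_sub, coeff_X_mul, finsetSum_coeff, coeff_C_mul] at h
  rw [sub_eq_iff_eq_add] at h
  simp only [adjCoeff_apply, h, add_apply, mul_apply, smul_apply, one_apply]
  split_ifs <;> simp [add_comm]

theorem adjCoeff_zero (A : Matrix ι ι R) :
    A * adjCoeff A 0 + A.charpoly.coeff 0 • (1 : Matrix ι ι R) = 0 := by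
  ext i j
  have h := congrArg (fun p => coeff p 0) (charmatrix_mul_adjugate_apply A i j)
  simp only [coeff_sub, mul_coeff_zero, coeff_X_zero, zero_mul, finsetSum_coeff, coeff_C_zero] at h
  rw [sub_eq_iff_eq_add] at h
  simp only [adjCoeff_apply, add_apply, mul_apply, smul_apply, one_apply, zero_apply]
  by_cases hij : i = j
  · simp only [hij, if_true] at h ⊢
    simp [h.symm, add_comm]
  · simp only [hij, if_false, coeff_zero] at h ⊢
    simpa [eq_comm] using h

theorem trace_adjCoeff (A : Matrix ι ι R) (m : ℕ) :
    (adjCoeff A m).trace = A.charpoly.coeff (m + 1) * (m + 1) := by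
  rw [← coeff_derivative, derivative_charpoly, trace, trace, finsetSum_coeff]
  exact Finset.sum_congr rfl fun i _ => adjCoeff_apply A m i i

theorem charpoly_coeff_of_lt [Nontrivial R] (A : Matrix ι ι R) {m : ℕ} (h : Fintype.card ι < m) :
    A.charpoly.coeff m = 0 :=
  coeff_eq_zero_of_natDegree_lt (by rwa [charpoly_natDegree_eq_dim])

/-- The coefficients vanish far out because the adjugate is a polynomial. The recursion of
`adjCoeff_succ` carries the vanishing down as long as the coefficients of the characteristic
polynomial vanish too. -/
theorem adjCoeff_eq_zero [Nontrivial R] (A : Matrix ι ι R) {m : ℕ} (hm : Fintype.card ι ≤ m) :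
    adjCoeff A m = 0 := by
  obtain ⟨N, hN⟩ : ∃ N, ∀ m, N ≤ m → adjCoeff A m = 0 :=
    ⟨_, fun m hm => coeff_eq_zero_of_natDegree_lt (Nat.lt_of_succ_le hm)⟩
  suffices H : ∀ r m, Fintype.card ι ≤ m → N ≤ m + r → adjCoeff A m = 0 from
    H N m hm (by omega)
  intro r
  induction r with
  | zero => exact fun m _ h => hN m h
  | succ r ih =>
    intro m hm h
    rw [adjCoeff_succ, ih (m + 1) (by omega) (by omega), charpoly_coeff_of_lt A (by omega)]
    simp

/-- The coefficients of the characteristic polynomial, the leading one first. -/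
noncomputable def revCharCoeff (A : Matrix ι ι R) (t : ℕ) : R :=
  A.charpoly.coeff (Fintype.card ι - t)

theorem revCharCoeff_zero (A : Matrix ι ι R) : revCharCoeff A 0 = 1 := by
  nontriviality R
  have h := (charpoly_monic A).coeff_natDegree
  rwa [charpoly_natDegree_eq_dim] at h

theorem revCharCoeff_card (A : Matrix ι ι R) :
    revCharCoeff A (Fintype.card ι) = (-1) ^ Fintype.card ι * A.det := by
  rw [revCharCoeff, Nat.sub_self, det_eq_sign_charpoly_coeff, ← mul_assoc, ← mul_pow]
  simp

/-- The recursion of `adjCoeff_succ` unrolled from the top degree, as in Horner's scheme. -/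
theorem adjCoeff_eq_sum [Nontrivial R] (A : Matrix ι ι R) {t : ℕ} (ht : t < Fintype.card ι) :
    adjCoeff A (Fintype.card ι - 1 - t) =
      ∑ i ∈ Finset.range (t + 1), revCharCoeff A (t - i) • A ^ i := by
  induction t with
  | zero =>
    rw [adjCoeff_succ, adjCoeff_eq_zero A (by omega)]
    simp only [mul_zero, zero_add, Finset.range_one, Finset.sum_singleton, pow_zero, revCharCoeff]
    congr 2
    omega
  | succ t ih =>
    rw [adjCoeff_succ, show Fintype.card ι - 1 - (t + 1) + 1 = Fintype.card ι - 1 - t by omega,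
      ih (by omega), Finset.sum_range_succ' _ (t + 1), Finset.mul_sum]
    congr 1
    · refine Finset.sum_congr rfl fun i _ => ?_
      rw [Nat.add_sub_add_right, Matrix.mul_smul, pow_succ']
    · rw [pow_zero, revCharCoeff]
      congr 2
      omega

/-- Newton's identities. Write B_m for `adjCoeff A m`, c_m for the coefficient of X^m and n for the
size. The sum is tr(A B_{n-1-t}) by the closed form of B. The trace of the recursion, with tr B_m =
(m+1) c_{m+1} from the derivative, evaluates it as -(t+1) c_{n-t-1}; for t + 1 = n the constant-term
equation `adjCoeff_zero` takes the place of the recursion. -/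
theorem mul_revCharCoeff (A : Matrix ι ι R) {t : ℕ} (ht : t < Fintype.card ι) :
    ((t + 1 : ℕ) : R) * revCharCoeff A (t + 1) =
      -∑ i ∈ Finset.range (t + 1), revCharCoeff A (t - i) * (A ^ (i + 1)).trace := by
  nontriviality R
  have key : ∑ i ∈ Finset.range (t + 1), revCharCoeff A (t - i) * (A ^ (i + 1)).trace =
      (A * adjCoeff A (Fintype.card ι - 1 - t)).trace := by
    rw [adjCoeff_eq_sum A ht, Finset.mul_sum, trace_sum]
    refine Finset.sum_congr rfl fun i _ => ?_
    rw [Matrix.mul_smul, trace_smul, pow_succ', smul_eq_mul]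
  rw [key]
  rcases Nat.lt_or_ge (t + 1) (Fintype.card ι) with h | h
  · have h1 := congrArg trace (adjCoeff_succ A (Fintype.card ι - 1 - (t + 1)))
    rw [trace_add, trace_smul, trace_one, trace_adjCoeff, smul_eq_mul,
      show Fintype.card ι - 1 - (t + 1) + 1 = Fintype.card ι - (t + 1) by omega] at h1
    rw [show Fintype.card ι - 1 - t = Fintype.card ι - (t + 1) by omega, revCharCoeff]
    have h2 : ((Fintype.card ι - 1 - (t + 1) : ℕ) : R) + 1 + ((t + 1 : ℕ) : R)
        = (Fintype.card ι : R) := by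
      rw [← Nat.cast_succ, ← Nat.cast_add]
      congr 1
      omega
    rw [← h2] at h1
    linear_combination -h1
  · have h1 := congrArg trace (adjCoeff_zero A)
    rw [trace_add, trace_smul, trace_one, trace_zero, smul_eq_mul] at h1
    rw [show Fintype.card ι - 1 - t = 0 by omega, revCharCoeff,
      show Fintype.card ι - (t + 1) = 0 by omega, show t + 1 = Fintype.card ι by omega]
    linear_combination h1

end Matrix

/-! ### Random integers from coin tosses -/

/-- The `t`-th block of `b` coin tosses, read as a binary number. -/
def randInt (b : ℕ) (ω : ℕ → Bool) (t : ℕ) : ℤ :=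
  ∑ i ∈ Finset.range b, (if ω (t * b + i) then 1 else 0) * 2 ^ i

theorem sum_bits_nonneg (f : ℕ → Bool) (b : ℕ) :
    0 ≤ ∑ i ∈ Finset.range b, (if f i then 1 else 0) * (2 : ℤ) ^ i :=
  Finset.sum_nonneg fun i _ => by split_ifs <;> positivity

theorem sum_bits_lt (f : ℕ → Bool) (b : ℕ) :
    ∑ i ∈ Finset.range b, (if f i then 1 else 0) * (2 : ℤ) ^ i < 2 ^ b := by
  induction b with
  | zero => simp
  | succ b ih =>
    rw [Finset.sum_range_succ, pow_succ]
    split_ifs <;> linarith [pow_pos (two_pos : (0 : ℤ) < 2) b]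

/-- Parity determines the lowest bit; halving reduces to one bit fewer. -/
theorem sum_bits_inj {b : ℕ} : ∀ {f g : ℕ → Bool},
    ∑ i ∈ Finset.range b, (if f i then 1 else 0) * (2 : ℤ) ^ i =
      ∑ i ∈ Finset.range b, (if g i then 1 else 0) * (2 : ℤ) ^ i → ∀ i < b, f i = g i := by
  induction b with
  | zero => simp
  | succ b ih =>
    intro f g h
    have e : ∀ f : ℕ → Bool, ∑ i ∈ Finset.range (b + 1), (if f i then 1 else 0) * (2 : ℤ) ^ i =
        2 * (∑ i ∈ Finset.range b, (if f (i + 1) then 1 else 0) * (2 : ℤ) ^ i) +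
          (if f 0 then 1 else 0) := by
      intro f
      rw [Finset.sum_range_succ', Finset.mul_sum, pow_zero, mul_one]
      congr 1
      exact Finset.sum_congr rfl fun i _ => by ring
    rw [e f, e g] at h
    have h0 : f 0 = g 0 := by
      cases hf : f 0 <;> cases hg : g 0 <;> simp [hf, hg] at h ⊢ <;> omega
    rw [h0, add_left_inj, mul_right_inj' two_ne_zero] at h
    rintro (_ | i) hi
    · exact h0
    · exact ih (f := fun i => f (i + 1)) (g := fun i => g (i + 1)) h i (by omega)

/-! ### Events depending on finitely many tosses, and Schwartz–Zippel for coin tosses -/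

instance : IsProbabilityMeasure coinMeasure := by
  unfold coinMeasure; infer_instance

theorem coinMeasure_cylinder (M : ℕ) (f : ℕ → Bool) :
    coinMeasure.real {ω | ∀ i < M, ω i = f i} = (1 / 2) ^ M := by
  have h : {ω : ℕ → Bool | ∀ i < M, ω i = f i} =
      Set.pi (Finset.range M : Set ℕ) (fun i => {f i}) := by
    ext ω; simp [Set.mem_pi]
  rw [h, Measure.real, coinMeasure, Measure.infinitePi_pi _ (fun i _ => measurableSet_singleton _)]
  simp

theorem measurableSet_coin_cylinder (M : ℕ) (f : ℕ → Bool) :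
    MeasurableSet {ω : ℕ → Bool | ∀ i < M, ω i = f i} := by
  have : {ω : ℕ → Bool | ∀ i < M, ω i = f i} = ⋂ i ∈ Finset.range M, (fun ω => ω i) ⁻¹' {f i} := by
    ext ω; simp
  rw [this]
  exact Finset.measurableSet_biInter _ fun i _ =>
    measurable_pi_apply i (measurableSet_singleton _)

/-- An event that depends on the first `M` coin tosses only. -/
theorem setOf_coins_eq_biUnion (M : ℕ) (T : Finset (Fin M → Bool)) :
    {ω : ℕ → Bool | (fun i : Fin M => ω i) ∈ T} =
      ⋃ f ∈ T, {ω | ∀ i < M, ω i = if h : i < M then f ⟨i, h⟩ else false} := by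
  ext ω
  simp only [Set.mem_ofPred_eq, Set.mem_iUnion, exists_prop]
  constructor
  · intro h
    exact ⟨_, h, fun i hi => by simp [hi]⟩
  · rintro ⟨f, hf, h⟩
    convert hf
    rename_i i
    simpa using h i i.2

theorem measurableSet_coins (M : ℕ) (T : Finset (Fin M → Bool)) :
    MeasurableSet {ω : ℕ → Bool | (fun i : Fin M => ω i) ∈ T} := by
  rw [setOf_coins_eq_biUnion]
  exact Finset.measurableSet_biUnion _ fun f _ => measurableSet_coin_cylinder _ _

theorem coinMeasure_coins (M : ℕ) (T : Finset (Fin M → Bool)) :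
    coinMeasure.real {ω : ℕ → Bool | (fun i : Fin M => ω i) ∈ T} = T.card / 2 ^ M := by
  rw [setOf_coins_eq_biUnion, measureReal_biUnion_finset]
  · simp only [coinMeasure_cylinder, Finset.sum_const, nsmul_eq_mul]
    rw [one_div, inv_pow, div_eq_mul_inv]
  · intro f _ g _ hfg
    refine Set.disjoint_left.2 fun ω h1 h2 => hfg ?_
    ext i
    have := (h1 i i.2).symm.trans (h2 i i.2)
    simp only [Fin.is_lt, dite_true, Fin.eta] at this
    rw [this]
  · exact fun f _ => measurableSet_coin_cylinder _ _

/-- The polynomial `p` does not vanish at a random point, up to a small error probability. -/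
theorem one_sub_le_coinMeasure_eval_ne_zero {N : ℕ} (b : ℕ) {p : MvPolynomial (Fin N) ℤ}
    (hp : p ≠ 0) :
    1 - (p.totalDegree : ℝ) / 2 ^ b ≤
      coinMeasure.real {ω | MvPolynomial.eval (fun t : Fin N => randInt b ω t) p ≠ 0} := by
  classical
  have hidx : ∀ (t : Fin N) (i : ℕ), i < b → (t : ℕ) * b + i < N * b := by
    intro t i hi
    calc (t : ℕ) * b + i < t * b + b := by omega
      _ = (t + 1) * b := by ring
      _ ≤ N * b := Nat.mul_le_mul_right _ t.2
  let ext : (Fin (N * b) → Bool) → ℕ → Bool := fun f i => if h : i < N * b then f ⟨i, h⟩ else false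
  let r : (Fin (N * b) → Bool) → Fin N → ℤ := fun f t => randInt b (ext f) t
  have hr : ∀ (ω : ℕ → Bool) (t : Fin N), r (fun i => ω i) t = randInt b ω t := by
    intro ω t
    refine Finset.sum_congr rfl fun i hi => ?_
    simp only [ext, dif_pos (hidx t i (Finset.mem_range.1 hi))]
  let T : Finset (Fin (N * b) → Bool) :=
    Finset.univ.filter fun f => MvPolynomial.eval (r f) p = 0
  have hset : {ω : ℕ → Bool | MvPolynomial.eval (fun t : Fin N => randInt b ω t) p ≠ 0} =
      {ω | (fun i : Fin (N * b) => ω i) ∈ T}ᶜ := by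
    ext ω
    simp only [Set.mem_ofPred_eq, Set.mem_compl_iff, T, Finset.mem_filter, Finset.mem_univ, true_and]
    rw [show r (fun i : Fin (N * b) => ω i) = fun t : Fin N => randInt b ω t from
      funext (hr ω)]
  rw [hset, probReal_compl_eq_one_sub (measurableSet_coins _ _), coinMeasure_coins]
  -- Reading the tosses in blocks of `b` bits is injective into [0, 2^b)^N. Bad toss sequences are
  -- thus at most as many as zeros of `p` in this grid, which Schwartz–Zippel bounds.
  have hinj : T.card ≤ (Finset.filter (fun f => MvPolynomial.eval f p = 0)
      (Fintype.piFinset fun _ : Fin N => Finset.Ico (0 : ℤ) (2 ^ b))).card := by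
    refine Finset.card_le_card_of_injOn r ?_ ?_
    · intro f hf
      simp only [T, Finset.coe_filter, Finset.mem_univ, true_and, Set.mem_ofPred_eq] at hf
      simp only [Finset.coe_filter, Fintype.mem_piFinset, Finset.mem_Ico, Set.mem_ofPred_eq]
      exact ⟨fun t => ⟨sum_bits_nonneg _ _, sum_bits_lt _ _⟩, hf⟩
    · intro f _ g _ hfg
      ext ⟨i, hi⟩
      have hb : 0 < b := Nat.pos_of_ne_zero (by rintro rfl; simp at hi)
      have hq : i / b < N := (Nat.div_lt_iff_lt_mul hb).2 hi
      have h1 := congrFun hfg ⟨i / b, hq⟩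
      have h2 := sum_bits_inj (f := fun j => ext f (i / b * b + j))
        (g := fun j => ext g (i / b * b + j)) h1 (i % b) (Nat.mod_lt _ hb)
      simp only [ext, Nat.div_add_mod', dif_pos hi] at h2
      rw [h2]
  have hsz := MvPolynomial.schwartz_zippel_totalDegree hp (Finset.Ico (0 : ℤ) (2 ^ b))
  have hc : (Finset.Ico (0 : ℤ) (2 ^ b)).card = 2 ^ b := by
    rw [Int.card_Ico, sub_zero]
    norm_cast
  rw [hc] at hsz
  have hsz' := (NNRat.cast_le (K := ℝ)).2 hsz
  push_cast at hsz'
  rw [sub_le_sub_iff_left]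
  refine le_trans ?_ hsz'
  rw [show (2 : ℝ) ^ (N * b) = (2 ^ b) ^ N by rw [← pow_mul, mul_comm]]
  gcongr

/-! ### Sieving for coverings with determinants -/

section Sieve

open Finset

variable {α : Type*} [Fintype α] [DecidableEq α]

/-- The supersets of U are the sets U ∪ T with T ⊆ Uᶜ, and the alternating sum over T vanishes
unless Uᶜ is empty. -/
theorem sum_filter_superset_neg_one_pow_card (U : Finset α) :
    ∑ S : Finset α, (if U ⊆ S then (-1 : ℤ) ^ #S else 0) =
      if U = univ then (-1) ^ Fintype.card α else 0 := by
  rw [← sum_filter]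
  have h : (univ.filter fun S : Finset α => U ⊆ S) = (Uᶜ).powerset.image (fun T => U ∪ T) := by
    ext S
    simp only [mem_filter, mem_univ, true_and, mem_image, mem_powerset]
    constructor
    · intro h
      refine ⟨S \ U, fun x hx => ?_, union_sdiff_of_subset h⟩
      simp only [mem_sdiff] at hx
      simpa using hx.2
    · rintro ⟨T, _, rfl⟩
      exact subset_union_left
  have hd : ∀ T ∈ (Uᶜ).powerset, Disjoint U T := fun T hT =>
    (disjoint_compl_right (a := U)).mono_right (mem_powerset.1 hT)
  rw [h, sum_image]
  · have : ∀ T ∈ (Uᶜ).powerset, (-1 : ℤ) ^ #(U ∪ T) = (-1) ^ #U * (-1) ^ #T := fun T hT => by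
      rw [card_union_of_disjoint (hd T hT), pow_add]
    rw [sum_congr rfl this, ← mul_sum, sum_powerset_neg_one_pow_card]
    simp only [compl_eq_empty_iff, mul_ite, mul_one, mul_zero]
    split_ifs with hU
    · rw [hU, card_univ]
    · rfl
  · intro T hT T' hT' e
    have e' : U ∪ T = U ∪ T' := e
    rw [← union_sdiff_cancel_left (hd T hT), e', union_sdiff_cancel_left (hd T' hT')]

variable {ι : Type*} [Fintype ι] [DecidableEq ι]

/-- The number of families of sets, weighted by `f`, that cover the whole type. -/
def coverSum (f : ι → Finset α → ℤ) : ℤ :=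
  ∑ X : ι → Finset α, if univ.biUnion X = univ then ∏ i, f i (X i) else 0

/-- Inclusion–exclusion for covers: expanding the product gives the families whose union lies in S.
After exchanging the sums, the alternating sum over S keeps only the families whose union is
everything. -/
theorem sum_neg_one_pow_mul_prod_sum_powerset (f : ι → Finset α → ℤ) :
    ∑ S : Finset α, (-1 : ℤ) ^ #S * ∏ i, ∑ X ∈ S.powerset, f i X =
      (-1) ^ Fintype.card α * coverSum f := by
  have h1 : ∀ S : Finset α, ∏ i, ∑ X ∈ S.powerset, f i X =
      ∑ X : ι → Finset α, if univ.biUnion X ⊆ S then ∏ i, f i (X i) else 0 := by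
    intro S
    rw [prod_univ_sum, ← sum_filter]
    refine sum_congr ?_ fun _ _ => rfl
    ext X
    simp [Fintype.mem_piFinset]
  simp only [h1, mul_sum, coverSum]
  rw [sum_comm]
  refine sum_congr rfl fun X _ => ?_
  have h2 := sum_filter_superset_neg_one_pow_card (univ.biUnion X)
  rw [show (-1 : ℤ) ^ Fintype.card α * (if univ.biUnion X = univ then ∏ i, f i (X i) else 0) =
    (if univ.biUnion X = univ then (-1) ^ Fintype.card α else 0) * ∏ i, f i (X i) by
      split_ifs <;> simp, ← h2, sum_mul]
  refine sum_congr rfl fun S _ => ?_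
  split_ifs <;> simp

/-- The sieved determinant. -/
def sieveDet (f : ι → ι → Finset α → ℤ) (r : ι → ι → ℤ) : ℤ :=
  ∑ S : Finset α, (-1 : ℤ) ^ #S *
    (Matrix.of fun a c => r a c * ∑ X ∈ S.powerset, f a c X).det

/-- In the Leibniz expansion the weights do not depend on S and factor out; what remains for each σ
is the sieve of `sum_neg_one_pow_mul_prod_sum_powerset`. -/
theorem sieveDet_eq (f : ι → ι → Finset α → ℤ) (r : ι → ι → ℤ) :
    sieveDet f r = ∑ σ : Equiv.Perm ι, ((Equiv.Perm.sign σ : ℤ) * (-1) ^ Fintype.card α *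
      coverSum fun c => f (σ c) c) * ∏ c, r (σ c) c := by
  simp only [sieveDet, Matrix.det_apply', Matrix.of_apply]
  rw [sum_congr rfl fun S _ => mul_sum univ _ ((-1 : ℤ) ^ #S), sum_comm]
  refine sum_congr rfl fun σ _ => ?_
  rw [mul_assoc (_ : ℤ) ((-1) ^ _), ← sum_neg_one_pow_mul_prod_sum_powerset, mul_sum, sum_mul]
  refine sum_congr rfl fun S _ => ?_
  rw [prod_mul_distrib, Int.cast_id]
  ring

/-- The monomial of a permutation. -/
noncomputable def permMonomial (σ : Equiv.Perm ι) : ι × ι →₀ ℕ :=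
  ∑ c, Finsupp.single (σ c, c) 1

theorem permMonomial_apply (σ : Equiv.Perm ι) (a c : ι) :
    permMonomial σ (a, c) = if σ c = a then 1 else 0 := by
  simp only [permMonomial, Finsupp.coe_finsetSum, Finset.sum_apply, Finsupp.single_apply, Prod.mk.injEq]
  rw [sum_eq_single c]
  · simp
  · intro b _ hb; simp [hb]
  · simp

theorem permMonomial_injective : Function.Injective (permMonomial (ι := ι)) := by
  intro σ τ h
  ext c
  have := DFunLike.congr_fun h (σ c, c)
  rw [permMonomial_apply, permMonomial_apply] at this
  by_contra hne
  simp [Ne.symm hne] at this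

/-- The sieved determinant as a polynomial in the random weights. -/
noncomputable def sievePoly (f : ι → ι → Finset α → ℤ) : MvPolynomial (ι × ι) ℤ :=
  ∑ σ : Equiv.Perm ι, MvPolynomial.monomial (permMonomial σ)
    ((Equiv.Perm.sign σ : ℤ) * (-1) ^ Fintype.card α * coverSum fun c => f (σ c) c)

theorem eval_sievePoly (f : ι → ι → Finset α → ℤ) (r : ι × ι → ℤ) :
    MvPolynomial.eval r (sievePoly f) = sieveDet f fun a c => r (a, c) := by
  rw [sieveDet_eq, sievePoly, map_sum]
  refine sum_congr rfl fun σ _ => ?_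
  rw [MvPolynomial.eval_monomial]
  congr 1
  rw [permMonomial, ← Finsupp.prod_finsetSum_index] <;> simp [pow_add]

theorem totalDegree_sievePoly_le (f : ι → ι → Finset α → ℤ) :
    (sievePoly f).totalDegree ≤ Fintype.card ι := by
  refine MvPolynomial.totalDegree_finsetSum_le fun σ _ => ?_
  refine (MvPolynomial.totalDegree_monomial_le _ _).trans ?_
  rw [permMonomial, ← Finsupp.sum_finsetSum_index] <;> simp

/-- The monomials of distinct permutations are distinct, so the covers for σ cannot be cancelled by
those for another permutation of opposite sign. -/
theorem sievePoly_ne_zero {f : ι → ι → Finset α → ℤ} {σ : Equiv.Perm ι}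
    (h : coverSum (fun c => f (σ c) c) ≠ 0) : sievePoly f ≠ 0 := by
  intro h0
  have h1 := congrArg (MvPolynomial.coeff (permMonomial σ)) h0
  simp only [sievePoly, MvPolynomial.coeff_sum, MvPolynomial.coeff_monomial,
    permMonomial_injective.eq_iff, MvPolynomial.coeff_zero, sum_ite_eq', mem_univ, if_true] at h1
  simp [h] at h1

open Classical in
-- All terms are nonnegative, so a single cover suffices.
theorem coverSum_ne_zero_iff (g : ι → Finset α → Prop) :
    coverSum (fun i X => if g i X then 1 else 0) ≠ 0 ↔
      ∃ X : ι → Finset α, univ.biUnion X = univ ∧ ∀ i, g i (X i) := by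
  have h0 : ∀ X ∈ (univ : Finset (ι → Finset α)),
      (0 : ℤ) ≤ if univ.biUnion X = univ then ∏ i, (if g i (X i) then (1 : ℤ) else 0) else 0 := by
    intro X _
    split_ifs
    · exact prod_nonneg fun i _ => by split_ifs <;> simp
    · exact le_rfl
  rw [coverSum, Ne, sum_eq_zero_iff_of_nonneg h0]
  simp only [mem_univ, true_implies, not_forall, ite_eq_right_iff, prod_eq_zero_iff, true_and,
    one_ne_zero, imp_false, exists_prop, not_exists, not_not]

end Sieve

/-! ### Reading an instance from its encoding -/

namespace List

theorem length_flatMap_range (g : ℕ → List ℕ) (n : ℕ) :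
    ((List.range n).flatMap g).length = ∑ u ∈ Finset.range n, (g u).length := by
  induction n with
  | zero => simp
  | succ n ih => rw [List.range_succ, List.flatMap_append, List.length_append, ih,
      Finset.sum_range_succ]; simp

theorem getD_flatMap_range (g : ℕ → List ℕ) {n u i : ℕ} (hu : u < n) (hi : i < (g u).length) :
    ((List.range n).flatMap g).getD (∑ v ∈ Finset.range u, (g v).length + i) 0 =
      (g u).getD i 0 := by
  induction n with
  | zero => omega
  | succ n ih =>
    rw [List.range_succ, List.flatMap_append]
    rcases Nat.lt_succ_iff_lt_or_eq.1 hu with h | rfl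
    · rw [List.getD_append, ih h]
      rw [length_flatMap_range]
      refine lt_of_lt_of_le (Nat.add_lt_add_left hi _) ?_
      rw [← Finset.sum_range_succ]
      exact Finset.sum_le_sum_of_subset (Finset.range_mono h)
    · rw [List.getD_append_right, length_flatMap_range, Nat.add_sub_cancel_left]
      · simp
      · rw [length_flatMap_range]; omega

theorem flatMap_finRange {β : Type*} (n : ℕ) (f : Fin n → List β) :
    (List.finRange n).flatMap f =
      (List.range n).flatMap fun u => if h : u < n then f ⟨u, h⟩ else [] := by
  rw [← List.map_coe_finRange_eq_range, List.flatMap_map]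
  congr 1
  ext u
  simp

theorem map_finRange {β : Type*} [Inhabited β] (n : ℕ) (f : Fin n → β) :
    (List.finRange n).map f =
      (List.range n).map fun u => if h : u < n then f ⟨u, h⟩ else default := by
  rw [← List.map_coe_finRange_eq_range, List.map_map]
  congr 1
  ext u
  simp

end List

namespace LCCMInstance

variable (I : LCCMInstance)

/-- The input word. -/
noncomputable def word (p : ℕ) : ℕ := I.encode.getD p 0

/-- The length of the input word. -/
noncomputable def Q : ℕ := I.encode.length

/-- The adjacency relation on vertex numbers. -/
def adj (u v : ℕ) : Prop := ∃ (hu : u < I.n) (hv : v < I.n), I.graph.Adj ⟨u, hu⟩ ⟨v, hv⟩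

/-- The modulator as a set of vertex numbers. -/
def inD (u : ℕ) : Prop := ∃ hu : u < I.n, (⟨u, hu⟩ : Fin I.n) ∈ I.modulator

/-- The list of colors of a vertex number. -/
def list (u : ℕ) : List ℕ := if h : u < I.n then I.colors ⟨u, h⟩ else []

/-- The position of the length of the `u`-th list. -/
def start (u : ℕ) : ℕ := 1 + I.n * I.n + I.n + ∑ v ∈ Finset.range u, ((I.list v).length + 1)

open Classical in
/-- The encoding without dependent types. -/
theorem encode_eq : I.encode = [I.n]
    ++ (List.range I.n).flatMap (fun u => (List.range I.n).map fun v => if I.adj u v then 1 else 0)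
    ++ (List.range I.n).map (fun v => if I.inD v then 1 else 0)
    ++ (List.range I.n).flatMap (fun v => (I.list v).length :: I.list v) := by
  rw [encode, List.flatMap_finRange, List.flatMap_finRange, List.map_finRange]
  congr 1
  · congr 1
    · congr 1
      refine List.flatMap_congr fun u hu => ?_
      rw [List.mem_range] at hu
      rw [dif_pos hu, List.map_finRange]
      refine List.map_congr_left fun v hv => ?_
      rw [List.mem_range] at hv
      simp [adj, hu, hv]
    · refine List.map_congr_left fun v hv => ?_
      rw [List.mem_range] at hv
      simp [inD, hv]
  · refine List.flatMap_congr fun u hu => ?_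
    rw [List.mem_range] at hu
    simp [list, hu]

theorem start_succ (u : ℕ) : I.start (u + 1) = I.start u + (I.list u).length + 1 := by
  rw [start, start, Finset.sum_range_succ]; ring

theorem start_mono : Monotone I.start :=
  monotone_nat_of_le_succ fun u => by rw [start_succ]; omega

open Classical in
theorem length_adj (n : ℕ) : ((List.range n).flatMap
    (fun u => (List.range I.n).map fun v => if I.adj u v then 1 else 0)).length = n * I.n := by
  rw [List.length_flatMap_range]; simp

/-- The machine is not told the length of its input; it reads it off as the last entry of the table
of starting positions. -/
theorem Q_eq_start : I.Q = I.start I.n := by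
  classical
  rw [Q, encode_eq, List.length_append, List.length_append, List.length_append, length_adj,
    List.length_flatMap_range, start]
  simp

theorem n_lt_Q : I.n < I.Q := by
  rw [Q_eq_start, start]; have := Nat.zero_le (I.n * I.n); omega

theorem word_zero : I.word 0 = I.n := by
  classical
  rw [word, encode_eq]; simp

open Classical in
theorem word_adj {u v : ℕ} (hu : u < I.n) (hv : v < I.n) :
    I.word (1 + (u * I.n + v)) = if I.adj u v then 1 else 0 := by
  have hlt : u * I.n + v < I.n * I.n := by
    calc u * I.n + v < (u + 1) * I.n := by rw [add_mul]; omega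
      _ ≤ _ := Nat.mul_le_mul_right _ hu
  rw [word, encode_eq, List.getD_append, List.getD_append, List.getD_append_right]
  · have := List.getD_flatMap_range
      (fun u => (List.range I.n).map fun v => if I.adj u v then 1 else 0) hu (i := v) (by simpa)
    simp only [List.length_map, List.length_range, Finset.sum_const, Finset.card_range,
      smul_eq_mul] at this
    simp only [List.length_singleton, Nat.add_sub_cancel_left, this]
    simp [List.getD_eq_getElem?_getD, hv]
  · simp
  · rw [List.length_append, length_adj, List.length_singleton]; omega
  · rw [List.length_append, List.length_append, length_adj, List.length_singleton,
      List.length_map, List.length_range]; omega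

open Classical in
theorem word_inD {v : ℕ} (hv : v < I.n) :
    I.word (1 + I.n * I.n + v) = if I.inD v then 1 else 0 := by
  rw [word, encode_eq, List.getD_append, List.getD_append_right]
  · rw [List.length_append, length_adj, List.length_singleton, Nat.add_sub_cancel_left]
    simp [List.getD_eq_getElem?_getD, hv]
  · rw [List.length_append, length_adj, List.length_singleton]; omega
  · rw [List.length_append, List.length_append, length_adj, List.length_singleton,
      List.length_map, List.length_range]; omega

theorem word_start_add {u i : ℕ} (hu : u < I.n) (hi : i < (I.list u).length + 1) :
    I.word (I.start u + i) = ((I.list u).length :: I.list u).getD i 0 := by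
  classical
  rw [word, encode_eq, List.getD_append_right]
  · have := List.getD_flatMap_range (fun v => (I.list v).length :: I.list v) hu (i := i)
      (by simpa only [List.length_cons] using hi)
    rw [← this]
    congr 1
    rw [List.length_append, List.length_append, length_adj, List.length_singleton,
      List.length_map, List.length_range, start]
    simp only [List.length_cons]
    omega
  · rw [List.length_append, List.length_append, length_adj, List.length_singleton,
      List.length_map, List.length_range, start]
    omega

theorem word_start {u : ℕ} (hu : u < I.n) : I.word (I.start u) = (I.list u).length := by
  simpa using I.word_start_add hu (i := 0) (by omega)

/-- The colors of a vertex stand in the input word between two starting positions. -/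
theorem mem_list_iff {u : ℕ} (hu : u < I.n) (c : ℕ) :
    c ∈ I.list u ↔ ∃ p, I.start u < p ∧ p < I.start (u + 1) ∧ I.word p = c := by
  rw [start_succ]
  constructor
  · intro h
    obtain ⟨i, hi, rfl⟩ := List.getElem_of_mem h
    refine ⟨I.start u + (i + 1), by omega, by omega, ?_⟩
    rw [word_start_add I hu (by omega)]
    simp [List.getD_eq_getElem?_getD, hi]
  · rintro ⟨p, h1, h2, rfl⟩
    obtain ⟨i, rfl⟩ : ∃ i, p = I.start u + (i + 1) := ⟨p - I.start u - 1, by omega⟩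
    rw [word_start_add I hu (by omega)]
    have hi : i < (I.list u).length := by omega
    simp [List.getD_eq_getElem?_getD, hi]

theorem list_eq_nil {u : ℕ} (hu : ¬ u < I.n) : I.list u = [] := by simp [list, hu]

theorem start_le_Q {u : ℕ} (hu : u ≤ I.n) : I.start u ≤ I.Q := by
  rw [Q_eq_start]; exact I.start_mono hu

theorem exists_word_eq {u c : ℕ} (h : c ∈ I.list u) : ∃ p < I.Q, I.word p = c := by
  have hu : u < I.n := by
    by_contra hu
    simp [list_eq_nil I hu] at h
  obtain ⟨p, _, h2, h3⟩ := (I.mem_list_iff hu c).1 h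
  exact ⟨p, h2.trans_le (I.start_le_Q hu), h3⟩

theorem word_lt_two_pow_size (p : ℕ) : I.word p < 2 ^ I.size := by
  rw [word, ← Nat.size_le]
  rcases Nat.lt_or_ge p I.encode.length with h | h
  · rw [List.getD_eq_getElem _ _ h]
    have : (I.encode[p]).size + 1 ≤ I.size :=
      List.single_le_sum (fun _ _ => Nat.zero_le _) _ (List.mem_map_of_mem (List.getElem_mem h))
    omega
  · rw [List.getD_eq_default _ _ h]; simp

theorem Q_le_size : I.Q ≤ I.size := by
  have : ∀ l : List ℕ, l.length ≤ (l.map fun x => x.size + 1).sum := by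
    intro l
    induction l with
    | nil => simp
    | cons a l ih => simp only [List.length_cons, List.map_cons, List.sum_cons]; omega
  exact this _

/-! ### Colorings as coverings -/

open Classical in
/-- The number of modulator vertices below `u`. -/
noncomputable def rank (u : ℕ) : ℕ := Nat.count I.inD u

theorem inD_lt {u : ℕ} (h : I.inD u) : u < I.n := h.1

/-- Likewise, the parameter is the last entry of the table of ranks. -/
theorem rank_n : I.rank I.n = I.k := by
  classical
  rw [rank, Nat.count_eq_card_filter_range, k]
  symm
  refine Finset.card_bij (fun v _ => v) ?_ ?_ ?_
  · intro v hv
    simp only [Finset.mem_filter, Finset.mem_range]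
    exact ⟨v.2, v.2, hv⟩
  · intro v _ w _ h
    exact Fin.ext h
  · intro u hu
    obtain ⟨_, h1, h2⟩ := Finset.mem_filter.1 hu
    exact ⟨⟨u, h1⟩, h2, rfl⟩

theorem rank_lt {u : ℕ} (h : I.inD u) : I.rank u < I.k := by
  classical
  rw [← rank_n]
  exact Nat.count_strict_mono h (I.inD_lt h)

theorem rank_le_k {u : ℕ} (h : u ≤ I.n) : I.rank u ≤ I.k := by
  classical
  rw [← rank_n]
  exact Nat.count_monotone _ h

theorem rank_injective {u v : ℕ} (hu : I.inD u) (hv : I.inD v) (h : I.rank u = I.rank v) :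
    u = v := by
  classical
  exact Nat.count_injective hu hv h

theorem exists_rank_eq {i : ℕ} (hi : i < I.k) : ∃ u, I.inD u ∧ I.rank u = i := by
  classical
  have hi' : ∀ hf : {u | I.inD u}.Finite, i < hf.toFinset.card := by
    intro hf
    refine lt_of_lt_of_le hi ?_
    rw [← rank_n, rank, Nat.count_eq_card_filter_range]
    refine Finset.card_le_card fun u hu => ?_
    exact hf.mem_toFinset.2 (Finset.mem_filter.1 hu).2
  exact ⟨Nat.nth I.inD i, Nat.nth_mem i hi', Nat.count_nth hi'⟩

/-- A row of the matrix is genuine if it belongs to a vertex outside the modulator. -/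
def real (a : ℕ) : Prop := a < I.n ∧ ¬ I.inD a

/-- Vertex `u` may take the color at position `c`, the first occurrence of this color. -/
def allow (u c : ℕ) : Prop := I.word c ∈ I.list u ∧ ∀ p < c, I.word p ≠ I.word c

/-- The modulator vertex `u` belongs to the set with the given ranks. -/
def bit (S : ℕ → Prop) (u : ℕ) : Prop := I.inD u ∧ S (I.rank u)

/-- Row `a` and the modulator vertices in `S` may share the color at position `c`. -/
def good (a c : ℕ) (S : ℕ → Prop) : Prop :=
  (∀ u < I.n, I.bit S u → I.allow u c ∧ (I.real a → ¬ I.adj a u)) ∧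
  (∀ u < I.n, ∀ v < I.n, I.bit S u → I.bit S v → ¬ I.adj u v) ∧
  (I.real a → I.allow a c)

/-- The predicate on numbers given by a finite set of small numbers. -/
def finPred {k : ℕ} (X : Finset (Fin k)) (i : ℕ) : Prop := ∃ h : i < k, (⟨i, h⟩ : Fin k) ∈ X

/-- Only first occurrences are allowed, so equal colors mean equal columns. -/
theorem allow_unique {u v c d : ℕ} (h1 : I.allow u c) (h2 : I.allow v d)
    (h : I.word c = I.word d) : c = d := by
  rcases lt_trichotomy c d with hcd | hcd | hcd
  · exact absurd h (h2.2 c hcd)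
  · exact hcd
  · exact absurd h.symm (h1.2 d hcd)

theorem adj_symm {u v : ℕ} (h : I.adj u v) : I.adj v u := by
  obtain ⟨hu, hv, h⟩ := h
  exact ⟨hv, hu, h.symm⟩

/-- A vertex outside the modulator takes the column that σ matches with its row; a modulator vertex
takes any column whose set contains it. Two vertices of equal color then share a column: goodness
forbids an edge if at least one of them is in the modulator, and otherwise both are the single row
of that column. -/
theorem isYes_of_cover (σ : Equiv.Perm (Fin I.Q)) (X : Fin I.Q → Finset (Fin I.k))
    (hX : Finset.univ.biUnion X = Finset.univ)
    (hg : ∀ c : Fin I.Q, I.good (σ c) c (finPred (X c))) : I.IsYes := by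
  classical
  have hnQ := I.n_lt_Q
  have hcol : ∀ u : Fin I.n, ∃ c : Fin I.Q, I.allow u c ∧
      (I.inD u → I.bit (finPred (X c)) u) ∧ (¬ I.inD u → (σ c : ℕ) = u) := by
    intro u
    by_cases hu : I.inD u
    · have : (⟨I.rank u, I.rank_lt hu⟩ : Fin I.k) ∈ Finset.univ.biUnion X := by simp [hX]
      obtain ⟨c, _, hc⟩ := Finset.mem_biUnion.1 this
      have hb : I.bit (finPred (X c)) u := ⟨hu, I.rank_lt hu, hc⟩
      exact ⟨c, ((hg c).1 u u.2 hb).1, fun _ => hb, fun h => absurd hu h⟩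
    · refine ⟨σ.symm ⟨u, u.2.trans hnQ⟩, ?_, fun h => absurd h hu, fun _ => by simp⟩
      have := (hg (σ.symm ⟨u, u.2.trans hnQ⟩)).2.2
      simp only [Equiv.apply_symm_apply] at this
      exact this ⟨u.2, hu⟩
  choose col h1 h2 h3 using hcol
  refine ⟨SimpleGraph.Coloring.mk (fun u => I.word (col u)) ?_, ?_⟩
  · intro u v huv he
    have hc : col u = col v := Fin.ext (I.allow_unique (h1 u) (h1 v) he)
    have ha : I.adj u v := ⟨u.2, v.2, huv⟩
    by_cases hu : I.inD u <;> by_cases hv : I.inD v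
    · exact (hg (col u)).2.1 u u.2 v v.2 (h2 u hu) (by rw [hc]; exact h2 v hv) ha
    · refine ((hg (col u)).1 u u.2 (h2 u hu)).2 ?_ ?_
      · rw [hc, h3 v hv]; exact ⟨v.2, hv⟩
      · rw [hc, h3 v hv]; exact I.adj_symm ha
    · refine ((hg (col v)).1 v v.2 (h2 v hv)).2 ?_ ?_
      · rw [← hc, h3 u hu]; exact ⟨u.2, hu⟩
      · rw [← hc, h3 u hu]; exact ha
    · have : (u : ℕ) = v := by rw [← h3 u hu, ← h3 v hv, hc]
      exact huv.ne (Fin.ext this)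
  · intro u
    have := (h1 u).1
    rwa [list, dif_pos u.2] at this

/-- Column c receives the modulator vertices whose color first occurs at c. The map from genuine
rows to columns is injective and extends to a permutation because there are Q rows and Q columns;
its inverse is σ. -/
theorem cover_of_isYes (h : I.IsYes) : ∃ (σ : Equiv.Perm (Fin I.Q))
    (X : Fin I.Q → Finset (Fin I.k)), Finset.univ.biUnion X = Finset.univ ∧
      ∀ c : Fin I.Q, I.good (σ c) c (finPred (X c)) := by
  classical
  obtain ⟨col, hcol⟩ := h
  have hnQ := I.n_lt_Q
  have hlist : ∀ u : Fin I.n, col u ∈ I.list u := fun u => by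
    rw [list, dif_pos u.2]; exact hcol u
  have hpos : ∀ u : Fin I.n, ∃ c : Fin I.Q, I.allow u c ∧ I.word c = col u := by
    intro u
    have hex := I.exists_word_eq (hlist u)
    have hs := Nat.find_spec hex
    refine ⟨⟨Nat.find hex, hs.1⟩, ⟨?_, ?_⟩, hs.2⟩
    · simp only [hs.2]; exact hlist u
    · intro p hp he
      simp only [hs.2] at he hp
      exact Nat.find_min hex hp ⟨hp.trans hs.1, he⟩
  choose pos hp1 hp2 using hpos
  have hpos_eq : ∀ u v, pos u = pos v → ¬ I.graph.Adj u v := by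
    intro u v huv ha
    apply col.valid ha
    rw [← hp2 u, ← hp2 v, huv]
  -- The clique hypothesis enters here: distinct genuine rows are adjacent vertices, hence have
  -- different colors. The `else` value of the map is never taken on genuine rows.
  obtain ⟨g, hgσ⟩ := Finset.exists_equiv_extend_of_card_eq (α := Fin I.Q) (β := Fin I.Q)
    (t := Finset.univ) (by simp) (s := Finset.univ.filter fun a : Fin I.Q => I.real a)
    (f := fun a => if ha : (a : ℕ) < I.n then pos ⟨a, ha⟩ else a) (Finset.subset_univ _) (by
      intro a ha b hb hab
      simp only [Finset.coe_filter, Finset.mem_univ, true_and, Set.mem_ofPred_eq] at ha hb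
      simp only [dif_pos ha.1, dif_pos hb.1] at hab
      by_contra hne
      refine hpos_eq _ _ hab (I.isClique ?_ ?_ ?_)
      · intro hD; exact ha.2 ⟨ha.1, hD⟩
      · intro hD; exact hb.2 ⟨hb.1, hD⟩
      · intro he
        exact hne (Fin.ext (congrArg (fun x : Fin I.n => (x : ℕ)) he)))
  let τ : Equiv.Perm (Fin I.Q) := g.trans (Equiv.subtypeUnivEquiv fun _ => Finset.mem_univ _)
  have hτ : ∀ (a : Fin I.Q) (ha : I.real a), τ a = pos ⟨a, ha.1⟩ := by
    intro a ha
    have := hgσ a (by simpa using ha)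
    rw [dif_pos ha.1] at this
    exact this
  have hX : ∀ c u, I.bit (finPred (Finset.univ.filter fun i : Fin I.k =>
      ∃ u : Fin I.n, I.inD u ∧ I.rank u = i ∧ pos u = c)) u →
      ∃ hu : u < I.n, pos ⟨u, hu⟩ = c := by
    rintro c u ⟨hu, h, hm⟩
    obtain ⟨_, v, hv, hr, hc⟩ := Finset.mem_filter.1 hm
    obtain rfl := I.rank_injective hv hu hr
    exact ⟨v.2, hc⟩
  refine ⟨τ.symm, fun c => Finset.univ.filter fun i : Fin I.k =>
    ∃ u : Fin I.n, I.inD u ∧ I.rank u = i ∧ pos u = c, ?_, fun c => ⟨?_, ?_, ?_⟩⟩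
  · refine Finset.eq_univ_of_forall fun i => ?_
    obtain ⟨u, hu, hr⟩ := I.exists_rank_eq i.2
    refine Finset.mem_biUnion.2 ⟨pos ⟨u, I.inD_lt hu⟩, Finset.mem_univ _,
      Finset.mem_filter.2 ⟨Finset.mem_univ _, ⟨u, I.inD_lt hu⟩, hu, hr, rfl⟩⟩
  · intro u hu hb
    obtain ⟨_, rfl⟩ := hX c u hb
    refine ⟨hp1 ⟨u, hu⟩, fun hr ha => ?_⟩
    have h1 := hτ _ hr
    rw [Equiv.apply_symm_apply] at h1
    obtain ⟨h2, h3, h4⟩ := ha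
    exact hpos_eq _ _ h1.symm h4
  · intro u _ v _ hu hv ha
    obtain ⟨h1, h2⟩ := hX c u hu
    obtain ⟨h3, h4⟩ := hX c v hv
    obtain ⟨_, _, h5⟩ := ha
    exact hpos_eq _ _ (h2.trans h4.symm) h5
  · intro hr
    have h1 := hτ _ hr
    rw [Equiv.apply_symm_apply] at h1
    conv_rhs => rw [h1]
    exact hp1 ⟨_, hr.1⟩

end LCCMInstance

/-! ### Numbers as sets of bits -/

/-- Write S = 2^i (2q + 1) + l with l < 2^i; the difference is 2^i · 2q + l, without any borrow. -/
theorem testBit_sub_two_pow {S i : ℕ} (h : S.testBit i = true) :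
    2 ^ i ≤ S ∧ ∀ j, (S - 2 ^ i).testBit j = (S.testBit j && decide (j ≠ i)) := by
  have hS := Nat.div_add_mod S (2 ^ i)
  have hl := Nat.mod_lt S (Nat.two_pow_pos i)
  rw [Nat.testBit_eq_decide_div_mod_eq, decide_eq_true_eq] at h
  obtain ⟨q, hq⟩ : ∃ q, S / 2 ^ i = 2 * q + 1 := ⟨S / 2 ^ i / 2, by omega⟩
  rw [hq] at hS
  generalize S % 2 ^ i = l at hS hl
  have e1 : 2 ^ i * (2 * q + 1) = 2 ^ i * (2 * q) + 2 ^ i := by ring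
  refine ⟨by omega, fun j => ?_⟩
  rw [show S - 2 ^ i = 2 ^ i * (2 * q) + l by omega, ← hS, Nat.testBit_two_pow_mul_add _ hl,
    Nat.testBit_two_pow_mul_add _ hl]
  rcases lt_trichotomy j i with h | rfl | h
  · simp [h, h.ne]
  · simp
  · obtain ⟨d, hd⟩ : ∃ d, j - i = d + 1 := ⟨j - i - 1, by omega⟩
    rw [if_neg (by omega), if_neg (by omega), hd, Nat.testBit_add_one, Nat.testBit_add_one,
      show 2 * q / 2 = q by omega, show (2 * q + 1) / 2 = q by omega]
    simp [h.ne']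

/-- The set of the bits of a number. -/
def bitFinset (k S : ℕ) : Finset (Fin k) := Finset.univ.filter fun i => S.testBit i = true

theorem mem_bitFinset {k S : ℕ} {i : Fin k} : i ∈ bitFinset k S ↔ S.testBit i = true := by
  simp [bitFinset]

theorem bitFinset_injOn {k S T : ℕ} (hS : S < 2 ^ k) (hT : T < 2 ^ k)
    (h : bitFinset k S = bitFinset k T) : S = T := by
  refine Nat.eq_of_testBit_eq fun i => ?_
  rcases Nat.lt_or_ge i k with hi | hi
  · have := Finset.ext_iff.1 h ⟨i, hi⟩
    rw [mem_bitFinset, mem_bitFinset] at this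
    exact Bool.eq_iff_iff.2 this
  · rw [Nat.testBit_lt_two_pow (hS.trans_le (Nat.pow_le_pow_right two_pos hi)),
      Nat.testBit_lt_two_pow (hT.trans_le (Nat.pow_le_pow_right two_pos hi))]

theorem sum_range_two_pow {M : Type*} [AddCommMonoid M] (k : ℕ) (g : Finset (Fin k) → M) :
    ∑ S ∈ Finset.range (2 ^ k), g (bitFinset k S) = ∑ X, g X := by
  have hb : Function.Bijective fun S : Fin (2 ^ k) => bitFinset k S := by
    rw [Fintype.bijective_iff_injective_and_card]
    exact ⟨fun S T h => Fin.ext (bitFinset_injOn S.2 T.2 h), by simp⟩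
  rw [← hb.sum_comp g, Finset.sum_range]

theorem finPred_bitFinset {k S : ℕ} (hS : S < 2 ^ k) :
    LCCMInstance.finPred (bitFinset k S) = fun i => S.testBit i = true := by
  ext i
  simp only [LCCMInstance.finPred, mem_bitFinset]
  constructor
  · rintro ⟨_, h⟩; exact h
  · intro h
    refine ⟨?_, h⟩
    by_contra hi
    rw [Nat.testBit_lt_two_pow
      (hS.trans_le (Nat.pow_le_pow_right two_pos (Nat.le_of_not_lt hi)))] at h
    cases h

/-- The first `i` rounds of the subset sum transformation. -/
def zetaStep (f : ℕ → ℤ) : ℕ → ℕ → ℤ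
  | 0, S => f S
  | i + 1, S => zetaStep f i S + if S.testBit i then zetaStep f i (S - 2 ^ i) else 0

open Classical in
-- After i rounds the sum ranges over the X ⊆ S that agree with S from bit i on. Round i + 1 frees
-- bit i: if S contains it, the sets X with and without this bit come from the two summands.
theorem zetaStep_eq_sum {k : ℕ} (f : ℕ → ℤ) (i : ℕ) : ∀ S < 2 ^ k, zetaStep f i S =
    ∑ X ∈ Finset.range (2 ^ k), if (∀ j, X.testBit j → S.testBit j) ∧
      (∀ j, i ≤ j → S.testBit j → X.testBit j) then f X else 0 := by
  induction i with
  | zero =>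
    intro S hS
    rw [zetaStep, Finset.sum_eq_single S]
    · rw [if_pos ⟨fun _ h => h, fun _ _ h => h⟩]
    · intro X _ hne
      rw [if_neg]
      rintro ⟨h1, h2⟩
      exact hne (Nat.eq_of_testBit_eq fun j => Bool.eq_iff_iff.2 ⟨h1 j, h2 j (Nat.zero_le _)⟩)
    · intro h; exact absurd (Finset.mem_range.2 hS) h
  | succ i ih =>
    intro S hS
    rw [zetaStep, ih S hS]
    by_cases hb : S.testBit i = true
    · obtain ⟨hle, hbit⟩ := testBit_sub_two_pow hb
      rw [if_pos hb, ih _ ((Nat.sub_le _ _).trans_lt hS), ← Finset.sum_add_distrib]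
      refine Finset.sum_congr rfl fun X _ => ?_
      by_cases hX : X.testBit i = true
      · rw [if_neg (c := _ ∧ ∀ j, i ≤ j → (S - 2 ^ i).testBit j = true → X.testBit j = true),
          add_zero]
        · congr 1
          refine propext (and_congr_right fun _ => ⟨fun h j hj => h j (by omega), ?_⟩)
          intro h j hj hS
          rcases Nat.eq_or_lt_of_le hj with rfl | hj
          · exact hX
          · exact h j hj hS
        · rintro ⟨h, _⟩
          have := h i hX
          simp [hbit] at this
      · rw [if_neg (c := _ ∧ ∀ j, i ≤ j → S.testBit j = true → X.testBit j = true), zero_add]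
        · congr 1
          refine propext ⟨?_, ?_⟩
          · rintro ⟨h1, h2⟩
            refine ⟨fun j hj => ?_, fun j hj hS => h2 j ?_ ?_⟩
            · have := h1 j hj; rw [hbit] at this; simp at this; exact this.1
            · omega
            · have hne : j ≠ i := by omega
              simp [hbit, hS, hne]
          · rintro ⟨h1, h2⟩
            refine ⟨fun j hj => ?_, fun j hj hS => ?_⟩
            · rw [hbit]
              simp only [h1 j hj, Bool.true_and, decide_eq_true_eq]
              rintro rfl; exact hX hj
            · have hne : j ≠ i := by
                rintro rfl
                simp [hbit] at hS
              rw [hbit] at hS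
              simp only [Bool.and_eq_true] at hS
              exact h2 j (by omega) hS.1
        · rintro ⟨_, h⟩
          exact hX (h i le_rfl hb)
    · rw [if_neg hb, add_zero]
      refine Finset.sum_congr rfl fun X _ => ?_
      congr 1
      refine propext (and_congr_right fun h1 => ⟨fun h j hj => h j (by omega), ?_⟩)
      intro h j hj hS
      rcases Nat.eq_or_lt_of_le hj with rfl | hj
      · exact absurd hS hb
      · exact h j hj hS

theorem zetaStep_eq_sum_powerset {k : ℕ} {f : ℕ → ℤ} {F : Finset (Fin k) → ℤ}
    (hf : ∀ X < 2 ^ k, f X = F (bitFinset k X)) {S : ℕ} (hS : S < 2 ^ k) :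
    zetaStep f k S = ∑ X ∈ (bitFinset k S).powerset, F X := by
  have e : ∑ X ∈ (bitFinset k S).powerset, F X = ∑ X, if X ⊆ bitFinset k S then F X else 0 := by
    rw [← Finset.sum_filter]
    congr 1
    ext X; simp
  rw [zetaStep_eq_sum f k S hS, e, ← sum_range_two_pow]
  refine Finset.sum_congr rfl fun X hX => ?_
  have hX' := Finset.mem_range.1 hX
  rw [hf X hX']
  congr 1
  refine propext ⟨fun h i hi => mem_bitFinset.2 (h.1 i (mem_bitFinset.1 hi)), fun h => ⟨?_, ?_⟩⟩
  · intro j hj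
    have hjk : j < k := by
      by_contra hjk
      rw [Nat.testBit_lt_two_pow
        (hX'.trans_le (Nat.pow_le_pow_right two_pos (Nat.le_of_not_lt hjk)))] at hj
      cases hj
    exact mem_bitFinset.1 (h (mem_bitFinset.2 hj : (⟨j, hjk⟩ : Fin k) ∈ bitFinset k X))
  · intro j hj hS'
    rw [Nat.testBit_lt_two_pow (hS.trans_le (Nat.pow_le_pow_right two_pos hj))] at hS'
    cases hS'

theorem zetaStep_nonneg {f : ℕ → ℤ} (hf : ∀ X, 0 ≤ f X) (i : ℕ) : ∀ S, 0 ≤ zetaStep f i S := by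
  induction i with
  | zero => exact hf
  | succ i ih =>
    intro S
    rw [zetaStep]
    split_ifs
    · exact add_nonneg (ih _) (ih _)
    · simpa using ih S

/-- Each round at most doubles the bound. -/
theorem zetaStep_le {f : ℕ → ℤ} (hf : ∀ X, f X ≤ 1) (i : ℕ) : ∀ S, zetaStep f i S ≤ 2 ^ i := by
  induction i with
  | zero => simpa [zetaStep] using hf
  | succ i ih =>
    intro S
    have h1 := ih S
    have h2 := ih (S - 2 ^ i)
    have h3 : (0 : ℤ) ≤ 2 ^ i := by positivity
    rw [zetaStep, pow_succ]
    split_ifs <;> linarith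

/-- The sign of a set of bits. -/
def bitSign (k S : ℕ) : ℤ := ∏ i ∈ Finset.range k, if S.testBit i then -1 else 1

theorem bitSign_eq (k S : ℕ) : bitSign k S = (-1) ^ (bitFinset k S).card := by
  rw [bitSign, Finset.prod_range, Finset.prod_ite, Finset.prod_const, Finset.prod_const_one, mul_one,
    bitFinset]

theorem bitSign_zero (k : ℕ) : bitSign k 0 = 1 := by simp [bitSign]

/-- This is the recursion by which the table of signs is filled: halving drops the lowest bit and
moves in a zero at the top. -/
theorem bitSign_div_two {k S : ℕ} (h0 : S ≠ 0) (hS : S < 2 ^ k) :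
    bitSign k S = bitSign k (S / 2) * (1 - 2 * ((S % 2 : ℕ) : ℤ)) := by
  obtain ⟨k, rfl⟩ : ∃ k', k = k' + 1 := by
    cases k with
    | zero => simp at hS; exact absurd hS h0
    | succ k => exact ⟨k, rfl⟩
  rw [bitSign, bitSign, Finset.prod_range_succ', Finset.prod_range_succ _ k]
  simp only [Nat.testBit_div_two, Nat.testBit_lt_two_pow hS, Nat.testBit_zero]
  rcases Nat.mod_two_eq_zero_or_one S with h | h <;> simp [h]

theorem natAbs_bitSign (k S : ℕ) : (bitSign k S).natAbs = 1 := by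
  rw [bitSign_eq, Int.natAbs_pow]; simp

/-! ### Matrices indexed by numbers -/

section MatrixEntries

variable {Q : ℕ}

/-- The entries of a matrix, as a function of numbers. -/
def matEntry (A : Matrix (Fin Q) (Fin Q) ℤ) (a c : ℕ) : ℤ :=
  if h : a < Q ∧ c < Q then A ⟨a, h.1⟩ ⟨c, h.2⟩ else 0

theorem matEntry_one {a c : ℕ} (ha : a < Q) (hc : c < Q) :
    matEntry (1 : Matrix (Fin Q) (Fin Q) ℤ) a c = if a = c then 1 else 0 := by
  simp [matEntry, ha, hc, Matrix.one_apply]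

theorem matEntry_mul (A B : Matrix (Fin Q) (Fin Q) ℤ) {a c : ℕ} (ha : a < Q) (hc : c < Q) :
    matEntry (A * B) a c = ∑ l ∈ Finset.range Q, matEntry A a l * matEntry B l c := by
  rw [Finset.sum_range]
  simp [matEntry, ha, hc, Matrix.mul_apply]

theorem trace_eq_sum_matEntry (A : Matrix (Fin Q) (Fin Q) ℤ) :
    A.trace = ∑ a ∈ Finset.range Q, matEntry A a a := by
  rw [Finset.sum_range]
  simp [matEntry, Matrix.trace]

/-! ### Size of powers, traces and characteristic coefficients -/

variable {A : Matrix (Fin Q) (Fin Q) ℤ} {B : ℕ}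

/-- An entry of A^(i+1) is at most Q^i B^(i+1). The extra factor Q on the left makes the bound a
pure power and, summed over the diagonal, saves the factor Q for the trace. -/
theorem mul_natAbs_matEntry_pow_le (hA : ∀ a c, (matEntry A a c).natAbs ≤ B) (i : ℕ) (a c : ℕ) :
    Q * (matEntry (A ^ (i + 1)) a c).natAbs ≤ (Q * B) ^ (i + 1) := by
  induction i generalizing a c with
  | zero => simpa using Nat.mul_le_mul_left Q (hA a c)
  | succ i ih =>
    by_cases h : a < Q ∧ c < Q
    · rw [pow_succ, matEntry_mul _ _ h.1 h.2]
      refine (Nat.mul_le_mul_left _ (Int.natAbs_sum_le _ _)).trans ?_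
      rw [Finset.mul_sum, pow_succ _ (i + 1)]
      calc _ ≤ ∑ l ∈ Finset.range Q, (Q * B) ^ (i + 1) * B := by
            refine Finset.sum_le_sum fun l _ => ?_
            rw [Int.natAbs_mul, ← mul_assoc]
            exact Nat.mul_le_mul (ih a l) (hA l c)
        _ = _ := by simp; ring
    · simp [matEntry, h]

theorem sum_natAbs_matEntry_pow_le (hA : ∀ a c, (matEntry A a c).natAbs ≤ B) (i : ℕ) :
    ∑ a ∈ Finset.range Q, (matEntry (A ^ (i + 1)) a a).natAbs ≤ (Q * B) ^ (i + 1) := by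
  rcases Nat.eq_zero_or_pos Q with h | hQ
  · simp [h]
  · refine Nat.le_of_mul_le_mul_left ?_ hQ
    rw [Finset.mul_sum]
    refine (Finset.sum_le_sum fun a _ => mul_natAbs_matEntry_pow_le hA i a a).trans ?_
    simp

theorem natAbs_trace_pow_le (hA : ∀ a c, (matEntry A a c).natAbs ≤ B) (i : ℕ) :
    ((A ^ (i + 1)).trace).natAbs ≤ (Q * B) ^ (i + 1) := by
  rw [trace_eq_sum_matEntry]
  exact (Int.natAbs_sum_le _ _).trans (sum_natAbs_matEntry_pow_le hA i)

/-- Newton's identity makes the division exact over ℤ, so the integer division of the machine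
computes the coefficient. -/
theorem revCharCoeff_succ {t : ℕ} (ht : t < Q) :
    A.revCharCoeff (t + 1) = (-∑ i ∈ Finset.range (t + 1),
      A.revCharCoeff (t - i) * (A ^ (i + 1)).trace) / ((t + 1 : ℕ) : ℤ) := by
  rw [← Matrix.mul_revCharCoeff A (by simpa using ht), Int.mul_ediv_cancel_left]
  exact_mod_cast Nat.succ_ne_zero t

/-- Newton's identity expresses t times the coefficient by t products, each at most (QB)^t by
induction; the factor t cancels. The second conjunct bounds the accumulator before the division. -/
theorem natAbs_revCharCoeff_le (hA : ∀ a c, (matEntry A a c).natAbs ≤ B) {t : ℕ} (ht : t ≤ Q) :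
    (A.revCharCoeff t).natAbs ≤ (Q * B) ^ t ∧ (∀ s, s + 1 = t → ∑ i ∈ Finset.range t,
      (A.revCharCoeff (s - i) * (A ^ (i + 1)).trace).natAbs ≤ t * (Q * B) ^ t) := by
  induction t using Nat.strong_induction_on with
  | _ t ih =>
    rcases t with _ | t
    · simp [Matrix.revCharCoeff_zero]
    · have hsum : ∑ i ∈ Finset.range (t + 1),
          (A.revCharCoeff (t - i) * (A ^ (i + 1)).trace).natAbs ≤ (t + 1) * (Q * B) ^ (t + 1) := by
        calc _ ≤ ∑ i ∈ Finset.range (t + 1), (Q * B) ^ (t + 1) := by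
              refine Finset.sum_le_sum fun i hi => ?_
              rw [Finset.mem_range] at hi
              rw [Int.natAbs_mul, show t + 1 = (t - i) + (i + 1) by omega, pow_add (Q * B)]
              exact Nat.mul_le_mul (ih (t - i) (by omega) (by omega)).1 (natAbs_trace_pow_le hA i)
          _ = _ := by simp
      refine ⟨?_, ?_⟩
      · refine Nat.le_of_mul_le_mul_left (c := t + 1) ?_ (Nat.succ_pos t)
        refine le_trans ?_ hsum
        have h := congrArg Int.natAbs (Matrix.mul_revCharCoeff A (t := t) (by simpa using ht))
        rw [Int.natAbs_mul, Int.natAbs_neg] at h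
        exact h.le.trans (Int.natAbs_sum_le _ _)
      · rintro s hs
        obtain rfl : s = t := by omega
        exact hsum

end MatrixEntries

/-! ### The answer of the algorithm -/

namespace LCCMInstance

variable (I : LCCMInstance) (b : ℕ) (ω : ℕ → Bool)

open Classical in
/-- The value `1` if row `a` and the set `S` may share the color at position `c`. -/
noncomputable def goodVal (a c S : ℕ) : ℤ := if I.good a c fun i => S.testBit i = true then 1 else 0

/-- The matrix for the set `S`. -/
noncomputable def mat (S : ℕ) : Matrix (Fin I.Q) (Fin I.Q) ℤ := Matrix.of fun a c =>
  randInt b ω (a * I.Q + c) * zetaStep (I.goodVal a c) I.k S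

/-- The number that the algorithm computes. -/
noncomputable def answer : ℤ :=
  ∑ S ∈ Finset.range (2 ^ I.k), bitSign I.k S * (I.mat b ω S).revCharCoeff I.Q

open Classical in
/-- The function to which the sieve is applied. -/
noncomputable def goodFun (a c : Fin I.Q) (X : Finset (Fin I.k)) : ℤ :=
  if I.good a c (finPred X) then 1 else 0

theorem answer_eq : I.answer b ω =
    (-1) ^ I.Q * sieveDet I.goodFun fun a c => randInt b ω (a * I.Q + c) := by
  rw [answer, sieveDet, ← sum_range_two_pow, Finset.mul_sum]
  refine Finset.sum_congr rfl fun S hS => ?_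
  rw [Finset.mem_range] at hS
  have h := Matrix.revCharCoeff_card (I.mat b ω S)
  rw [Fintype.card_fin] at h
  rw [h, bitSign_eq, mul_left_comm]
  congr 4
  ext a c
  simp only [mat, Matrix.of_apply]
  congr 1
  refine zetaStep_eq_sum_powerset (fun X hX => ?_) hS
  rw [goodVal, goodFun, finPred_bitFinset hX]

theorem answer_eq_zero (h : ¬ I.IsYes) : I.answer b ω = 0 := by
  rw [answer_eq, sieveDet_eq, Finset.sum_eq_zero, mul_zero]
  intro σ _
  have : coverSum (fun c => I.goodFun (σ c) c) = 0 := by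
    by_contra hne
    obtain ⟨X, hX, hg⟩ := (coverSum_ne_zero_iff fun (c : Fin I.Q) X => I.good (σ c) c (finPred X)).1
      hne
    exact h (I.isYes_of_cover σ X hX hg)
  rw [this]; simp

theorem le_coinMeasure_answer_ne_zero (h : I.IsYes) :
    1 - (I.Q : ℝ) / 2 ^ b ≤ coinMeasure.real {ω | I.answer b ω ≠ 0} := by
  obtain ⟨σ, X, hX, hg⟩ := I.cover_of_isYes h
  have hne : sievePoly I.goodFun ≠ 0 :=
    sievePoly_ne_zero (σ := σ) ((coverSum_ne_zero_iff
      fun (c : Fin I.Q) X => I.good (σ c) c (finPred X)).2 ⟨X, hX, hg⟩)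
  -- The renaming numbers the weight of entry (a, c) by a * Q + c, the block of coin tosses it is
  -- read from.
  have hne' : MvPolynomial.rename finProdFinEquiv (sievePoly I.goodFun) ≠ 0 := by
    rwa [Ne, map_eq_zero_iff _ (MvPolynomial.rename_injective _ finProdFinEquiv.injective)]
  have hdeg : (MvPolynomial.rename finProdFinEquiv (sievePoly I.goodFun)).totalDegree ≤ I.Q := by
    refine (MvPolynomial.totalDegree_rename_le _ _).trans ?_
    simpa using totalDegree_sievePoly_le I.goodFun
  have key := one_sub_le_coinMeasure_eval_ne_zero b hne'
  have hset : {ω | I.answer b ω ≠ 0} = {ω | MvPolynomial.eval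
      (fun t : Fin (I.Q * I.Q) => randInt b ω t)
      (MvPolynomial.rename finProdFinEquiv (sievePoly I.goodFun)) ≠ 0} := by
    ext ω
    simp only [Set.mem_ofPred_eq]
    rw [MvPolynomial.eval_rename, eval_sievePoly, answer_eq]
    have : (fun a c : Fin I.Q => ((fun t : Fin (I.Q * I.Q) => randInt b ω t) ∘ finProdFinEquiv)
        (a, c)) = fun a c : Fin I.Q => randInt b ω (a * I.Q + c) := by
      ext a c
      simp only [Function.comp_apply, finProdFinEquiv_apply_val]
      congr 1; ring
    rw [this]
    simp
  rw [hset]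
  refine le_trans ?_ key
  gcongr

end LCCMInstance

/-! ### Evaluating expressions with natural number values -/

/-- The indicator of a proposition. -/
noncomputable def ind (p : Prop) : ℤ := open Classical in if p then 1 else 0

theorem ind_eq_ite (p : Prop) [Decidable p] : ind p = if p then 1 else 0 := by
  unfold ind; congr

theorem ind_pos {p : Prop} (h : p) : ind p = 1 := if_pos h
theorem ind_neg {p : Prop} (h : ¬ p) : ind p = 0 := if_neg h

theorem ind_mul_ind (p q : Prop) : ind p * ind q = ind (p ∧ q) := by
  by_cases hp : p <;> by_cases hq : q <;> simp [ind, hp, hq]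

theorem one_sub_ind (p : Prop) : 1 - ind p = ind (¬ p) := by
  by_cases hp : p <;> simp [ind, hp]

theorem ind_nonneg (p : Prop) : 0 ≤ ind p := by
  by_cases hp : p <;> simp [ind, hp]

theorem ind_le_one (p : Prop) : ind p ≤ 1 := by
  by_cases hp : p <;> simp [ind, hp]

theorem ind_eq_zero {p : Prop} : ind p = 0 ↔ ¬ p := by
  by_cases hp : p <;> simp [ind, hp]

theorem natAbs_ind_le (p : Prop) : (ind p).natAbs ≤ 1 := by
  by_cases hp : p <;> simp [ind, hp]

theorem ind_congr {p q : Prop} (h : p ↔ q) : ind p = ind q := by rw [propext h]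

namespace RamExpr

variable {m : RamMem} {e e₁ e₂ t : RamExpr} {i x y : ℕ}

/-- The expression `e` has the natural number `x` as its value. -/
def Ev (m : RamMem) (e : RamExpr) (x : ℕ) : Prop := e.eval m = (x : ℤ)

theorem Ev.add (h₁ : Ev m e₁ x) (h₂ : Ev m e₂ y) : Ev m (e₁ + e₂) (x + y) := by
  unfold Ev at *; rw [eval_add, h₁, h₂, Nat.cast_add]
theorem Ev.mul (h₁ : Ev m e₁ x) (h₂ : Ev m e₂ y) : Ev m (e₁ * e₂) (x * y) := by
  unfold Ev at *; rw [eval_mul, h₁, h₂, Nat.cast_mul]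
theorem Ev.div (h₁ : Ev m e₁ x) (h₂ : Ev m e₂ y) : Ev m (e₁ / e₂) (x / y) := by
  unfold Ev at *; rw [eval_div, h₁, h₂, Int.natCast_div]
theorem Ev.mod (h₁ : Ev m e₁ x) (h₂ : Ev m e₂ y) : Ev m (e₁ % e₂) (x % y) := by
  unfold Ev at *; rw [eval_mod, h₁, h₂, Int.natCast_mod]
theorem Ev.sub (h₁ : Ev m e₁ x) (h₂ : Ev m e₂ y) (h : y ≤ x) : Ev m (e₁ - e₂) (x - y) := by
  unfold Ev at *; rw [eval_sub, h₁, h₂, Nat.cast_sub h]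
theorem ev_zero : Ev m 0 0 := rfl
theorem ev_one : Ev m 1 1 := rfl
theorem ev_two : Ev m 2 2 := rfl
theorem ev_const (x : ℕ) : Ev m (const x) x := rfl

theorem Ev.get (h : Ev m e i) (a : ℕ) : (RamExpr.get a e).eval m = m a i := by
  unfold Ev at h; rw [eval_get, h]

theorem Ev.isEq (h₁ : Ev m e₁ x) (h₂ : Ev m e₂ y) : (isEq e₁ e₂).eval m = ind (x = y) := by
  unfold Ev at *; rw [eval_isEq, h₁, h₂, ind_eq_ite]; simp only [Nat.cast_inj]
theorem Ev.isLt (h₁ : Ev m e₁ x) (h₂ : Ev m e₂ y) : (isLt e₁ e₂).eval m = ind (x < y) := by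
  unfold Ev at *; rw [eval_isLt, h₁, h₂, ind_eq_ite]; simp only [Nat.cast_lt]

theorem eval_two : (2 : RamExpr).eval m = 2 := rfl

/-- Both branches are always evaluated and the discarded one is multiplied by 0, so it may read
meaningless cells. -/
theorem eval_cond_pos {p : Prop} (ht : t.eval m = ind p) (hp : p) :
    (cond t e₁ e₂).eval m = e₁.eval m := by
  simp [cond, ht, ind_pos hp]

theorem eval_cond_neg {p : Prop} (ht : t.eval m = ind p) (hp : ¬ p) :
    (cond t e₁ e₂).eval m = e₂.eval m := by
  simp [cond, ht, ind_neg hp]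

end RamExpr

open RamExpr

/-! ### Positions in multidimensional tables -/

theorem mul_add_div_of_lt {x y Q : ℕ} (hy : y < Q) : (x * Q + y) / Q = x := by
  rw [mul_comm, Nat.mul_add_div (by omega), Nat.div_eq_of_lt hy, add_zero]

theorem mul_add_mod_of_lt {x y Q : ℕ} (hy : y < Q) : (x * Q + y) % Q = y := by
  rw [mul_comm, Nat.mul_add_mod, Nat.mod_eq_of_lt hy]

theorem mul_add_lt_mul {x y N Q : ℕ} (hx : x < N) (hy : y < Q) : x * Q + y < N * Q := by
  calc x * Q + y < (x + 1) * Q := by rw [add_mul]; omega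
    _ ≤ _ := Nat.mul_le_mul_right _ hx

theorem exists_eq_mul_add {j N Q : ℕ} (h : j < N * Q) : ∃ x y, x < N ∧ y < Q ∧ j = x * Q + y := by
  have hQ : 0 < Q := Nat.pos_of_ne_zero (by rintro rfl; simp at h)
  exact ⟨j / Q, j % Q, (Nat.div_lt_iff_lt_mul hQ).2 h, Nat.mod_lt _ hQ, (Nat.div_add_mod' j Q).symm⟩

namespace LCCMInstance

variable (I : LCCMInstance) (e₀ : ℕ) (ω : ℕ → Bool)

/-! ### The tables of the algorithm -/

/-- The number of adjacent pairs in the set `S`. -/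
noncomputable def conflicts (S : ℕ) : ℤ := ∑ i ∈ Finset.range (I.n * I.n),
  ind ((I.bit (fun j => S.testBit j = true) (i / I.n) ∧
    I.bit (fun j => S.testBit j = true) (i % I.n)) ∧ I.adj (i / I.n) (i % I.n))

/-- The contents of the arrays. -/
noncomputable def tab : ℕ → ℕ → ℤ
  | 0, j => I.word j
  | 2, j => I.start j
  | 3, j => I.rank j
  | 4, j => 2 ^ j
  | 5, j => bitSign I.k j
  | 6, j => ind (I.allow (j / I.Q) (j % I.Q))
  | 7, j => I.conflicts j
  | 8, j => I.goodVal (j / 2 ^ I.k / I.Q) (j / 2 ^ I.k % I.Q) (j % 2 ^ I.k)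
  | 9, j => zetaStep (I.goodVal (j / 2 ^ I.k / I.Q % I.Q) (j / 2 ^ I.k % I.Q))
      (j / 2 ^ I.k / I.Q / I.Q) (j % 2 ^ I.k)
  | 10, j => if ω j then 1 else 0
  | 11, j => matEntry (I.mat (I.Q + e₀) ω (j / I.Q / I.Q)) (j / I.Q % I.Q) (j % I.Q)
  | 12, j => matEntry (I.mat (I.Q + e₀) ω (j / I.Q / I.Q / (I.Q + 1)) ^ (j / I.Q / I.Q % (I.Q + 1)))
      (j / I.Q % I.Q) (j % I.Q)
  | 13, j => (I.mat (I.Q + e₀) ω (j / (I.Q + 1)) ^ (j % (I.Q + 1))).trace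
  | 14, j => (I.mat (I.Q + e₀) ω (j / (I.Q + 1))).revCharCoeff (j % (I.Q + 1))
  | 15, _ => I.answer (I.Q + e₀) ω
  | _, _ => 0

/-- The sizes of the arrays. -/
noncomputable def sz : ℕ → ℕ
  | 0 => I.Q
  | 2 => I.n + 1
  | 3 => I.n + 1
  | 4 => I.Q + e₀ + 1
  | 5 => 2 ^ I.k
  | 6 => I.n * I.Q
  | 7 => 2 ^ I.k
  | 8 => I.Q * I.Q * 2 ^ I.k
  | 9 => (I.k + 1) * I.Q * I.Q * 2 ^ I.k
  | 10 => I.Q * I.Q * (I.Q + e₀)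
  | 11 => 2 ^ I.k * I.Q * I.Q
  | 12 => 2 ^ I.k * (I.Q + 1) * I.Q * I.Q
  | 13 => 2 ^ I.k * (I.Q + 1)
  | 14 => 2 ^ I.k * (I.Q + 1)
  | 15 => 1
  | _ => 0

/-- A bound for the parameters of the algorithm. -/
noncomputable def β : ℕ := I.Q + e₀ + 2

/-- A bound for the bit lengths of all numbers. -/
noncomputable def W : ℕ := I.size + 8 * I.β e₀ ^ 2

/-- The arrays below `T` have been filled. -/
def Avail (T : ℕ) (m : RamMem) : Prop := ∀ a < T, ∀ j < I.sz e₀ a, m a j = I.tab e₀ ω a j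

/-- The arrays below `T` and the first `j` cells of array `T` have been filled, and `j` is the
outer index. -/
structure AvailAt (T j : ℕ) (m : RamMem) : Prop where
  avail : I.Avail e₀ ω T m
  own : ∀ i < j, m T i = I.tab e₀ ω T i
  idx : m 101 0 = j

/-- The state after the arrays below `T` have been filled. -/
structure Inv (T : ℕ) (s : RamState) : Prop where
  avail : I.Avail e₀ ω T s.mem
  bounded : s.mem.Bounded (I.W e₀)
  coins : T ≤ 10 → s.coins = ω

variable {I e₀ ω}

theorem one_le_W : 1 ≤ I.W e₀ := by
  have : 0 < I.β e₀ ^ 2 := pow_pos (by unfold β; omega) 2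
  unfold W; omega

theorem Avail.succ {T : ℕ} {m : RamMem} (h : I.Avail e₀ ω T m)
    (h' : ∀ i < I.sz e₀ T, m T i = I.tab e₀ ω T i) : I.Avail e₀ ω (T + 1) m := by
  intro a ha i hi
  rcases Nat.lt_succ_iff_lt_or_eq.1 ha with ha | rfl
  · exact h a ha i hi
  · exact h' i hi

/-- Specializes `runs_sumFill` to the tables `tab`: while table `T` is filled, all earlier tables
and its own earlier cells may be read. The bound on `T` keeps it clear of the scratch arrays 101 to
103. -/
theorem Inv.sumFill {T Mm : ℕ} {N M E F : RamExpr} (h : ℕ → ℕ → ℤ) (hT : T ≤ 100)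
    (hN : ∀ m, I.Avail e₀ ω T m → Ev m N (I.sz e₀ T)) (hM : ∀ m, I.Avail e₀ ω T m → Ev m M Mm)
    (hE : ∀ j < I.sz e₀ T, ∀ i < Mm, ∀ m, I.AvailAt e₀ ω T j m → m 102 0 = i → E.eval m = h j i)
    (hF : ∀ j < I.sz e₀ T, ∀ m, I.AvailAt e₀ ω T j m →
      m 103 0 = ∑ i ∈ Finset.range Mm, h j i → F.eval m = I.tab e₀ ω T j)
    (hb : ∀ j < I.sz e₀ T, ∑ i ∈ Finset.range Mm, (h j i).natAbs < 2 ^ I.W e₀)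
    (hg : ∀ j < I.sz e₀ T, (I.tab e₀ ω T j).natAbs < 2 ^ I.W e₀)
    (hNW : I.sz e₀ T < 2 ^ I.W e₀) (hMW : Mm < 2 ^ I.W e₀)
    (hcost : (I.sz e₀ T + 1) * (Mm + 1) ≤ 2 ^ I.k * I.β e₀ ^ 7)
    {s : RamState} (hs : I.Inv e₀ ω T s) :
    (_root_.sumFill T N M E F).Runs s
      (sumFillFactor N M E F * (I.W e₀ * (2 ^ I.k * I.β e₀ ^ 7))) (I.Inv e₀ ω (T + 1)) := by
  have hsc : ¬ scratch T := by unfold scratch; omega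
  have hframe : ∀ m, FrameEq T s.mem m → I.Avail e₀ ω T m := fun m hm a ha i hi => by
    rw [hm a ha.ne (by unfold scratch; omega)]
    exact hs.avail a ha i hi
  refine (runs_sumFill (g := I.tab e₀ ω T) (h := h) one_le_W hsc hNW hMW
    (fun m hm => hN m (hframe m hm)) (fun m hm => hM m (hframe m hm)) ?_ ?_ hb hg rfl
    hs.bounded).mono ?_ ?_
  · exact fun j hj i hi m hm h1 h2 => hE j hj i hi m ⟨hframe m hm.frame, hm.vals, h1⟩ h2
  · exact fun j hj m hm h1 h2 => hF j hj m ⟨hframe m hm.frame, hm.vals, h1⟩ h2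
  · rw [mul_assoc]
    exact Nat.mul_le_mul_left _ (Nat.mul_le_mul_left _ hcost)
  · rintro s' ⟨h1, h2⟩
    exact ⟨(hframe _ h2.frame).succ h2.vals, h2.bounded, fun h' => h1.trans (hs.coins (by omega))⟩

theorem Inv.flipFill {N : RamExpr} (hN : ∀ m, I.Avail e₀ ω 10 m → Ev m N (I.sz e₀ 10))
    (hNW : I.sz e₀ 10 < 2 ^ I.W e₀)
    (hcost : I.sz e₀ 10 + 1 ≤ 2 ^ I.k * I.β e₀ ^ 7) {s : RamState} (hs : I.Inv e₀ ω 10 s) :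
    (_root_.flipFill 10 N).Runs s
      (flipFillFactor N * (I.W e₀ * (2 ^ I.k * I.β e₀ ^ 7))) (I.Inv e₀ ω 11) := by
  have hsc : ¬ scratch 10 := by unfold scratch; omega
  have hframe : ∀ m, FrameEq 10 s.mem m → I.Avail e₀ ω 10 m := fun m hm a ha i hi => by
    rw [hm a ha.ne (by unfold scratch; omega)]
    exact hs.avail a ha i hi
  refine (runs_flipFill one_le_W hsc hNW (fun m hm => hN m (hframe m hm)) rfl hs.bounded).mono ?_ ?_
  · rw [mul_assoc]
    exact Nat.mul_le_mul_left _ (Nat.mul_le_mul_left _ hcost)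
  · intro s' h2
    refine ⟨(hframe _ h2.frame).succ fun i hi => ?_, h2.bounded, fun h' => by omega⟩
    rw [h2.vals i hi, hs.coins le_rfl]
    rfl

/-! ### Bounds -/

theorem two_le_β : 2 ≤ I.β e₀ := by unfold β; omega

theorem k_le_n : I.k ≤ I.n := by
  unfold k; exact (Finset.card_le_univ _).trans (by simp)

theorem k_lt_Q : I.k < I.Q := k_le_n.trans_lt I.n_lt_Q

theorem lt_two_pow_W {z x : ℕ} (h : z < 2 ^ x) (hx : x ≤ 8 * I.β e₀ ^ 2) : z < 2 ^ I.W e₀ :=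
  h.trans_le (Nat.pow_le_pow_right two_pos (hx.trans (Nat.le_add_left _ _)))

/-- Since k < β and β < 2^β, the product is below 2^((1+i)β); and 15 β ≤ 8 β² because β ≥ 2. -/
theorem two_pow_k_mul_lt {i z : ℕ} (hz : z ≤ I.β e₀ ^ i) (hi : i ≤ 14) :
    2 ^ I.k * z < 2 ^ I.W e₀ := by
  have hk : I.k + 1 ≤ I.β e₀ := by have := k_lt_Q (I := I); unfold β; omega
  have h2 := two_le_β (I := I) (e₀ := e₀)
  refine lt_two_pow_W (x := (1 + i) * I.β e₀) ?_ (by nlinarith)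
  rw [add_mul, one_mul, pow_add, mul_comm i, pow_mul]
  exact (Nat.mul_le_mul_left _ (hz.trans (Nat.pow_le_pow_left Nat.lt_two_pow_self.le _))).trans_lt
    (Nat.mul_lt_mul_of_pos_right (Nat.pow_lt_pow_right one_lt_two hk) (by positivity))

theorem lt_two_pow_W_of_le {i z : ℕ} (hz : z ≤ I.β e₀ ^ i) (hi : i ≤ 14) : z < 2 ^ I.W e₀ :=
  (Nat.le_mul_of_pos_left z (Nat.two_pow_pos I.k)).trans_lt (two_pow_k_mul_lt hz hi)

theorem one_lt_two_pow_W : 1 < 2 ^ I.W e₀ :=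
  Nat.one_lt_two_pow (by have := one_le_W (I := I) (e₀ := e₀); omega)

theorem natAbs_ind_lt (p : Prop) : (ind p).natAbs < 2 ^ I.W e₀ :=
  (natAbs_ind_le p).trans_lt one_lt_two_pow_W

/-- The cost of a step with at most `2 ^ k * β ^ 3` outer and `β ^ 2` inner iterations. -/
theorem cost_bound {N M : ℕ} (hN : N ≤ 2 ^ I.k * I.β e₀ ^ 3) (hM : M ≤ I.β e₀ ^ 2) :
    (N + 1) * (M + 1) ≤ 2 ^ I.k * I.β e₀ ^ 7 := by
  have h2 := two_le_β (I := I) (e₀ := e₀)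
  have hp := Nat.one_le_two_pow (n := I.k)
  generalize I.β e₀ = β at *
  generalize 2 ^ I.k = p at *
  have h3 : 1 ≤ β ^ 3 := Nat.one_le_pow _ _ (by omega)
  have h4 : 1 ≤ β ^ 2 := Nat.one_le_pow _ _ (by omega)
  have e1 : N + 1 ≤ p * β ^ 4 := by
    calc N + 1 ≤ p * β ^ 3 + p * β ^ 3 := by nlinarith
      _ = p * (2 * β ^ 3) := by ring
      _ ≤ p * (β * β ^ 3) := by gcongr
      _ = p * β ^ 4 := by ring
  have e2 : M + 1 ≤ β ^ 3 := by
    calc M + 1 ≤ 2 * β ^ 2 := by omega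
      _ ≤ β * β ^ 2 := by gcongr
      _ = β ^ 3 := by ring
  calc _ ≤ p * β ^ 4 * β ^ 3 := Nat.mul_le_mul e1 e2
    _ = _ := by ring

theorem le_two_pow_k_mul {N B : ℕ} (h : N ≤ B) : N ≤ 2 ^ I.k * B :=
  h.trans (Nat.le_mul_of_pos_left _ (Nat.two_pow_pos _))

/-! ### Common expressions -/

end LCCMInstance

/-- The number of vertices. -/
def eN : RamExpr := .get 0 0
/-- The size of the modulator. -/
def eK : RamExpr := .get 3 eN
/-- The length of the input word. -/
def eQ : RamExpr := .get 2 eN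
/-- The number of subsets of the modulator. -/
def eP : RamExpr := .get 4 eK
/-- Does the vertex `u` belong to the subset `S` of the modulator? -/
def eBit (u S : RamExpr) : RamExpr := .get 0 (1 + eN * eN + u) * (S / .get 4 (.get 3 u) % 2)
/-- Is `a` a vertex outside the modulator? -/
def eReal (a : RamExpr) : RamExpr := isLt a eN * (1 - .get 0 (1 + eN * eN + a))

namespace LCCMInstance

variable {I : LCCMInstance} {e₀ : ℕ} {ω : ℕ → Bool}

/-! ### Values of the common expressions once the tables are filled -/

namespace Avail

variable {T : ℕ} {m : RamMem} {e e' : RamExpr}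

theorem n (h : I.Avail e₀ ω T m) (hT : 0 < T) : Ev m eN I.n := by
  have h0 := h 0 hT 0 (by have := I.n_lt_Q; simp only [sz]; omega)
  simp only [tab, word_zero] at h0
  exact (ev_zero.get 0).trans h0

theorem Q (h : I.Avail e₀ ω T m) (hT : 2 < T) : Ev m eQ I.Q := by
  have h0 := h 2 hT I.n (by simp [sz])
  simp only [tab, ← Q_eq_start] at h0
  exact ((h.n (by omega)).get 2).trans h0

theorem k (h : I.Avail e₀ ω T m) (hT : 3 < T) : Ev m eK I.k := by
  have h0 := h 3 hT I.n (by simp [sz])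
  simp only [tab, rank_n] at h0
  exact ((h.n (by omega)).get 3).trans h0

theorem P (h : I.Avail e₀ ω T m) (hT : 4 < T) : Ev m eP (2 ^ I.k) := by
  have h0 := h 4 hT I.k (by have := k_lt_Q (I := I); simp only [sz]; omega)
  simp only [tab] at h0
  exact ((h.k (by omega)).get 4).trans (h0.trans (by push_cast; rfl))

theorem word (h : I.Avail e₀ ω T m) (hT : 0 < T) {p : ℕ} (he : Ev m e p) (hp : p < I.Q) :
    Ev m (.get 0 e) (I.word p) :=
  (he.get 0).trans (h 0 hT p hp)

theorem start (h : I.Avail e₀ ω T m) (hT : 2 < T) {u : ℕ} (he : Ev m e u) (hu : u ≤ I.n) :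
    Ev m (.get 2 e) (I.start u) :=
  (he.get 2).trans (h 2 hT u (Nat.lt_succ_of_le hu))

theorem inD (h : I.Avail e₀ ω T m) (hT : 0 < T) {u : ℕ} (he : Ev m e u) (hu : u < I.n) :
    (RamExpr.get 0 (1 + eN * eN + e)).eval m = ind (I.inD u) := by
  classical
  have hn := h.n hT
  refine (h.word hT ((ev_one.add (hn.mul hn)).add he) ?_).trans ?_
  · rw [Q_eq_start, LCCMInstance.start]; omega
  · rw [word_inD I hu, ind_eq_ite]; push_cast; rfl

theorem adj (h : I.Avail e₀ ω T m) (hT : 0 < T) {u v : ℕ} (he : Ev m e (u * I.n + v))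
    (hu : u < I.n) (hv : v < I.n) : (RamExpr.get 0 (1 + e)).eval m = ind (I.adj u v) := by
  classical
  have hlt := mul_add_lt_mul hu hv
  refine (h.word hT (ev_one.add he) ?_).trans ?_
  · rw [Q_eq_start, LCCMInstance.start]; omega
  · rw [word_adj I hu hv, ind_eq_ite]; push_cast; rfl

theorem pow (h : I.Avail e₀ ω T m) (hT : 4 < T) {i : ℕ} (he : Ev m e i) (hi : i ≤ I.Q + e₀) :
    Ev m (.get 4 e) (2 ^ i) :=
  (he.get 4).trans ((h 4 hT i (Nat.lt_succ_of_le hi)).trans (by simp [tab]))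

theorem testBit (h : I.Avail e₀ ω T m) (hT : 4 < T) {i S : ℕ} (he : Ev m e i) (hS : Ev m e' S)
    (hi : i ≤ I.Q + e₀) : (e' / .get 4 e % 2).eval m = ind (S.testBit i = true) := by
  refine ((hS.div (h.pow hT he hi)).mod ev_two).trans ?_
  rw [Nat.testBit_eq_decide_div_mod_eq, ind_eq_ite]
  rcases Nat.mod_two_eq_zero_or_one (S / 2 ^ i) with h | h <;> simp [h]

theorem bit (h : I.Avail e₀ ω T m) (hT : 4 < T) {u S : ℕ} (he : Ev m e u) (hS : Ev m e' S)
    (hu : u < I.n) : (eBit e e').eval m = ind (I.bit (fun i => S.testBit i = true) u) := by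
  have hr : Ev m (.get 3 e) (I.rank u) :=
    (he.get 3).trans (h 3 (by omega) u (Nat.lt_succ_of_lt hu))
  have hk : I.rank u ≤ I.Q + e₀ := by
    have := I.rank_le_k hu.le
    have := k_lt_Q (I := I)
    omega
  rw [eBit, eval_mul, h.inD (by omega) he hu, h.testBit hT hr hS hk, ind_mul_ind]
  rfl

theorem real (h : I.Avail e₀ ω T m) (hT : 0 < T) {a : ℕ} (he : Ev m e a) :
    (eReal e).eval m = ind (I.real a) := by
  rw [eReal, eval_mul, he.isLt (h.n hT)]
  by_cases ha : a < I.n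
  · rw [eval_sub, h.inD hT he ha, eval_one, one_sub_ind, ind_mul_ind]; rfl
  -- Beyond the vertices the cell read is not a modulator indicator, but its contribution is
  -- multiplied by 0.
  · rw [ind_neg ha, zero_mul, ind_neg]
    exact fun hr => ha hr.1

theorem allow (h : I.Avail e₀ ω T m) (hT : 6 < T) {u c : ℕ} (he : Ev m e (u * I.Q + c))
    (hu : u < I.n) (hc : c < I.Q) : (RamExpr.get 6 e).eval m = ind (I.allow u c) := by
  refine (he.get 6).trans ((h 6 hT _ (mul_add_lt_mul hu hc)).trans ?_)
  simp only [tab, mul_add_div_of_lt hc, mul_add_mod_of_lt hc]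

end Avail

theorem AvailAt.j {T j : ℕ} {m : RamMem} (h : I.AvailAt e₀ ω T j m) : Ev m vJ j := h.idx

theorem ev_vI {m : RamMem} {i : ℕ} (h : m 102 0 = i) : Ev m vI i := h

end LCCMInstance

namespace LCCMInstance

variable {I : LCCMInstance} {e₀ : ℕ}

/-! ### The steps of the algorithm -/

theorem Q_le_β : I.Q + e₀ + 2 ≤ I.β e₀ := le_rfl

theorem n_add_one_le_β : I.n + 2 ≤ I.β e₀ := by have := I.n_lt_Q; unfold β; omega

theorem β_le_pow {i : ℕ} (hi : i ≠ 0) : I.β e₀ ≤ I.β e₀ ^ i := Nat.le_self_pow hi _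

/-- The program fills the arrays from `T` to `T'` in time `2 ^ k` times a polynomial. -/
def Carries (e₀ T T' : ℕ) (p : RamProg) : Prop :=
  ∃ K, ∀ (I : LCCMInstance) (ω : ℕ → Bool) (s : RamState), I.Inv e₀ ω T s →
    p.Runs s (K * (I.W e₀ * (2 ^ I.k * I.β e₀ ^ 7))) (I.Inv e₀ ω T')

theorem carries_sumFill {T T' a : ℕ} {N M E F : RamExpr}
    (h : ∀ (I : LCCMInstance) (ω : ℕ → Bool) (s : RamState), I.Inv e₀ ω T s →
      (sumFill a N M E F).Runs s (sumFillFactor N M E F * (I.W e₀ * (2 ^ I.k * I.β e₀ ^ 7)))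
        (I.Inv e₀ ω T')) : Carries e₀ T T' (sumFill a N M E F) := ⟨_, h⟩

theorem carries_flipFill {T T' a : ℕ} {N : RamExpr}
    (h : ∀ (I : LCCMInstance) (ω : ℕ → Bool) (s : RamState), I.Inv e₀ ω T s →
      (flipFill a N).Runs s (flipFillFactor N * (I.W e₀ * (2 ^ I.k * I.β e₀ ^ 7)))
        (I.Inv e₀ ω T')) : Carries e₀ T T' (flipFill a N) := ⟨_, h⟩

theorem Carries.seq {T₁ T₂ T₃ : ℕ} {p q : RamProg} (hp : Carries e₀ T₁ T₂ p)
    (hq : Carries e₀ T₂ T₃ q) : Carries e₀ T₁ T₃ (.seq p q) := by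
  obtain ⟨K, hp⟩ := hp
  obtain ⟨L, hq⟩ := hq
  refine ⟨K + L, fun I ω s hs => ?_⟩
  rw [add_mul]
  exact (hp I ω s hs).seq fun s' hs' => hq I ω s' hs'

/-- The outer cost of a step without inner iterations. -/
theorem cost_bound_zero {N : ℕ} (hN : N ≤ 2 ^ I.k * I.β e₀ ^ 3) :
    (N + 1) * (0 + 1) ≤ 2 ^ I.k * I.β e₀ ^ 7 := cost_bound hN (Nat.zero_le _)

/-- The word at the start of a list holds its length, which leads to the start of the next list. -/
theorem step_start : Carries e₀ 2 3
    (sumFill 2 (eN + 1) 0 0 (.cond (.isEq vJ 0) (1 + eN * eN + eN)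
      (.get 2 (vJ - 1) + .get 0 (.get 2 (vJ - 1)) + 1))) := by
  refine carries_sumFill fun I ω s hs => ?_
  have hβ := (β_le_pow (I := I) (e₀ := e₀) three_ne_zero)
  have hn := n_add_one_le_β (I := I) (e₀ := e₀)
  have hN : I.n + 1 ≤ I.β e₀ ^ 3 := by omega
  refine Inv.sumFill (T := 2) (Mm := 0) (fun _ _ => 0) (by omega) (fun m hm => (hm.n (by omega)).add ev_one)
    (fun m _ => ev_zero) (by omega) ?_ (by simp) ?_ (lt_two_pow_W_of_le hN (by omega)) (by simp)
    (cost_bound_zero (le_two_pow_k_mul hN)) hs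
  · intro j hj m hm _
    have hn := hm.avail.n (by omega)
    rcases j with _ | j
    · rw [eval_cond_pos (hm.j.isEq ev_zero) rfl]
      refine ((ev_one.add (hn.mul hn)).add hn).trans ?_
      simp [tab, LCCMInstance.start]
    · have hj' : j < I.n := by simpa [sz] using hj
      have hlt : I.start j < I.Q := by
        have h1 := I.start_le_Q (u := j + 1) (by omega)
        rw [start_succ] at h1; omega
      rw [eval_cond_neg (hm.j.isEq ev_zero) (Nat.succ_ne_zero _)]
      have e1 : Ev m (.get 2 (vJ - 1)) (I.start j) :=
        ((hm.j.sub ev_one (by omega)).get 2).trans (hm.own j (by omega))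
      refine ((e1.add (hm.avail.word (by omega) e1 hlt)).add ev_one).trans ?_
      rw [word_start I hj']
      simp only [tab, start_succ]
  · intro j hj
    have hj' : j ≤ I.n := by simpa [sz, Nat.lt_succ_iff] using hj
    have := I.start_le_Q hj'
    simp only [tab, Int.natAbs_natCast]
    refine lt_two_pow_W_of_le (i := 1) ?_ (by omega)
    rw [pow_one]; unfold β; omega

theorem step_rank : Carries e₀ 3 4
    (sumFill 3 (eN + 1) 0 0 (.cond (.isEq vJ 0) 0
      (.get 3 (vJ - 1) + .get 0 (1 + eN * eN + (vJ - 1))))) := by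
  refine carries_sumFill fun I ω s hs => ?_
  classical
  have hβ := (β_le_pow (I := I) (e₀ := e₀) three_ne_zero)
  have hn := n_add_one_le_β (I := I) (e₀ := e₀)
  have hN : I.n + 1 ≤ I.β e₀ ^ 3 := by omega
  refine Inv.sumFill (T := 3) (Mm := 0) (fun _ _ => 0) (by omega) (fun m hm => (hm.n (by omega)).add ev_one)
    (fun m _ => ev_zero) (by omega) ?_ (by simp) ?_ (lt_two_pow_W_of_le hN (by omega)) (by simp)
    (cost_bound_zero (le_two_pow_k_mul hN)) hs
  · intro j hj m hm _
    rcases j with _ | j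
    · rw [eval_cond_pos (hm.j.isEq ev_zero) rfl]
      simp [tab, LCCMInstance.rank]
    · have hj' : j < I.n := by simpa [sz] using hj
      have e1 := hm.j.sub ev_one (by omega)
      rw [eval_cond_neg (hm.j.isEq ev_zero) (Nat.succ_ne_zero _), eval_add,
        hm.avail.inD (by omega) e1 hj', (e1.get 3).trans (hm.own j (by omega)), ind_eq_ite]
      simp only [tab, LCCMInstance.rank, Nat.count_succ]
      push_cast
      rfl
  · intro j hj
    have hj' : j ≤ I.n := by simpa [sz, Nat.lt_succ_iff] using hj
    have := I.rank_le_k hj'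
    have := k_lt_Q (I := I)
    simp only [tab, Int.natAbs_natCast]
    refine lt_two_pow_W_of_le (i := 1) ?_ (by omega)
    rw [pow_one]; unfold β; omega

theorem step_pow : Carries e₀ 4 5
    (sumFill 4 (eQ + .const e₀ + 1) 0 0 (.cond (.isEq vJ 0) 1
      (2 * .get 4 (vJ - 1)))) := by
  refine carries_sumFill fun I ω s hs => ?_
  have hβ := (β_le_pow (I := I) (e₀ := e₀) three_ne_zero)
  have hN : I.Q + e₀ + 1 ≤ I.β e₀ ^ 3 := by have := Q_le_β (I := I) (e₀ := e₀); omega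
  refine Inv.sumFill (T := 4) (Mm := 0) (fun _ _ => 0) (by omega)
    (fun m hm => ((hm.Q (by omega)).add (ev_const _)).add ev_one)
    (fun m _ => ev_zero) (by omega) ?_ (by simp) ?_ (lt_two_pow_W_of_le hN (by omega)) (by simp)
    (cost_bound_zero (le_two_pow_k_mul hN)) hs
  · intro j hj m hm _
    rcases j with _ | j
    · rw [eval_cond_pos (hm.j.isEq ev_zero) rfl]
      simp [tab]
    · have e1 := hm.j.sub ev_one (by omega)
      rw [eval_cond_neg (hm.j.isEq ev_zero) (Nat.succ_ne_zero _), eval_mul,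
        (e1.get 4).trans (hm.own j (by omega))]
      simp only [tab, pow_succ', eval_two]
  · intro j hj
    have hj' : j < I.Q + e₀ + 1 := hj
    simp only [tab, Int.natAbs_pow, show (2 : ℤ).natAbs = 2 from rfl]
    refine lt_two_pow_W (x := I.β e₀) (Nat.pow_lt_pow_right one_lt_two ?_) ?_
    · unfold β; omega
    · have := two_le_β (I := I) (e₀ := e₀); nlinarith

theorem step_sign : Carries e₀ 5 6
    (sumFill 5 eP 0 0 (.cond (.isEq vJ 0) 1
      (.get 5 (vJ / 2) * (1 - 2 * (vJ % 2))))) := by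
  refine carries_sumFill fun I ω s hs => ?_
  have h0 := Nat.one_le_pow 3 (I.β e₀) (by have := two_le_β (I := I) (e₀ := e₀); omega)
  have hN := Nat.mul_le_mul_left (2 ^ I.k) h0
  rw [mul_one] at hN
  refine Inv.sumFill (T := 5) (Mm := 0) (fun _ _ => 0) (by omega)
    (fun m hm => hm.P (by omega))
    (fun m _ => ev_zero) (by omega) ?_ (by simp) ?_
    (hN.trans_lt (two_pow_k_mul_lt le_rfl (by omega))) (by simp)
    (cost_bound_zero hN) hs
  · intro j hj m hm _
    have hj' : j < 2 ^ I.k := hj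
    rcases Nat.eq_zero_or_pos j with rfl | hpos
    · rw [eval_cond_pos (hm.j.isEq ev_zero) rfl]
      simp [tab, bitSign_zero]
    · rw [eval_cond_neg (hm.j.isEq ev_zero) hpos.ne', eval_mul,
        ((hm.j.div ev_two).get 5).trans (hm.own (j / 2) (by omega)), eval_sub, eval_mul,
        (hm.j.mod ev_two : _ = _)]
      simp only [tab, bitSign_div_two hpos.ne' hj', eval_one, eval_two]
  · intro j _
    simp only [tab, natAbs_bitSign]
    exact one_lt_two_pow_W

/-- The number of occurrences of the color at position `p` in the list of `u`, or a number that is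
not positive if the color occurs before `p`. -/
noncomputable def allowTerm (I : LCCMInstance) (u p i : ℕ) : ℤ :=
  ind (I.word i = I.word p) * (ind (I.start u < i) * ind (i < I.start (u + 1)) - I.Q * ind (i < p))

theorem natAbs_allowTerm_le (u p i : ℕ) : (I.allowTerm u p i).natAbs ≤ 1 + I.Q := by
  unfold allowTerm
  rw [ind_mul_ind, Int.natAbs_mul]
  refine (Nat.mul_le_mul (natAbs_ind_le _) ((Int.natAbs_sub_le _ _).trans
    (Nat.add_le_add (natAbs_ind_le _) ?_))).trans (by rw [one_mul])
  rw [Int.natAbs_mul, Int.natAbs_natCast]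
  exact (Nat.mul_le_mul_left _ (natAbs_ind_le _)).trans (by rw [mul_one])

/-- Without an earlier occurrence of the color, the terms are indicators of its occurrences in the
list of `u`. One earlier occurrence brings a penalty of Q, which outweighs the at most Q positive
contributions. -/
theorem allow_iff {u p : ℕ} (hu : u < I.n) (hp : p < I.Q) :
    0 < ∑ i ∈ Finset.range I.Q, I.allowTerm u p i ↔ I.allow u p := by
  classical
  have hle : ∀ i, I.allowTerm u p i ≤ 1 := by
    intro i
    rw [allowTerm, ind_mul_ind]
    by_cases h1 : I.word i = I.word p
    · rw [ind_pos h1, one_mul]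
      have := ind_le_one (I.start u < i ∧ i < I.start (u + 1))
      have := mul_nonneg (Nat.cast_nonneg (α := ℤ) I.Q) (ind_nonneg (i < p))
      linarith
    · rw [ind_neg h1, zero_mul]; exact zero_le_one
  rw [allow]
  by_cases hf : ∀ q < p, I.word q ≠ I.word p
  · have hterm : ∀ i, I.allowTerm u p i =
        ind (I.word i = I.word p ∧ I.start u < i ∧ i < I.start (u + 1)) := by
      intro i
      rw [allowTerm]
      by_cases h1 : I.word i = I.word p
      · rw [ind_neg (p := i < p) fun h => hf i h h1, mul_zero, sub_zero, ind_mul_ind, ind_mul_ind]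
      · rw [ind_neg h1, zero_mul, ind_neg fun h => h1 h.1]
    rw [Finset.sum_pos_iff_of_nonneg fun i _ => by rw [hterm]; exact ind_nonneg _,
      mem_list_iff I hu]
    simp only [hterm, Finset.mem_range]
    constructor
    · rintro ⟨i, _, h⟩
      refine ⟨⟨i, ?_⟩, hf⟩
      by_contra hc
      rw [ind_neg fun hh => hc ⟨hh.2.1, hh.2.2, hh.1⟩] at h
      exact lt_irrefl _ h
    · rintro ⟨⟨i, h1, h2, h3⟩, _⟩
      exact ⟨i, h2.trans_le (I.start_le_Q (by omega)), by rw [ind_pos ⟨h3, h1, h2⟩]; simp⟩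
  · refine iff_of_false ?_ fun h => hf h.2
    push Not at hf
    obtain ⟨q, hq, he⟩ := hf
    rw [not_lt]
    have hq' : q ∈ Finset.range I.Q := Finset.mem_range.2 (hq.trans hp)
    calc ∑ i ∈ Finset.range I.Q, I.allowTerm u p i
        ≤ ∑ i ∈ Finset.range I.Q, (1 - if i = q then (I.Q : ℤ) else 0) := by
          refine Finset.sum_le_sum fun i _ => ?_
          split_ifs with hi
          · subst hi
            rw [allowTerm, ind_pos he, ind_pos hq, ind_mul_ind]
            have := ind_le_one (I.start u < i ∧ i < I.start (u + 1))
            linarith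
          · simpa using hle i
      _ = 0 := by
          rw [Finset.sum_sub_distrib, Finset.sum_ite_eq', if_pos hq']
          simp

theorem step_allow : Carries e₀ 6 7
    (sumFill 6 (eN * eQ) eQ (.isEq (.get 0 vI) (.get 0 (vJ % eQ)) *
      (.isLt (.get 2 (vJ / eQ)) vI * .isLt vI (.get 2 (vJ / eQ + 1)) - eQ * .isLt vI (vJ % eQ)))
      (.isLt 0 vAcc)) := by
  refine carries_sumFill fun I ω s hs => ?_
  have hn := n_add_one_le_β (I := I) (e₀ := e₀)
  have hQ := Q_le_β (I := I) (e₀ := e₀)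
  have h2 := two_le_β (I := I) (e₀ := e₀)
  have hM : I.Q ≤ I.β e₀ ^ 2 := by nlinarith
  have hN2 : I.n * I.Q ≤ I.β e₀ ^ 2 := by nlinarith
  have hN : I.n * I.Q ≤ I.β e₀ ^ 3 := hN2.trans (Nat.pow_le_pow_right (by omega) (by omega))
  refine Inv.sumFill (T := 6) (Mm := I.Q) (fun j i => I.allowTerm (j / I.Q) (j % I.Q) i) (by omega)
    (fun m hm => (hm.n (by omega)).mul (hm.Q (by omega)))
    (fun m hm => hm.Q (by omega)) ?_ ?_ ?_ ?_
    (lt_two_pow_W_of_le hN2 (by omega)) (lt_two_pow_W_of_le hM (by omega))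
    (cost_bound (le_two_pow_k_mul hN) hM) hs
  · intro j hj i hi m hm hI
    obtain ⟨u, p, hu, hp, rfl⟩ := exists_eq_mul_add (N := I.n) (Q := I.Q) hj
    have hQ := hm.avail.Q (by omega)
    have hI := ev_vI hI
    have eu := hm.j.div hQ
    have ep := hm.j.mod hQ
    rw [mul_add_div_of_lt hp] at eu ⊢
    rw [mul_add_mod_of_lt hp] at ep ⊢
    rw [eval_mul, eval_sub, eval_mul, eval_mul,
      (hm.avail.word (by omega) hI hi).isEq (hm.avail.word (by omega) ep hp),
      (hm.avail.start (by omega) eu (by omega)).isLt hI,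
      hI.isLt (hm.avail.start (by omega) (eu.add ev_one) (by omega)), hI.isLt ep, (hQ : _ = _)]
    simp only [allowTerm]
  · intro j hj m hm hA
    obtain ⟨u, p, hu, hp, rfl⟩ := exists_eq_mul_add (N := I.n) (Q := I.Q) hj
    rw [mul_add_div_of_lt hp, mul_add_mod_of_lt hp] at hA
    classical
    rw [eval_isLt, eval_vAcc, hA, eval_zero, ← ind_eq_ite, ind_congr (allow_iff hu hp)]
    simp only [tab, mul_add_div_of_lt hp, mul_add_mod_of_lt hp]
  · intro j hj
    refine lt_two_pow_W_of_le (i := 2) ?_ (by omega)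
    refine (Finset.sum_le_sum fun i _ => natAbs_allowTerm_le _ _ i).trans ?_
    simp only [Finset.sum_const, Finset.card_range, smul_eq_mul]
    nlinarith
  · intro j _
    exact natAbs_ind_lt _

/-- Edges inside S depend on neither row nor column; counting them once per S keeps the inner loop
of `step_good` linear in n. -/
theorem step_conflicts : Carries e₀ 7 8
    (sumFill 7 eP (eN * eN) (eBit (vI / eN) vJ * eBit (vI % eN) vJ * .get 0 (1 + vI))
      vAcc) := by
  refine carries_sumFill fun I ω s hs => ?_
  have hn := n_add_one_le_β (I := I) (e₀ := e₀)
  have h0 := Nat.one_le_pow 3 (I.β e₀) (by have := two_le_β (I := I) (e₀ := e₀); omega)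
  have hN := Nat.mul_le_mul_left (2 ^ I.k) h0
  rw [mul_one] at hN
  have hM : I.n * I.n ≤ I.β e₀ ^ 2 := by nlinarith
  have hMW := lt_two_pow_W_of_le hM (by omega)
  have hb : ∀ j : ℕ, ∑ i ∈ Finset.range (I.n * I.n), (ind ((I.bit (fun l => j.testBit l = true)
      (i / I.n) ∧ I.bit (fun l => j.testBit l = true) (i % I.n)) ∧
      I.adj (i / I.n) (i % I.n))).natAbs < 2 ^ I.W e₀ := by
    intro j
    refine lt_of_le_of_lt ?_ hMW
    refine (Finset.sum_le_sum fun i _ => natAbs_ind_le _).trans (by simp)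
  refine Inv.sumFill (T := 7) (Mm := I.n * I.n) (fun j i => ind ((I.bit (fun l => j.testBit l = true)
      (i / I.n) ∧ I.bit (fun l => j.testBit l = true) (i % I.n)) ∧ I.adj (i / I.n) (i % I.n)))
    (by omega) (fun m hm => hm.P (by omega))
    (fun m hm => (hm.n (by omega)).mul (hm.n (by omega))) ?_ ?_ (fun j _ => hb j) ?_
    (hN.trans_lt (two_pow_k_mul_lt le_rfl (by omega))) hMW (cost_bound hN hM) hs
  · intro j hj i hi m hm hI
    obtain ⟨u, v, hu, hv, rfl⟩ := exists_eq_mul_add hi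
    have hn := hm.avail.n (by omega)
    have hI := ev_vI hI
    have eu := hI.div hn
    have ev := hI.mod hn
    rw [mul_add_div_of_lt hv] at eu
    rw [mul_add_mod_of_lt hv] at ev
    simp only [mul_add_div_of_lt hv, mul_add_mod_of_lt hv]
    rw [eval_mul, eval_mul, hm.avail.bit (by omega) eu hm.j hu,
      hm.avail.bit (by omega) ev hm.j hv, hm.avail.adj (by omega) hI hu hv, ind_mul_ind,
      ind_mul_ind]
  · intro j hj m hm hA
    rw [eval_vAcc, hA]
    rfl
  · intro j _
    exact (Int.natAbs_sum_le _ _).trans_lt (hb j)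

/-- The contribution of the modulator vertex `u` to the number of violated conditions. -/
noncomputable def violation (I : LCCMInstance) (a c S u : ℕ) : ℤ :=
  ind (I.bit (fun i => S.testBit i = true) u) *
    (ind (¬ I.allow u c) + ind (I.real a) * ind (I.adj a u))

theorem violation_nonneg (a c S u : ℕ) : 0 ≤ I.violation a c S u :=
  mul_nonneg (ind_nonneg _) (add_nonneg (ind_nonneg _) (mul_nonneg (ind_nonneg _) (ind_nonneg _)))

theorem natAbs_violation_le (a c S u : ℕ) : (I.violation a c S u).natAbs ≤ 2 := by
  rw [violation, ind_mul_ind, Int.natAbs_mul]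
  exact Nat.mul_le_mul (natAbs_ind_le _) ((Int.natAbs_add_le _ _).trans
    (Nat.add_le_add (natAbs_ind_le _) (natAbs_ind_le _)))

theorem conflicts_nonneg (S : ℕ) : 0 ≤ I.conflicts S := Finset.sum_nonneg fun _ _ => ind_nonneg _

/-- Goodness becomes the vanishing of a count of violations; all contributions are nonnegative, so
they cannot cancel. -/
theorem good_iff (a c S : ℕ) :
    ∑ u ∈ Finset.range I.n, I.violation a c S u + I.conflicts S +
      ind (I.real a) * ind (¬ I.allow a c) = 0 ↔ I.good a c fun i => S.testBit i = true := by
  have h1 := Finset.sum_nonneg fun u (_ : u ∈ Finset.range I.n) => violation_nonneg (I := I) a c S u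
  have h2 := conflicts_nonneg (I := I) S
  have h3 := mul_nonneg (ind_nonneg (I.real a)) (ind_nonneg (¬ I.allow a c))
  rw [add_eq_zero_iff_of_nonneg (add_nonneg h1 h2) h3, add_eq_zero_iff_of_nonneg h1 h2,
    Finset.sum_eq_zero_iff_of_nonneg fun u _ => violation_nonneg a c S u, conflicts,
    Finset.sum_eq_zero_iff_of_nonneg fun _ _ => ind_nonneg _, good, and_assoc]
  refine and_congr ?_ (and_congr ?_ ?_)
  · refine forall_congr' fun u => ?_
    rw [Finset.mem_range]
    refine imp_congr_right fun _ => ?_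
    rw [violation, mul_eq_zero, ind_eq_zero, add_eq_zero_iff_of_nonneg (ind_nonneg _)
      (mul_nonneg (ind_nonneg _) (ind_nonneg _)), ind_eq_zero, ind_mul_ind, ind_eq_zero]
    tauto
  · constructor
    · intro h u hu v hv hbu hbv ha
      have := h (u * I.n + v) (Finset.mem_range.2 (mul_add_lt_mul hu hv))
      rw [ind_eq_zero, mul_add_div_of_lt hv, mul_add_mod_of_lt hv] at this
      exact this ⟨⟨hbu, hbv⟩, ha⟩
    · intro h i hi
      obtain ⟨u, v, hu, hv, rfl⟩ := exists_eq_mul_add (Finset.mem_range.1 hi)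
      rw [ind_eq_zero, mul_add_div_of_lt hv, mul_add_mod_of_lt hv]
      exact fun hh => h u hu v hv hh.1.1 hh.1.2 hh.2
  · rw [ind_mul_ind, ind_eq_zero]
    tauto

theorem goodVal_eq (a c S : ℕ) :
    I.goodVal a c S = ind (I.good a c fun i => S.testBit i = true) := by
  classical
  rw [goodVal, ind_eq_ite]

theorem goodVal_nonneg (a c S : ℕ) : 0 ≤ I.goodVal a c S := by
  rw [goodVal_eq]; exact ind_nonneg _

theorem goodVal_le_one (a c S : ℕ) : I.goodVal a c S ≤ 1 := by
  rw [goodVal_eq]; exact ind_le_one _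

theorem step_good : Carries e₀ 8 9
    (sumFill 8 (eQ * eQ * eP) eN (eBit vI (vJ % eP) *
        (1 - .get 6 (vI * eQ + vJ / eP % eQ) +
          eReal (vJ / eP / eQ) * .get 0 (1 + (vJ / eP / eQ * eN + vI))))
      (.isEq (vAcc + .get 7 (vJ % eP) +
        eReal (vJ / eP / eQ) * (1 - .get 6 (vJ / eP / eQ * eQ + vJ / eP % eQ))) 0)) := by
  refine carries_sumFill fun I ω s hs => ?_
  have hn := n_add_one_le_β (I := I) (e₀ := e₀)
  have hQ := Q_le_β (I := I) (e₀ := e₀)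
  have h2 := two_le_β (I := I) (e₀ := e₀)
  have hN : I.Q * I.Q * 2 ^ I.k ≤ 2 ^ I.k * I.β e₀ ^ 3 := by
    rw [mul_comm]
    refine Nat.mul_le_mul_left _ ?_
    calc I.Q * I.Q ≤ I.β e₀ * I.β e₀ := Nat.mul_le_mul (by omega) (by omega)
      _ = I.β e₀ ^ 2 := by ring
      _ ≤ _ := Nat.pow_le_pow_right (by omega) (by omega)
  have hM : I.n ≤ I.β e₀ ^ 2 := by nlinarith
  refine Inv.sumFill (T := 8) (Mm := I.n) (fun j u => I.violation (j / 2 ^ I.k / I.Q) (j / 2 ^ I.k % I.Q)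
      (j % 2 ^ I.k) u) (by omega)
    (fun m hm => ((hm.Q (by omega)).mul (hm.Q (by omega))).mul (hm.P (by omega)))
    (fun m hm => hm.n (by omega)) ?_ ?_ ?_ ?_
    (hN.trans_lt (two_pow_k_mul_lt le_rfl (by omega))) (lt_two_pow_W_of_le hM (by omega))
    (cost_bound hN hM) hs
  · intro j hj u hu m hm hI
    obtain ⟨x, S, hx, hS, rfl⟩ := exists_eq_mul_add (N := I.Q * I.Q) (Q := 2 ^ I.k) hj
    obtain ⟨a, c, ha, hc, rfl⟩ := exists_eq_mul_add hx
    have hQ := hm.avail.Q (by omega)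
    have hP := hm.avail.P (by omega)
    have hI := ev_vI hI
    have eS := hm.j.mod hP
    have ex := hm.j.div hP
    rw [mul_add_div_of_lt hS] at ex
    rw [mul_add_mod_of_lt hS] at eS
    have ea := ex.div hQ
    have ec := ex.mod hQ
    rw [mul_add_div_of_lt hc] at ea
    rw [mul_add_mod_of_lt hc] at ec
    simp only [mul_add_div_of_lt hS, mul_add_mod_of_lt hS, mul_add_div_of_lt hc,
      mul_add_mod_of_lt hc]
    rw [eval_mul, hm.avail.bit (by omega) hI eS hu, eval_add, eval_sub, eval_one,
      hm.avail.allow (by omega) ((hI.mul hQ).add ec) hu hc, one_sub_ind, eval_mul,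
      hm.avail.real (by omega) ea, violation]
    -- For a dummy row the adjacency cell has no meaning, but it is multiplied by 0.
    by_cases hr : I.real a
    · rw [hm.avail.adj (by omega) ((ea.mul (hm.avail.n (by omega))).add hI) hr.1 hu]
    · rw [ind_neg hr, zero_mul, zero_mul]
  · intro j hj m hm hA
    obtain ⟨x, S, hx, hS, rfl⟩ := exists_eq_mul_add (N := I.Q * I.Q) (Q := 2 ^ I.k) hj
    obtain ⟨a, c, ha, hc, rfl⟩ := exists_eq_mul_add hx
    have hQ := hm.avail.Q (by omega)
    have hP := hm.avail.P (by omega)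
    have eS := hm.j.mod hP
    have ex := hm.j.div hP
    rw [mul_add_div_of_lt hS] at ex
    rw [mul_add_mod_of_lt hS] at eS
    have ea := ex.div hQ
    have ec := ex.mod hQ
    rw [mul_add_div_of_lt hc] at ea
    rw [mul_add_mod_of_lt hc] at ec
    simp only [mul_add_div_of_lt hS, mul_add_mod_of_lt hS, mul_add_div_of_lt hc,
      mul_add_mod_of_lt hc, tab] at hA ⊢
    have h7 : m 7 (S : ℤ) = I.conflicts S := hm.avail 7 (by omega) S hS
    have hlast : (eReal (vJ / eP / eQ) * (1 - .get 6 (vJ / eP / eQ * eQ + vJ / eP % eQ))).eval m =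
        ind (I.real a) * ind (¬ I.allow a c) := by
      rw [eval_mul, hm.avail.real (by omega) ea]
      by_cases hr : I.real a
      · rw [eval_sub, eval_one, hm.avail.allow (by omega) ((ea.mul hQ).add ec) hr.1 hc, one_sub_ind]
      · rw [ind_neg hr, zero_mul, zero_mul]
    classical
    rw [eval_isEq, eval_add, eval_add, eval_vAcc, hA, eS.get, h7, hlast, eval_zero, ← ind_eq_ite,
      goodVal_eq, ind_congr (good_iff a c S)]
  · intro j hj
    refine lt_two_pow_W_of_le (i := 2) ?_ (by omega)
    refine (Finset.sum_le_sum fun i _ => natAbs_violation_le _ _ _ i).trans ?_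
    simp only [Finset.sum_const, Finset.card_range, smul_eq_mul]
    nlinarith
  · intro j _
    simp only [tab, goodVal_eq]
    exact natAbs_ind_lt _

theorem step_coins : Carries e₀ 10 11
    (flipFill 10 (eQ * eQ * (eQ + .const e₀))) := by
  refine carries_flipFill fun I ω s hs => ?_
  have hQ := Q_le_β (I := I) (e₀ := e₀)
  have hN : I.Q * I.Q * (I.Q + e₀) ≤ I.β e₀ ^ 3 := by
    calc _ ≤ I.β e₀ * I.β e₀ * I.β e₀ :=
          Nat.mul_le_mul (Nat.mul_le_mul (by omega) (by omega)) (by omega)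
      _ = _ := by ring
  refine Inv.flipFill (fun m hm => ?_) (lt_two_pow_W_of_le hN (by omega)) ?_ hs
  · have h := hm.Q (by omega)
    exact (h.mul h).mul (h.add (ev_const _))
  · have := cost_bound_zero (le_two_pow_k_mul (I := I) hN)
    rwa [zero_add, mul_one] at this

end LCCMInstance

/-! ### Steps for subset sums, matrices, determinants and the answer -/

namespace LCCMInstance

variable {I : LCCMInstance} {e₀ : ℕ} {ω : ℕ → Bool}

theorem one_le_β : 1 ≤ I.β e₀ := by unfold β; omega

theorem zeta_nonneg (a c i S : ℕ) : 0 ≤ zetaStep (I.goodVal a c) i S :=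
  zetaStep_nonneg (fun _ => goodVal_nonneg _ _ _) i S

theorem natAbs_zeta_le {a c i S : ℕ} (hi : i ≤ I.k) :
    (zetaStep (I.goodVal a c) i S).natAbs ≤ 2 ^ I.k := by
  have h1 := zeta_nonneg (I := I) a c i S
  have h2 := zetaStep_le (fun X => goodVal_le_one (I := I) a c X) i S
  have h3 : (2 : ℤ) ^ i ≤ 2 ^ I.k := pow_le_pow_right₀ one_le_two hi
  zify
  rw [abs_of_nonneg h1]
  exact h2.trans h3

/-- The k + 1 rounds are stacked as layers of Q² 2^k cells in one array. Layer 0 copies the goodness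
table; a cell of a later layer reads the layer before it, at S and at S without the current bit. -/
theorem step_zeta : Carries e₀ 9 10
    (sumFill 9 ((eK + 1) * eQ * eQ * eP) 0 0 (.cond (.isLt vJ (eQ * eQ * eP)) (.get 8 vJ)
      (.get 9 (vJ - eQ * eQ * eP) + vJ % eP / .get 4 (vJ / eP / eQ / eQ - 1) % 2 *
        .get 9 (vJ - eQ * eQ * eP - .get 4 (vJ / eP / eQ / eQ - 1))))) := by
  refine carries_sumFill fun I ω s hs => ?_
  have hk := k_lt_Q (I := I)
  have hQβ := Q_le_β (I := I) (e₀ := e₀)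
  have hN : (I.k + 1) * I.Q * I.Q * 2 ^ I.k ≤ 2 ^ I.k * I.β e₀ ^ 3 := by
    rw [mul_comm]
    refine Nat.mul_le_mul_left _ ?_
    calc _ ≤ I.β e₀ * I.β e₀ * I.β e₀ :=
          Nat.mul_le_mul (Nat.mul_le_mul (by omega) (by omega)) (by omega)
      _ = _ := by ring
  refine Inv.sumFill (T := 9) (Mm := 0) (fun _ _ => 0) (by omega)
    (fun m hm => ((((hm.k (by omega)).add ev_one).mul (hm.Q (by omega))).mul
      (hm.Q (by omega))).mul (hm.P (by omega)))
    (fun m _ => ev_zero) (by omega) ?_ (by simp) ?_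
    (hN.trans_lt (two_pow_k_mul_lt le_rfl (by omega))) (by simp)
    (cost_bound_zero hN) hs
  · intro j hj m hm _
    obtain ⟨x, S, hx, hS, rfl⟩ := exists_eq_mul_add (N := (I.k + 1) * I.Q * I.Q)
      (Q := 2 ^ I.k) hj
    obtain ⟨y, c, hy, hc, rfl⟩ := exists_eq_mul_add hx
    obtain ⟨i, a, hi, ha, rfl⟩ := exists_eq_mul_add hy
    have hQ := hm.avail.Q (by omega)
    have hP := hm.avail.P (by omega)
    have eR := (hQ.mul hQ).mul hP
    have eS := hm.j.mod hP
    have ei := ((hm.j.div hP).div hQ).div hQ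
    rw [mul_add_div_of_lt hS, mul_add_div_of_lt hc, mul_add_div_of_lt ha] at ei
    rw [mul_add_mod_of_lt hS] at eS
    simp only [tab, mul_add_div_of_lt hS, mul_add_mod_of_lt hS, mul_add_div_of_lt hc,
      mul_add_mod_of_lt hc, mul_add_div_of_lt ha, mul_add_mod_of_lt ha]
    rcases i with _ | i
    · have hlt : ((0 * I.Q + a) * I.Q + c) * 2 ^ I.k + S < I.Q * I.Q * 2 ^ I.k :=
        mul_add_lt_mul (mul_add_lt_mul (by omega) hc) hS
      rw [eval_cond_pos (hm.j.isLt eR) hlt, hm.j.get, hm.avail 8 (by omega) _ hlt]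
      simp only [tab, mul_add_div_of_lt hS, mul_add_mod_of_lt hS, mul_add_div_of_lt hc,
        mul_add_mod_of_lt hc, zero_mul, zero_add, zetaStep]
    -- The same entry in the previous layer lies exactly one layer length earlier.
    · have hj' : (((i + 1) * I.Q + a) * I.Q + c) * 2 ^ I.k + S =
          ((i * I.Q + a) * I.Q + c) * 2 ^ I.k + S + I.Q * I.Q * 2 ^ I.k := by ring
      have hR : 0 < I.Q * I.Q * 2 ^ I.k := by
        have : 0 < I.Q := by omega
        positivity
      rw [eval_cond_neg (hm.j.isLt eR) (by omega)]
      have e1 := hm.j.sub eR (by omega)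
      rw [show (((i + 1) * I.Q + a) * I.Q + c) * 2 ^ I.k + S - I.Q * I.Q * 2 ^ I.k =
        ((i * I.Q + a) * I.Q + c) * 2 ^ I.k + S by omega] at e1
      have ei' := ei.sub ev_one (by omega)
      rw [Nat.add_sub_cancel] at ei'
      rw [eval_add, eval_mul, hm.avail.testBit (by omega) ei' eS (by omega), e1.get,
        hm.own _ (by omega), zetaStep]
      congr 1
      · simp only [tab, mul_add_div_of_lt hS, mul_add_mod_of_lt hS, mul_add_div_of_lt hc,
          mul_add_mod_of_lt hc, mul_add_div_of_lt ha, mul_add_mod_of_lt ha]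
      · by_cases hb : S.testBit i = true
        · rw [ind_pos hb, one_mul, if_pos hb]
          have hle := (testBit_sub_two_pow hb).1
          have hS' : S - 2 ^ i < 2 ^ I.k := (Nat.sub_le _ _).trans_lt hS
          have e2 := e1.sub (hm.avail.pow (by omega) ei' (by omega)) (by omega)
          rw [Nat.add_sub_assoc hle] at e2
          rw [e2.get, hm.own _ (by rw [hj']; have := Nat.sub_le S (2 ^ i); omega)]
          simp only [tab, mul_add_div_of_lt hS', mul_add_mod_of_lt hS', mul_add_div_of_lt hc,
            mul_add_mod_of_lt hc, mul_add_div_of_lt ha, mul_add_mod_of_lt ha]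
        · rw [ind_neg hb, zero_mul, if_neg hb]
  · intro j hj
    obtain ⟨x, S, hx, hS, rfl⟩ := exists_eq_mul_add (N := (I.k + 1) * I.Q * I.Q)
      (Q := 2 ^ I.k) hj
    obtain ⟨y, c, hy, hc, rfl⟩ := exists_eq_mul_add hx
    obtain ⟨i, a, hi, ha, rfl⟩ := exists_eq_mul_add hy
    simp only [tab, mul_add_div_of_lt hS, mul_add_div_of_lt hc, mul_add_div_of_lt ha]
    refine (natAbs_zeta_le (by omega)).trans_lt ?_
    have := two_pow_k_mul_lt (I := I) (e₀ := e₀) (i := 0) (z := 1) le_rfl (by omega)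
    rwa [mul_one] at this

theorem matEntry_mat {S a c : ℕ} (b : ℕ) (ha : a < I.Q) (hc : c < I.Q) :
    matEntry (I.mat b ω S) a c =
      randInt b ω (a * I.Q + c) * zetaStep (I.goodVal a c) I.k S := by
  simp [matEntry, ha, hc, mat]

theorem natAbs_randInt_lt (b t : ℕ) : (randInt b ω t).natAbs < 2 ^ b := by
  have h1 := sum_bits_nonneg (fun i => ω (t * b + i)) b
  have h2 := sum_bits_lt (fun i => ω (t * b + i)) b
  zify
  rw [randInt, abs_of_nonneg h1]
  exact h2

theorem natAbs_matEntry_mat_le (b S a c : ℕ) :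
    (matEntry (I.mat b ω S) a c).natAbs ≤ 2 ^ (b + I.k) := by
  by_cases h : a < I.Q ∧ c < I.Q
  · rw [matEntry_mat b h.1 h.2, Int.natAbs_mul, pow_add]
    exact Nat.mul_le_mul (natAbs_randInt_lt _ _).le (natAbs_zeta_le le_rfl)
  · simp [matEntry, h]

/-- The bound for the entries of the powers of the matrices. -/
theorem lt_two_pow_W_of_le_pow {z i : ℕ} (hi : i ≤ I.Q)
    (hz : z ≤ 2 ^ I.k * (I.Q * (I.Q * 2 ^ (I.Q + e₀ + I.k)) ^ i)) : z < 2 ^ I.W e₀ := by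
  have hk := k_lt_Q (I := I)
  have hQβ := Q_le_β (I := I) (e₀ := e₀)
  have h2 := two_le_β (I := I) (e₀ := e₀)
  have hQ : I.Q < 2 ^ I.β e₀ := (show I.Q < I.β e₀ by omega).trans Nat.lt_two_pow_self
  -- Here Q ≤ 2^β and Q + e₀ + k ≤ 2β. With exponent i ≤ Q < β, this yields numbers of O(β²) bits.
  have hbase : I.Q * 2 ^ (I.Q + e₀ + I.k) ≤ 2 ^ (3 * I.β e₀) := by
    calc _ ≤ 2 ^ I.β e₀ * 2 ^ (2 * I.β e₀) :=
          Nat.mul_le_mul hQ.le (Nat.pow_le_pow_right two_pos (by omega))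
      _ = _ := by rw [← pow_add]; congr 1; ring
  refine lt_two_pow_W (x := I.β e₀ + (I.β e₀ + 3 * I.β e₀ * i)) (hz.trans_lt ?_) ?_
  · rw [pow_add 2 (I.β e₀), pow_add 2 (I.β e₀), pow_mul 2 (3 * I.β e₀)]
    refine lt_of_lt_of_le (Nat.mul_lt_mul_of_lt_of_le (c := 2 ^ I.β e₀)
      (Nat.pow_lt_pow_right one_lt_two (by omega))
      (Nat.mul_le_mul hQ.le (Nat.pow_le_pow_left hbase i)) (by positivity)) le_rfl
  · have : I.β e₀ * i ≤ I.β e₀ * I.β e₀ := Nat.mul_le_mul_left _ (by omega)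
    nlinarith

theorem natAbs_matEntry_pow_le (b S i a c : ℕ) :
    (matEntry (I.mat b ω S ^ i) a c).natAbs ≤ (I.Q * 2 ^ (b + I.k)) ^ i := by
  rcases i with _ | i
  · by_cases h : a < I.Q ∧ c < I.Q
    · rw [pow_zero, matEntry_one h.1 h.2]
      split_ifs <;> simp
    · simp [matEntry, h]
  · refine le_trans ?_ (mul_natAbs_matEntry_pow_le (natAbs_matEntry_mat_le (ω := ω) b S) i a c)
    exact Nat.le_mul_of_pos_left _ (by have := k_lt_Q (I := I); omega)

theorem le_two_pow_k_mul_Q_mul (z : ℕ) : z ≤ 2 ^ I.k * (I.Q * z) := by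
  rw [← mul_assoc]
  refine Nat.le_mul_of_pos_left _ (Nat.mul_pos (Nat.two_pow_pos _) ?_)
  have := k_lt_Q (I := I)
  omega

/-- The inner sum assembles the weight from its block of tosses, which depends on (a, c) only; the
sieve needs the same weights for every S. From this table on, S is the slowest index instead of the
fastest. -/
theorem step_mat : Carries e₀ 11 12
    (sumFill 11 (eP * eQ * eQ) (eQ + .const e₀)
      (.get 10 ((vJ / eQ % eQ * eQ + vJ % eQ) * (eQ + .const e₀) + vI) * .get 4 vI)
      (vAcc * .get 9 (((eK * eQ + vJ / eQ % eQ) * eQ + vJ % eQ) * eP + vJ / eQ / eQ))) := by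
  refine carries_sumFill fun I ω s hs => ?_
  have hQβ := Q_le_β (I := I) (e₀ := e₀)
  have h2 := two_le_β (I := I) (e₀ := e₀)
  have hN : 2 ^ I.k * I.Q * I.Q ≤ 2 ^ I.k * I.β e₀ ^ 3 := by
    rw [mul_assoc]
    refine Nat.mul_le_mul_left _ ?_
    calc _ ≤ I.β e₀ * I.β e₀ := Nat.mul_le_mul (by omega) (by omega)
      _ = I.β e₀ ^ 2 := by ring
      _ ≤ _ := Nat.pow_le_pow_right (by omega) (by omega)
  have hM : I.Q + e₀ ≤ I.β e₀ ^ 2 := by nlinarith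
  have hbits : ∀ t, (randInt (I.Q + e₀) ω t).natAbs < 2 ^ I.W e₀ := fun t =>
    lt_two_pow_W (natAbs_randInt_lt _ _) (by nlinarith)
  refine Inv.sumFill (T := 11) (Mm := I.Q + e₀)
    (fun j i => (if ω ((j / I.Q % I.Q * I.Q + j % I.Q) * (I.Q + e₀) + i) then 1 else 0) * 2 ^ i)
    (by omega) (fun m hm => ((hm.P (by omega)).mul (hm.Q (by omega))).mul (hm.Q (by omega)))
    (fun m hm => (hm.Q (by omega)).add (ev_const _)) ?_ ?_ ?_ ?_
    (hN.trans_lt (two_pow_k_mul_lt le_rfl (by omega))) (lt_two_pow_W_of_le hM (by omega))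
    (cost_bound hN hM) hs
  · intro j hj i hi m hm hI
    obtain ⟨x, c, hx, hc, rfl⟩ := exists_eq_mul_add (N := 2 ^ I.k * I.Q) (Q := I.Q) hj
    obtain ⟨S, a, hS, ha, rfl⟩ := exists_eq_mul_add hx
    have hQ := hm.avail.Q (by omega)
    have hI := ev_vI hI
    have ea := (hm.j.div hQ).mod hQ
    have ec := hm.j.mod hQ
    rw [mul_add_div_of_lt hc, mul_add_mod_of_lt ha] at ea
    rw [mul_add_mod_of_lt hc] at ec
    simp only [mul_add_div_of_lt hc, mul_add_mod_of_lt hc, mul_add_mod_of_lt ha]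
    have e1 := (((ea.mul hQ).add ec).mul (hQ.add (ev_const e₀))).add hI
    rw [eval_mul, e1.get, hm.avail 10 (by omega) _ (mul_add_lt_mul (mul_add_lt_mul ha hc) hi),
      (hm.avail.pow (by omega) hI hi.le : _ = _)]
    simp only [tab]
    push_cast
    rfl
  · intro j hj m hm hA
    obtain ⟨x, c, hx, hc, rfl⟩ := exists_eq_mul_add (N := 2 ^ I.k * I.Q) (Q := I.Q) hj
    obtain ⟨S, a, hS, ha, rfl⟩ := exists_eq_mul_add hx
    have hQ := hm.avail.Q (by omega)
    have ea := (hm.j.div hQ).mod hQ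
    have eS := (hm.j.div hQ).div hQ
    have ec := hm.j.mod hQ
    rw [mul_add_div_of_lt hc, mul_add_mod_of_lt ha] at ea
    rw [mul_add_div_of_lt hc, mul_add_div_of_lt ha] at eS
    rw [mul_add_mod_of_lt hc] at ec
    simp only [mul_add_div_of_lt hc, mul_add_mod_of_lt hc, mul_add_mod_of_lt ha,
      mul_add_div_of_lt ha, tab] at hA ⊢
    have e1 := (((((hm.avail.k (by omega)).mul hQ).add ea).mul hQ).add ec).mul
      (hm.avail.P (by omega)) |>.add eS
    rw [eval_mul, eval_vAcc, hA, e1.get, hm.avail 9 (by omega) _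
      (mul_add_lt_mul (mul_add_lt_mul (mul_add_lt_mul (Nat.lt_succ_self _) ha) hc) hS),
      matEntry_mat _ ha hc]
    simp only [tab, mul_add_div_of_lt hS, mul_add_mod_of_lt hS, mul_add_div_of_lt hc,
      mul_add_mod_of_lt hc, mul_add_div_of_lt ha, mul_add_mod_of_lt ha, randInt]
  · intro j _
    refine lt_of_eq_of_lt ?_ (hbits (j / I.Q % I.Q * I.Q + j % I.Q))
    zify
    rw [randInt, abs_of_nonneg (sum_bits_nonneg (fun i =>
      ω ((j / I.Q % I.Q * I.Q + j % I.Q) * (I.Q + e₀) + i)) _)]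
    refine Finset.sum_congr rfl fun i _ => abs_of_nonneg ?_
    split_ifs <;> positivity
  · intro j _
    simp only [tab]
    have h := natAbs_matEntry_pow_le (I := I) (ω := ω) (I.Q + e₀) (j / I.Q / I.Q) 1
      (j / I.Q % I.Q) (j % I.Q)
    rw [pow_one] at h
    exact lt_two_pow_W_of_le_pow (i := 1) (by have := k_lt_Q (I := I); omega)
      (h.trans (le_two_pow_k_mul_Q_mul _))

/-- Exponents run from 0 to Q, and the block before that of (S, i + 1) holds the i-th power for the
same S. Exponent 0 is treated separately, so no cell reads the block of another set. -/
theorem step_powers : Carries e₀ 12 13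
    (sumFill 12 (eP * (eQ + 1) * eQ * eQ) eQ
      (.cond (.isEq (vJ / eQ / eQ % (eQ + 1)) 0) 0
        (.get 12 (((vJ / eQ / eQ - 1) * eQ + vJ / eQ % eQ) * eQ + vI) *
          .get 11 ((vJ / eQ / eQ / (eQ + 1) * eQ + vI) * eQ + vJ % eQ)))
      (.cond (.isEq (vJ / eQ / eQ % (eQ + 1)) 0) (.isEq (vJ / eQ % eQ) (vJ % eQ)) vAcc)) := by
  refine carries_sumFill fun I ω s hs => ?_
  have hQβ := Q_le_β (I := I) (e₀ := e₀)
  have h2 := two_le_β (I := I) (e₀ := e₀)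
  have hk := k_lt_Q (I := I)
  have hN : 2 ^ I.k * (I.Q + 1) * I.Q * I.Q ≤ 2 ^ I.k * I.β e₀ ^ 3 := by
    calc _ = 2 ^ I.k * ((I.Q + 1) * I.Q * I.Q) := by ring
      _ ≤ 2 ^ I.k * (I.β e₀ * I.β e₀ * I.β e₀) := Nat.mul_le_mul_left _
          (Nat.mul_le_mul (Nat.mul_le_mul (by omega) (by omega)) (by omega))
      _ = _ := by ring
  have hM : I.Q ≤ I.β e₀ ^ 2 := by nlinarith
  refine Inv.sumFill (T := 12) (Mm := I.Q)
    (fun j l => if j / I.Q / I.Q % (I.Q + 1) = 0 then 0 else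
      matEntry (I.mat (I.Q + e₀) ω (j / I.Q / I.Q / (I.Q + 1)) ^
        (j / I.Q / I.Q % (I.Q + 1) - 1)) (j / I.Q % I.Q) l *
      matEntry (I.mat (I.Q + e₀) ω (j / I.Q / I.Q / (I.Q + 1))) l (j % I.Q))
    (by omega) (fun m hm => (((hm.P (by omega)).mul ((hm.Q (by omega)).add ev_one)).mul
      (hm.Q (by omega))).mul (hm.Q (by omega)))
    (fun m hm => hm.Q (by omega)) ?_ ?_ ?_ ?_
    (hN.trans_lt (two_pow_k_mul_lt le_rfl (by omega))) (lt_two_pow_W_of_le hM (by omega))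
    (cost_bound hN hM) hs
  · intro j hj l hl m hm hI
    obtain ⟨x, c, hx, hc, rfl⟩ := exists_eq_mul_add (N := 2 ^ I.k * (I.Q + 1) * I.Q) (Q := I.Q) hj
    obtain ⟨y, a, hy, ha, rfl⟩ := exists_eq_mul_add hx
    obtain ⟨S, i, hS, hi, rfl⟩ := exists_eq_mul_add hy
    have hQ := hm.avail.Q (by omega)
    have hI := ev_vI hI
    have ea := (hm.j.div hQ).mod hQ
    have ey := (hm.j.div hQ).div hQ
    have ec := hm.j.mod hQ
    rw [mul_add_div_of_lt hc, mul_add_mod_of_lt ha] at ea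
    rw [mul_add_div_of_lt hc, mul_add_div_of_lt ha] at ey
    rw [mul_add_mod_of_lt hc] at ec
    have ei := ey.mod (hQ.add ev_one)
    have eS := ey.div (hQ.add ev_one)
    rw [mul_add_mod_of_lt hi] at ei
    rw [mul_add_div_of_lt hi] at eS
    simp only [mul_add_div_of_lt hc, mul_add_mod_of_lt hc, mul_add_mod_of_lt ha,
      mul_add_div_of_lt ha, mul_add_div_of_lt hi, mul_add_mod_of_lt hi]
    rcases i with _ | i
    · rw [eval_cond_pos (ei.isEq ev_zero) rfl]
      simp
    · rw [eval_cond_neg (ei.isEq ev_zero) (Nat.succ_ne_zero _), if_neg (Nat.succ_ne_zero _)]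
      have hi' : i < I.Q + 1 := by omega
      have e1 := (((ey.sub ev_one (by omega)).mul hQ).add ea).mul hQ |>.add hI
      rw [show S * (I.Q + 1) + (i + 1) - 1 = S * (I.Q + 1) + i by omega] at e1
      have e2 := (((eS.mul hQ).add hI).mul hQ).add ec
      have hlt : ((S * (I.Q + 1) + i) * I.Q + a) * I.Q + l <
          ((S * (I.Q + 1) + (i + 1)) * I.Q + a) * I.Q + c := by
        calc ((S * (I.Q + 1) + i) * I.Q + a) * I.Q + l
            < ((S * (I.Q + 1) + (i + 1)) * I.Q + a) * I.Q :=
              mul_add_lt_mul (by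
                have : (S * (I.Q + 1) + (i + 1)) * I.Q = (S * (I.Q + 1) + i) * I.Q + I.Q := by ring
                omega) hl
          _ ≤ _ := Nat.le_add_right _ _
      rw [eval_mul, e1.get, hm.own _ hlt, e2.get,
        hm.avail 11 (by omega) _ (mul_add_lt_mul (mul_add_lt_mul hS hl) hc)]
      simp only [tab, mul_add_div_of_lt hc, mul_add_mod_of_lt hc, mul_add_mod_of_lt ha,
        mul_add_div_of_lt ha, mul_add_div_of_lt hi', mul_add_mod_of_lt hi', mul_add_div_of_lt hl,
        mul_add_mod_of_lt hl, Nat.add_sub_cancel]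
  · intro j hj m hm hA
    obtain ⟨x, c, hx, hc, rfl⟩ := exists_eq_mul_add (N := 2 ^ I.k * (I.Q + 1) * I.Q) (Q := I.Q) hj
    obtain ⟨y, a, hy, ha, rfl⟩ := exists_eq_mul_add hx
    obtain ⟨S, i, hS, hi, rfl⟩ := exists_eq_mul_add hy
    have hQ := hm.avail.Q (by omega)
    have ea := (hm.j.div hQ).mod hQ
    have ey := (hm.j.div hQ).div hQ
    have ec := hm.j.mod hQ
    rw [mul_add_div_of_lt hc, mul_add_mod_of_lt ha] at ea
    rw [mul_add_div_of_lt hc, mul_add_div_of_lt ha] at ey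
    rw [mul_add_mod_of_lt hc] at ec
    have ei := ey.mod (hQ.add ev_one)
    rw [mul_add_mod_of_lt hi] at ei
    simp only [mul_add_div_of_lt hc, mul_add_mod_of_lt hc, mul_add_mod_of_lt ha,
      mul_add_div_of_lt ha, mul_add_div_of_lt hi, mul_add_mod_of_lt hi, tab] at hA ⊢
    rcases i with _ | i
    · rw [eval_cond_pos (ei.isEq ev_zero) rfl, ea.isEq ec, pow_zero, matEntry_one ha hc,
        ind_eq_ite]
    · rw [eval_cond_neg (ei.isEq ev_zero) (Nat.succ_ne_zero _), eval_vAcc, hA, pow_succ,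
        matEntry_mul _ _ ha hc]
      rfl
  · intro j hj
    have hi : j / I.Q / I.Q % (I.Q + 1) ≤ I.Q := Nat.lt_succ_iff.1 (Nat.mod_lt _ (by omega))
    generalize j / I.Q / I.Q % (I.Q + 1) = i at *
    rcases i with _ | i
    · simp
    · refine lt_two_pow_W_of_le_pow hi (le_trans ?_ (le_two_pow_k_mul_Q_mul _))
      calc _ ≤ ∑ l ∈ Finset.range I.Q, (I.Q * 2 ^ (I.Q + e₀ + I.k)) ^ i *
            2 ^ (I.Q + e₀ + I.k) := by
            refine Finset.sum_le_sum fun l _ => ?_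
            rw [if_neg (Nat.succ_ne_zero _), Int.natAbs_mul]
            exact Nat.mul_le_mul (natAbs_matEntry_pow_le _ _ _ _ _) (natAbs_matEntry_mat_le _ _ _ _)
        _ = _ := by
            rw [Finset.sum_const, Finset.card_range, smul_eq_mul]
            ring
  · intro j hj
    have hi : j / I.Q / I.Q % (I.Q + 1) ≤ I.Q := Nat.lt_succ_iff.1 (Nat.mod_lt _ (by omega))
    exact lt_two_pow_W_of_le_pow hi
      ((natAbs_matEntry_pow_le _ _ _ _ _).trans (le_two_pow_k_mul_Q_mul _))

theorem step_trace : Carries e₀ 13 14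
    (sumFill 13 (eP * (eQ + 1)) eQ (.get 12 ((vJ * eQ + vI) * eQ + vI)) vAcc) := by
  refine carries_sumFill fun I ω s hs => ?_
  have hQβ := Q_le_β (I := I) (e₀ := e₀)
  have h2 := two_le_β (I := I) (e₀ := e₀)
  have hN : 2 ^ I.k * (I.Q + 1) ≤ 2 ^ I.k * I.β e₀ ^ 3 :=
    Nat.mul_le_mul_left _ ((show I.Q + 1 ≤ I.β e₀ by omega).trans (β_le_pow three_ne_zero))
  have hM : I.Q ≤ I.β e₀ ^ 2 := by nlinarith
  have hb : ∀ j, ∑ l ∈ Finset.range I.Q, (matEntry (I.mat (I.Q + e₀) ω (j / (I.Q + 1)) ^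
      (j % (I.Q + 1))) l l).natAbs < 2 ^ I.W e₀ := by
    intro j
    have hi : j % (I.Q + 1) ≤ I.Q := Nat.lt_succ_iff.1 (Nat.mod_lt _ (by omega))
    refine lt_two_pow_W_of_le_pow hi (le_trans ?_ (Nat.le_mul_of_pos_left _ (Nat.two_pow_pos _)))
    refine (Finset.sum_le_sum fun l _ => natAbs_matEntry_pow_le _ _ _ _ _).trans ?_
    simp
  refine Inv.sumFill (T := 13) (Mm := I.Q)
    (fun j l => matEntry (I.mat (I.Q + e₀) ω (j / (I.Q + 1)) ^ (j % (I.Q + 1))) l l)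
    (by omega) (fun m hm => (hm.P (by omega)).mul ((hm.Q (by omega)).add ev_one))
    (fun m hm => hm.Q (by omega)) ?_ ?_ (fun j _ => hb j) ?_
    (hN.trans_lt (two_pow_k_mul_lt le_rfl (by omega))) (lt_two_pow_W_of_le hM (by omega))
    (cost_bound hN hM) hs
  · intro j hj l hl m hm hI
    have hQ := hm.avail.Q (by omega)
    have hI := ev_vI hI
    have e1 := (((hm.j.mul hQ).add hI).mul hQ).add hI
    rw [e1.get, hm.avail 12 (by omega) _ (mul_add_lt_mul (mul_add_lt_mul hj hl) hl)]
    simp only [tab, mul_add_div_of_lt hl, mul_add_mod_of_lt hl]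
  · intro j hj m hm hA
    rw [eval_vAcc, hA]
    simp only [tab, trace_eq_sum_matEntry]
  · intro j hj
    simp only [tab, trace_eq_sum_matEntry]
    exact (Int.natAbs_sum_le _ _).trans_lt (hb j)

theorem sum_range_ite_lt {M : Type*} [AddCommMonoid M] {t Q : ℕ} (h : t ≤ Q) (f : ℕ → M) :
    ∑ i ∈ Finset.range Q, (if i < t then f i else 0) = ∑ i ∈ Finset.range t, f i := by
  rw [← Finset.sum_filter]
  congr 1
  ext i
  simp only [Finset.mem_filter, Finset.mem_range]
  omega

/-- Newton's identities row by row. The inner loop always runs Q times, so terms with i ≥ t are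
masked by 0; the coefficients read at offset t - 1 - i are earlier cells of the same table. -/
theorem step_charpoly : Carries e₀ 14 15
    (sumFill 14 (eP * (eQ + 1)) eQ
      (.cond (.isLt vI (vJ % (eQ + 1)))
        (.get 14 (vJ - 1 - vI) * .get 13 (vJ / (eQ + 1) * (eQ + 1) + (vI + 1))) 0)
      (.cond (.isEq (vJ % (eQ + 1)) 0) 1 ((0 - vAcc) / (vJ % (eQ + 1))))) := by
  refine carries_sumFill fun I ω s hs => ?_
  have hQβ := Q_le_β (I := I) (e₀ := e₀)
  have h2 := two_le_β (I := I) (e₀ := e₀)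
  have hN : 2 ^ I.k * (I.Q + 1) ≤ 2 ^ I.k * I.β e₀ ^ 3 :=
    Nat.mul_le_mul_left _ ((show I.Q + 1 ≤ I.β e₀ by omega).trans (β_le_pow three_ne_zero))
  have hM : I.Q ≤ I.β e₀ ^ 2 := by nlinarith
  have hmod : ∀ j, j % (I.Q + 1) ≤ I.Q := fun j => Nat.lt_succ_iff.1 (Nat.mod_lt _ (by omega))
  have hrev := fun (S t : ℕ) (ht : t ≤ I.Q) => natAbs_revCharCoeff_le
    (natAbs_matEntry_mat_le (I := I) (ω := ω) (I.Q + e₀) S) ht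
  refine Inv.sumFill (T := 14) (Mm := I.Q)
    (fun j i => if i < j % (I.Q + 1) then
      (I.mat (I.Q + e₀) ω (j / (I.Q + 1))).revCharCoeff (j % (I.Q + 1) - 1 - i) *
      (I.mat (I.Q + e₀) ω (j / (I.Q + 1)) ^ (i + 1)).trace else 0)
    (by omega) (fun m hm => (hm.P (by omega)).mul ((hm.Q (by omega)).add ev_one))
    (fun m hm => hm.Q (by omega)) ?_ ?_ ?_ ?_
    (hN.trans_lt (two_pow_k_mul_lt le_rfl (by omega))) (lt_two_pow_W_of_le hM (by omega))
    (cost_bound hN hM) hs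
  · intro j hj i hi m hm hI
    obtain ⟨S, t, hS, ht, rfl⟩ := exists_eq_mul_add (N := 2 ^ I.k) (Q := I.Q + 1) hj
    have hQ := (hm.avail.Q (by omega)).add ev_one
    have hI := ev_vI hI
    have et := hm.j.mod hQ
    have eS := hm.j.div hQ
    rw [mul_add_mod_of_lt ht] at et ⊢
    rw [mul_add_div_of_lt ht] at eS ⊢
    by_cases hit : i < t
    · have e1 := (hm.j.sub ev_one (by omega)).sub hI (by omega)
      rw [show S * (I.Q + 1) + t - 1 - i = S * (I.Q + 1) + (t - 1 - i) by omega] at e1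
      have ht' : t - 1 - i < I.Q + 1 := by omega
      have hi' : i + 1 < I.Q + 1 := by omega
      have e2 := (eS.mul hQ).add (hI.add ev_one)
      rw [eval_cond_pos (hI.isLt et) hit, if_pos hit, eval_mul, e1.get, hm.own _ (by omega), e2.get,
        hm.avail 13 (by omega) _ (mul_add_lt_mul hS hi')]
      simp only [tab, mul_add_div_of_lt ht', mul_add_mod_of_lt ht', mul_add_div_of_lt hi',
        mul_add_mod_of_lt hi']
    · rw [eval_cond_neg (hI.isLt et) hit, if_neg hit, eval_zero]
  · intro j hj m hm hA
    obtain ⟨S, t, hS, ht, rfl⟩ := exists_eq_mul_add (N := 2 ^ I.k) (Q := I.Q + 1) hj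
    have hQ := (hm.avail.Q (by omega)).add ev_one
    have et := hm.j.mod hQ
    rw [mul_add_mod_of_lt ht] at et
    simp only [tab, mul_add_mod_of_lt ht, mul_add_div_of_lt ht] at hA ⊢
    rw [sum_range_ite_lt (by omega)] at hA
    rcases t with _ | t
    · rw [eval_cond_pos (et.isEq ev_zero) rfl, Matrix.revCharCoeff_zero, eval_one]
    · rw [eval_cond_neg (et.isEq ev_zero) (Nat.succ_ne_zero _), eval_div, eval_sub, eval_zero,
        eval_vAcc, hA, (et : _ = _), zero_sub, revCharCoeff_succ (by omega)]
      rfl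
  · intro j _
    have h1 := hmod j
    have h2 := fun s => (hrev (j / (I.Q + 1)) _ h1).2 s
    generalize j % (I.Q + 1) = t at *
    simp only [apply_ite Int.natAbs, Int.natAbs_zero]
    rw [sum_range_ite_lt h1]
    rcases t with _ | t
    · simp
    · refine lt_two_pow_W_of_le_pow h1 ((h2 t rfl).trans ?_)
      exact (Nat.mul_le_mul_right _ h1).trans (Nat.le_mul_of_pos_left _ (Nat.two_pow_pos _))
  · intro j _
    exact lt_two_pow_W_of_le_pow (hmod j) ((hrev _ _ (hmod j)).1.trans (le_two_pow_k_mul_Q_mul _))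

theorem step_answer : Carries e₀ 15 16
    (sumFill 15 1 eP (.get 5 vI * .get 14 (vI * (eQ + 1) + eQ)) vAcc) := by
  refine carries_sumFill fun I ω s hs => ?_
  have h2 := two_le_β (I := I) (e₀ := e₀)
  have hb : ∑ S ∈ Finset.range (2 ^ I.k), (bitSign I.k S *
      (I.mat (I.Q + e₀) ω S).revCharCoeff I.Q).natAbs < 2 ^ I.W e₀ := by
    refine lt_two_pow_W_of_le_pow le_rfl (le_trans ?_
      (Nat.mul_le_mul_left _ (Nat.le_mul_of_pos_left _ (by have := k_lt_Q (I := I); omega))))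
    calc _ ≤ ∑ S ∈ Finset.range (2 ^ I.k), (I.Q * 2 ^ (I.Q + e₀ + I.k)) ^ I.Q := by
          refine Finset.sum_le_sum fun S _ => ?_
          rw [Int.natAbs_mul, natAbs_bitSign, one_mul]
          exact (natAbs_revCharCoeff_le (natAbs_matEntry_mat_le (I.Q + e₀) S) le_rfl).1
      _ = _ := by simp
  have hP := two_pow_k_mul_lt (I := I) (e₀ := e₀) (i := 0) (z := 1) le_rfl (by omega)
  rw [mul_one] at hP
  refine Inv.sumFill (T := 15) (Mm := 2 ^ I.k)
    (fun _ S => bitSign I.k S * (I.mat (I.Q + e₀) ω S).revCharCoeff I.Q)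
    (by omega) (fun m hm => ev_one) (fun m hm => hm.P (by omega)) ?_ ?_ (fun j _ => hb) ?_
    one_lt_two_pow_W hP ?_ hs
  · intro j hj S hS m hm hI
    have hQ := hm.avail.Q (by omega)
    have hI := ev_vI hI
    have hQ1 : I.Q < I.Q + 1 := Nat.lt_succ_self _
    have e1 := (hI.mul (hQ.add ev_one)).add hQ
    rw [eval_mul, hI.get, hm.avail 5 (by omega) S hS, e1.get, hm.avail 14 (by omega) _
      (mul_add_lt_mul hS hQ1)]
    simp only [tab, mul_add_div_of_lt hQ1, mul_add_mod_of_lt hQ1]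
  · intro j hj m hm hA
    rw [eval_vAcc, hA]
    rfl
  · intro j _
    exact (Int.natAbs_sum_le _ _).trans_lt hb
  · have hp := Nat.one_le_two_pow (n := I.k)
    have h4 : 4 ≤ I.β e₀ ^ 7 := by
      calc 4 ≤ 2 ^ 7 := by norm_num
        _ ≤ _ := Nat.pow_le_pow_left h2 7
    change (1 + 1) * (2 ^ I.k + 1) ≤ _
    nlinarith

/-! ### The algorithm -/

theorem inv_init : I.Inv e₀ ω 2 (RamState.init I.encode ω) where
  avail a ha j hj := by
    interval_cases a
    · simp [RamState.init, tab, word]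
    -- Array 1 is reserved for the output and counts as a table of size 0.
    · simp [sz] at hj
  bounded a i := by
    have h : ∀ p, (I.encode.getD p 0) < 2 ^ I.W e₀ := fun p =>
      (I.word_lt_two_pow_size p).trans_le (Nat.pow_le_pow_right two_pos (Nat.le_add_right _ _))
    simp only [RamState.init]
    split_ifs
    · rw [Int.natAbs_natCast]; exact h _
    · simp
  coins _ := rfl

theorem exists_carries (e₀ : ℕ) : ∃ p, Carries e₀ 2 16 p :=
  ⟨_, (((((((((((((step_start (e₀ := e₀)).seq step_rank).seq step_pow).seq step_sign).seq
    step_allow).seq step_conflicts).seq step_good).seq step_zeta).seq step_coins).seq step_mat).seq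
    step_powers).seq step_trace).seq step_charpoly).seq step_answer⟩

/-- The randomized algorithm. -/
theorem exists_algorithm (e₀ : ℕ) : ∃ (p : RamProg) (K : ℕ), ∀ (I : LCCMInstance) (ω : ℕ → Bool),
    p.Runs (RamState.init I.encode ω) (K * (I.W e₀ * (2 ^ I.k * I.β e₀ ^ 7)))
      fun s => s.mem 1 0 = I.answer (I.Q + e₀) ω := by
  obtain ⟨p, K, h⟩ := exists_carries e₀
  refine ⟨.seq p (.store 1 0 (.get 15 0)), K + RamProg.storeFactor 0 (.get 15 0), fun I ω => ?_⟩
  rw [add_mul]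
  refine (h I ω _ inv_init).seq (q := .store 1 0 (.get 15 0)) fun s hs => ?_
  refine (RamProg.runs_store one_le_W 1 0 (.get 15 0) hs.bounded ?_).mono
    (Nat.mul_le_mul_left _ (Nat.le_mul_of_pos_right _ ?_)) fun _ h => h
  · simp only [RamMem.set_apply, eval_zero, and_self, if_true, eval_get]
    exact hs.avail 15 (by omega) 0 Nat.one_pos
  · have := one_le_β (I := I) (e₀ := e₀)
    positivity

/-- As β ≤ (e₀ + 3)|I|, the bit bound `W` contributes |I|² and the iteration count |I|⁷, which gives
the exponent 9. -/
theorem time_le (I : LCCMInstance) (e₀ K : ℕ) : K * (I.W e₀ * (2 ^ I.k * I.β e₀ ^ 7)) ≤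
    K * 9 * (e₀ + 3) ^ 9 * 2 ^ I.k * I.size ^ 9 := by
  have hQ := I.Q_le_size
  have hn := I.n_lt_Q
  have hβ : I.β e₀ ≤ (e₀ + 3) * I.size := by unfold β; nlinarith
  have hW : I.W e₀ ≤ 9 * ((e₀ + 3) * I.size) ^ 2 := by
    have h1 : I.size ≤ ((e₀ + 3) * I.size) ^ 2 :=
      (Nat.le_mul_of_pos_left _ (by omega)).trans (Nat.le_self_pow two_ne_zero _)
    have h2 := Nat.pow_le_pow_left hβ 2
    unfold W
    omega
  calc _ ≤ K * (9 * ((e₀ + 3) * I.size) ^ 2 * (2 ^ I.k * ((e₀ + 3) * I.size) ^ 7)) := by gcongr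
    _ = _ := by ring

end LCCMInstance

/-- There is an absolute exponent `c` such that, for every error bound `ε > 0`, some randomized
program decides List Coloring Clique Modulator with one-sided error at most `ε`, and halts within
time `C * 2 ^ k * |I| ^ c` on every instance `I` for every outcome of its coin tosses. -/
theorem mainTheorem1 :
    ∃ c : ℕ, ∀ ε : ℝ, 0 < ε → ∃ (P : RamProg) (C : ℕ), ∀ I : LCCMInstance,
      (∀ ω : ℕ → Bool, P.HaltsWithin I.encode ω (C * 2 ^ I.k * I.size ^ c)) ∧
      (I.IsYes → 1 - ε ≤ coinMeasure.real {ω | P.Accepts I.encode ω}) ∧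
      (¬ I.IsYes → ∀ ω : ℕ → Bool, ¬ P.Accepts I.encode ω) := by
  refine ⟨9, fun ε hε => ?_⟩
  -- The number of extra random bits per weight; it affects the program and the constant, not the
  -- exponent.
  obtain ⟨e₀, he⟩ := exists_pow_lt_of_lt_one hε (show (1 / 2 : ℝ) < 1 by norm_num)
  obtain ⟨p, K, hp⟩ := LCCMInstance.exists_algorithm e₀
  refine ⟨p, K * 9 * (e₀ + 3) ^ 9, fun I => ?_⟩
  -- By determinism, the run constructed by `exists_algorithm` is the only one.
  have hacc : ∀ ω, p.Accepts I.encode ω ↔ I.answer (I.Q + e₀) ω ≠ 0 := by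
    intro ω
    obtain ⟨t, s, h1, _, h3⟩ := hp I ω
    constructor
    · rintro ⟨t', s', h1', h3'⟩
      obtain ⟨_, rfl⟩ := h1.unique h1'
      rwa [← h3]
    · intro h
      exact ⟨t, s, h1, by rwa [h3]⟩
  refine ⟨fun ω => ?_, fun hyes => ?_, fun hno ω => ?_⟩
  · obtain ⟨t, s, h1, h2, _⟩ := hp I ω
    exact ⟨t, s, h1, h2.trans (I.time_le e₀ K)⟩
  · simp only [hacc]
    refine le_trans ?_ (I.le_coinMeasure_answer_ne_zero (I.Q + e₀) hyes)
    -- The Q bits in the length Q + e₀ of a weight absorb the degree Q in Schwartz–Zippel, leaving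
    -- the error 2^(-e₀).
    have h1 : (I.Q : ℝ) ≤ 2 ^ I.Q := by exact_mod_cast Nat.lt_two_pow_self.le
    have h2 : (I.Q : ℝ) / 2 ^ (I.Q + e₀) ≤ (1 / 2) ^ e₀ := by
      rw [div_le_iff₀ (by positivity), pow_add, mul_comm ((2 : ℝ) ^ I.Q), ← mul_assoc,
        ← mul_pow]
      norm_num
      exact h1
    linarith
  · rw [hacc, I.answer_eq_zero _ _ hno]
    exact fun h => h rfl
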